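/- Let $\mathfrak g$ be a finite-dimensional simple Lie algebra over $\mathbb C$ of type $A_n$, $D_n$ ($n\ge 4$) or $E_6$, with Cartan matrix $(a_{ij})_{i,j\in I}$, Cartan subalgebra $\mathfrak h=\bigoplus_{i\in I}\mathbb C h_i$ ($h_i$ the simple coroots), simple roots $\alpha_i$, Chevalley generators $e_i,f_i$, and Weyl group $W=\langle s_i\mid i\in I\rangle\subset GL(\mathfrak h^*)$. Let $\sigma\neq 1$ be an automorphism of the Dynkin diagram of $\mathfrak g$. It induces the Lie algebra automorphism of $\mathfrak g$ with $e_i\mapsto e_{\sigma(i)}$, $f_i\mapsto f_{\sigma(i)}$, whose fixed point subalgebra is $\mathfrak g(0)$, and a linear automorphism of $\mathfrak h^*$, also denoted $\sigma$; put $\hat W=\{w\in W\mid \sigma w\sigma^{-1}=w\}$. Let $J$ be the set of $\langle\sigma\rangle$-orbits in $I$. For $p\in J$ let $H_p=\sum_{i\in p}h_i$ if $a_{ij}=0$ for all distinct $i,j\in p$, and $H_p=2\sum_{i\in p}h_i$ otherwise. Let $\mathfrak h(0)=\sum_{p\in J}\mathbb C H_p$ (a Cartan subalgebra of $\mathfrak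 g(0)$), let $\mathrm{res}:\mathfrak h^*\to\mathfrak h(0)^*$ be the restriction, $\beta_p=\mathrm{res}(\alpha_i)$ for $i\in p$, $\tilde s_p(\nu)=\nu-\nu(H_p)\beta_p$, and $\tilde W=\langle\tilde s_p\mid p\in J\rangle$, the Weyl group of $\mathfrak g(0)$. Orders on orbits. On an orbit $W\lambda$ (resp. $\tilde W\,\mathrm{res}(\lambda)$) let $\le_s$ be the reflexive transitive closure of the relations $\mu\le s_\beta(\mu)$, where $\beta$ is a positive root of $\mathfrak g$ (resp. of $\mathfrak g(0)$) with $\mu(\beta^\vee)>0$; let $\le_w$ be defined in the same way with simple roots $\beta$ only. Posets. Let $\mathcal F(P)$ be the set of order filters (upper sets) of a poset $P$. For a map $\kappa:P\to C$ ("coloring"), $c\in C$ and $F\in\mathcal F(P)$, let $A_c(F)$ be the union of all $F'\in\mathcal F(P)$ with $F'\setminus F\subseteq\kappa^{-1}(c)$, let $R_c(F)$ be the intersection of all $F'\in\mathcal F(P)$ with $F\setminus F'\subseteq\kappa^{-1}(c)$, and let $S_c(F)=(A_c(F)\setminus F)\cup R_c(F)$ if this is an order filter, $S_c(F)=F$ otherwise.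 Let $\lambda\ne 0$ be a minuscule weight of $\mathfrak g$, i.e. a dominant integral weight with $(w\lambda)(h_i)\in\{-1,0,1\}$ for all $w\in W$, $i\in I$; then $\lambda=\Lambda_{i_0}$ is a fundamental weight. Let $P_\lambda$ be the connected self-dual d-complete poset (in the sense of Proctor) such that $(W\lambda,\le_s)$ and $(\mathcal F(P_\lambda),\subseteq)$ are isomorphic posets. Let $\kappa:P_\lambda\to I$ be a coloring such that (a) $\kappa$ restricts to a graph isomorphism from the Hasse diagram of the top tree of $P_\lambda$ (the set of $x\in P_\lambda$ such that every $y\ge x$ is covered by at most one element) onto the Dynkin diagram of $\mathfrak g$, (b) the two ends of each interval of $P_\lambda$ that is isomorphic to a double-tailed diamond have the same color, and (c) the maximum of $P_\lambda$ has color $i_0$. Such $(P_\lambda,\kappa)$ exists, and for every such $(P_\lambda,\kappa)$ there is a unique order isomorphism $f:(W\lambda,\le_s)\to(\mathcal F(P_\lambda),\subseteq)$ with $f(s_i\mu)=S_i(f(\mu))$ for all $\mu\in W\lambda$, $i\in I$. The map $\mathrm{res}$ is a bijection from $\hat W\lambda$ onto $\tilde W\,\mathrm{res}(\lambda)$; let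 $\tilde f:\tilde W\,\mathrm{res}(\lambda)\to\mathcal F(P_\lambda)$ be the unique map with $\tilde f(\mathrm{res}(\mu))=f(\mu)$ for $\mu\in\hat W\lambda$, and let $\tilde{\mathcal F}(P_\lambda)$ be its image. For $p\in J$ let $\tilde S_p$ be the map $S_p$ defined as above for the coloring $P_\lambda\xrightarrow{\kappa}I\to J$, and let $\tilde\unlhd$ be the order on $\mathcal F(P_\lambda)$ with $F\,\tilde\unlhd\,F'$ if and only if there are $F=F_0,F_1,\dots,F_n=F'$ in $\mathcal F(P_\lambda)$ ($n\ge0$) and $p_0,\dots,p_{n-1}\in J$ with $\tilde S_{p_k}(F_k)=F_{k+1}\supset F_k$ for all $k$. Then: (1) $\tilde f$ is an isomorphism of posets from $(\tilde W\,\mathrm{res}(\lambda),\le_w)$ onto $(\tilde{\mathcal F}(P_\lambda),\tilde\unlhd)$. (2) $\tilde f$ is an isomorphism of posets from $(\tilde W\,\mathrm{res}(\lambda),\le_s)$ onto $(\tilde{\mathcal F}(P_\lambda),\subseteq)$. -/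

import Mathlib

open scoped ComplexOrder

noncomputable section

namespace FoldedOrbit

universe u v w

/-! ### Double-tailed diamonds and d-complete posets -/

section Posets

variable {P : Type v} [PartialOrder P]

/-- The double-tailed diamond `d_k(1)` (for `k ≥ 3`): a chain `w_k < ⋯ < w_3`, above it two
incomparable elements `x, y`, above them a chain `z_3 < ⋯ < z_k`. Here `⊕ₗ` is the ordinal sum and
`Unit ⊕ Unit` is the two-element antichain. -/
abbrev DoubleTailed (k : ℕ) : Type :=
  Fin (k - 2) ⊕ₗ ((Unit ⊕ Unit) ⊕ₗ Fin (k - 2))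

/-- The poset `d_k^-(1)`, i.e. `d_k(1)` without its maximum `z_k`. -/
abbrev DoubleTailedMinus (k : ℕ) : Type :=
  Fin (k - 2) ⊕ₗ ((Unit ⊕ Unit) ⊕ₗ Fin (k - 3))

/-- The interval `[x, y]` is a `d_k`-interval. -/
def IsDInterval (k : ℕ) (x y : P) : Prop :=
  3 ≤ k ∧ Nonempty (Set.Icc x y ≃o DoubleTailed k)

/-- The set `S` is a `d_k^-`-interval. For `k ≥ 4` this is an interval isomorphic to `d_k^-(1)`;
for `k = 3` it is a set `{w, x, y}` where `w` is covered by the two distinct elements `x, y`. -/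
def IsDMinusInterval (k : ℕ) (S : Set P) : Prop :=
  (k = 3 ∧ ∃ w x y : P, x ≠ y ∧ w ⋖ x ∧ w ⋖ y ∧ S = {w, x, y}) ∨
  (4 ≤ k ∧ ∃ x y : P, S = Set.Icc x y ∧ Nonempty (Set.Icc x y ≃o DoubleTailedMinus k))

variable (P) in
/-- d-complete posets. -/
structure IsDComplete : Prop where
  finite : Finite P
  /-- No `d_k^-`-interval is incomplete. -/
  complete : ∀ (k : ℕ) (S : Set P), IsDMinusInterval k S →
    ∃ z x y : P, insert z S = Set.Icc x y ∧ IsDInterval k x y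
  /-- The maximum of a `d_k`-interval covers only elements of the interval. -/
  covers : ∀ (k : ℕ) (x y : P), IsDInterval k x y → ∀ z : P, z ⋖ y → z ∈ Set.Icc x y
  /-- No two `d_k^-`-intervals overlap. -/
  nonoverlapping : ∀ (k : ℕ) (S S' : Set P) (m m' : P),
    IsDMinusInterval k S → IsDMinusInterval k S' → IsLeast S m → IsLeast S' m' →
    S \ {m} = S' \ {m'} → m = m'

variable (P) in
/-- The top tree: the elements `x` such that every `y ≥ x` is covered by at most one element. -/
def topTree : Set P := {x | ∀ y, x ≤ y → {z | y ⋖ z}.Subsingleton}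

variable (P) in
/-- Order filters (upper sets) of `P`; as a subtype of `Set P` they are ordered by inclusion. -/
abbrev Filt : Type v := {F : Set P // IsUpperSet F}

section Coloring

variable {C : Type w} (κ : P → C)

/-- The union of all filters that exceed `F` only in elements of color `c`. -/
def filtA (c : C) (F : Filt P) : Set P :=
  ⋃ F' ∈ {F' : Set P | IsUpperSet F' ∧ F' \ F.1 ⊆ κ ⁻¹' {c}}, F'

/-- The intersection of all filters that miss only elements of color `c` of `F`. -/
def filtR (c : C) (F : Filt P) : Set P :=
  ⋂ F' ∈ {F' : Set P | IsUpperSet F' ∧ F.1 \ F' ⊆ κ ⁻¹' {c}}, F'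

open Classical in
/-- The involution `S_c` on order filters. -/
def filtS (c : C) (F : Filt P) : Filt P :=
  if h : IsUpperSet ((filtA κ c F \ F.1) ∪ filtR κ c F)
  then ⟨(filtA κ c F \ F.1) ∪ filtR κ c F, h⟩
  else F

/-- The order on filters generated by the steps `F ⊂ S_c(F)`, for `c` an arbitrary color. -/
def filtLE : Filt P → Filt P → Prop :=
  Relation.ReflTransGen fun F F' => ∃ c : C, filtS κ c F = F' ∧ F < F'

end Coloring

end Posets

/-- `φ` is an isomorphism of `(X, r)` onto its image in `Y`, equipped with the restriction
of `s`. -/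
def IsIsoOntoImage {X : Type u} {Y : Type v} (r : X → X → Prop) (s : Y → Y → Prop)
    (φ : X → Y) : Prop :=
  Function.Injective φ ∧ ∀ a b, r a b ↔ s (φ a) (φ b)

/-! ### Reflection groups and the two orders on an orbit

`V` is a Cartan subalgebra; the pairs `(β, c)` below consist of a root `β ∈ V^*` and its coroot
`c ∈ V`. -/

section Orbits

variable {V : Type u} [AddCommGroup V] [Module ℂ V]

open Module

/-- The subgroup of `GL(V^*)` generated by the reflections `ν ↦ ν - ν(c) β`, `(β, c) ∈ Φ`. -/
def reflGroup (Φ : Set (Dual ℂ V × V)) : Subgroup (Dual ℂ V ≃ₗ[ℂ] Dual ℂ V) :=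
  Subgroup.closure {g | ∃ r ∈ Φ, ∀ ν, g ν = ν - ν r.2 • r.1}

/-- The orbit of `ν` under a group of linear automorphisms. -/
def orbit (W : Subgroup (Dual ℂ V ≃ₗ[ℂ] Dual ℂ V)) (ν : Dual ℂ V) : Set (Dual ℂ V) :=
  {μ | ∃ g ∈ W, g ν = μ}

/-- The order on a set `O` of weights generated by the steps `μ ≤ s_β(μ)`, `μ(c) > 0`,
`(β, c) ∈ Φ`, within `O`. For the pairs of positive (co)roots it is `≤_s`; for the pairs of simple
(co)roots it is `≤_w`. -/
def reflLE (Φ : Set (Dual ℂ V × V)) (O : Set (Dual ℂ V)) : O → O → Prop :=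
  Relation.ReflTransGen fun μ μ' =>
    ∃ r ∈ Φ, 0 < μ.1 r.2 ∧ μ'.1 = μ.1 - μ.1 r.2 • r.1

end Orbits

/-! ### The simply-laced Lie algebra -/

section LieAlg

open Module

/-- The matrix is, up to a bijection of the index set, the Cartan matrix of type
`A_n`, `D_n` (`n ≥ 4`) or `E_6`. -/
def IsTypeADE6 {ι : Type w} (A : Matrix ι ι ℤ) : Prop :=
  (∃ (n : ℕ) (e : ι ≃ Fin n), A = (CartanMatrix.A n).submatrix e e) ∨
  (∃ (n : ℕ) (e : ι ≃ Fin n), 4 ≤ n ∧ A = (CartanMatrix.D n).submatrix e e) ∨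
  (∃ e : ι ≃ Fin 6, A = CartanMatrix.E₆.submatrix e e)

variable {L : Type u} [LieRing L] [LieAlgebra ℂ L] {H : LieSubalgebra ℂ L}
variable {ι : Type w} [Fintype ι] (B : LieAlgebra.Basis ι H)

/-- The basis of the Cartan subalgebra formed by the simple coroots `h_i`. -/
def cartanBasis : Basis ι ℂ H :=
  (Basis.span B.linInd).map (LinearEquiv.ofEq _ _ B.coe_cartan_eq_span).symm

/-- The fundamental weight `Λ_i`. -/
def fundWeight (i : ι) : Dual ℂ H := (cartanBasis B).coord i

/-- The pairs (simple root, simple coroot). -/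
def simplePairs : Set (Dual ℂ H × H) := Set.range fun i => (B.baseSupp i, B.h' i)

/-- The pairs (positive root, its coroot). -/
def posPairs [FiniteDimensional ℂ L] [LieAlgebra.IsKilling ℂ L] [H.IsCartanSubalgebra] :
    Set (Dual ℂ H × H) :=
  {r | r.1 ∈ AddSubmonoid.closure (Set.range B.baseSupp) ∧
    ∃ α : H.root, (LieAlgebra.IsKilling.rootSystem H).root α = r.1 ∧
      (LieAlgebra.IsKilling.rootSystem H).coroot α = r.2}

/-- The Weyl group. -/
def weyl : Subgroup (Dual ℂ H ≃ₗ[ℂ] Dual ℂ H) := reflGroup (simplePairs B)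

/-- `lam` is a minuscule weight: it is dominant integral and all the weights in its Weyl group
orbit take only the values `-1, 0, 1` on the simple coroots. -/
def IsMinuscule (lam : Dual ℂ H) : Prop :=
  (∀ i, ∃ n : ℕ, lam (B.h' i) = n) ∧
  ∀ μ ∈ orbit (weyl B) lam, ∀ i, μ (B.h' i) = -1 ∨ μ (B.h' i) = 0 ∨ μ (B.h' i) = 1

/-- `P` is a d-complete poset `P_λ` attached to the minuscule weight `lam`, and `κ` makes it
an `I`-colored d-complete poset. -/
structure IsColoredMinusculePoset [FiniteDimensional ℂ L] [LieAlgebra.IsKilling ℂ L]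
    [H.IsCartanSubalgebra] (lam : Dual ℂ H) (P : Type v) [PartialOrder P] (κ : P → ι) :
    Prop where
  dComplete : IsDComplete P
  connected : (SimpleGraph.hasse P).Connected
  selfDual : Nonempty (P ≃o Pᵒᵈ)
  /-- `(Wλ, ≤_s)` and the order filters of `P` are isomorphic as posets. -/
  orbitIso : ∃ φ : orbit (weyl B) lam ≃ Filt P,
    ∀ μ μ', reflLE (posPairs B) _ μ μ' ↔ φ μ ≤ φ μ'
  /-- The coloring is bijective on the top tree ... -/
  topTree_bij : Set.BijOn κ (topTree P) Set.univ
  /-- ... and maps its Hasse diagram isomorphically to the Dynkin diagram. -/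
  topTree_adj : ∀ x y : topTree P,
    (SimpleGraph.hasse (topTree P)).Adj x y ↔ κ x ≠ κ y ∧ B.A (κ x) (κ y) ≠ 0
  /-- The two ends of a `d_k`-interval have the same color. -/
  ends : ∀ (k : ℕ) (x y : P), IsDInterval k x y → κ x = κ y
  /-- If `i` is the color of the maximum of `P`, then `λ = Λ_i`. -/
  top : ∃ m : P, IsTop m ∧ lam = fundWeight B (κ m)

/-- The map `f`: an order isomorphism from `(Wλ, ≤_s)` to the order filters of `P` that carries
the simple reflection `s_i` to the involution `S_i`. -/
def IsColoredIso [FiniteDimensional ℂ L] [LieAlgebra.IsKilling ℂ L]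
    [H.IsCartanSubalgebra] (lam : Dual ℂ H) {P : Type v} [PartialOrder P] (κ : P → ι)
    (f : orbit (weyl B) lam ≃ Filt P) : Prop :=
  (∀ μ μ', reflLE (posPairs B) _ μ μ' ↔ f μ ≤ f μ') ∧
  ∀ (i : ι) (μ μ' : orbit (weyl B) lam),
    μ'.1 = μ.1 - μ.1 (B.h' i) • B.baseSupp i → f μ' = filtS κ i (f μ)

/-! ### Folding -/

variable (σ : Equiv.Perm ι)

/-- The set `J` of orbits of `⟨σ⟩` on `I`. -/
abbrev FoldIndex : Type w := Quotient (Equiv.Perm.SameCycle.setoid σ)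

/-- The orbit of `i`. -/
def toFold (i : ι) : FoldIndex σ := Quotient.mk _ i

/-- The orthogonality condition for an orbit `p`. -/
def IsOrthogonal (p : FoldIndex σ) : Prop :=
  ∀ i j, toFold σ i = p → toFold σ j = p → i ≠ j → B.A i j = 0

open Classical in
/-- The element `H_p` of the Cartan subalgebra: the sum of the `h_i`, `i ∈ p`, doubled if `p` does
not satisfy the orthogonality condition. -/
def foldH (p : FoldIndex σ) : H :=
  if IsOrthogonal B σ p then ∑ i with toFold σ i = p, B.h' i
  else (2 : ℂ) • ∑ i with toFold σ i = p, B.h' i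

/-- The Cartan subalgebra `h(0)` of the fixed point subalgebra. -/
def cartan0 : Submodule ℂ H := Submodule.span ℂ (Set.range (foldH B σ))

/-- The restriction map from weights of `h` to weights of `h(0)`. -/
def res : Dual ℂ H →ₗ[ℂ] Dual ℂ (cartan0 B σ) := (cartan0 B σ).dualRestrict

/-- `H_p` as an element of `h(0)`. -/
def foldH0 (p : FoldIndex σ) : cartan0 B σ :=
  ⟨foldH B σ p, Submodule.subset_span (Set.mem_range_self p)⟩

/-- The pairs `(β_p, H_p)`, where `β_p = res(α_i)` for `i ∈ p`. -/
def foldSimplePairs : Set (Dual ℂ (cartan0 B σ) × cartan0 B σ) :=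
  Set.range fun i => (res B σ (B.baseSupp i), foldH0 B σ (toFold σ i))

/-- The Weyl group of the fixed point subalgebra. -/
def foldWeyl : Subgroup (Dual ℂ (cartan0 B σ) ≃ₗ[ℂ] Dual ℂ (cartan0 B σ)) :=
  reflGroup (foldSimplePairs B σ)

/-- The action of `σ` on the Cartan subalgebra, `h_i ↦ h_{σ(i)}`. -/
def sigmaH : H ≃ₗ[ℂ] H := (cartanBasis B).equiv (cartanBasis B) σ

/-- The action of `σ` on weights, `(σ μ)(h) = μ(σ⁻¹ h)`. -/
def sigmaDual : Dual ℂ H ≃ₗ[ℂ] Dual ℂ H := (sigmaH B σ).symm.dualMap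

/-- The orbit of `lam` under the group of those `w` in the Weyl group with `σ w σ⁻¹ = w`. -/
def hatOrbit (lam : Dual ℂ H) : Set (Dual ℂ H) :=
  {μ | ∃ g ∈ weyl B, sigmaDual B σ * g * (sigmaDual B σ)⁻¹ = g ∧ g lam = μ}

/-- The fixed point subalgebra `g(0)` of a Lie algebra automorphism. -/
def fixedSubalgebra (τ : L ≃ₗ⁅ℂ⁆ L) : LieSubalgebra ℂ L where
  carrier := {x | τ x = x}
  add_mem' {x y} hx hy := by
    simp only [Set.mem_ofPred_eq] at hx hy ⊢
    rw [map_add, hx, hy]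
  zero_mem' := by
    simp only [Set.mem_ofPred_eq, map_zero]
  smul_mem' c x hx := by
    simp only [Set.mem_ofPred_eq] at hx ⊢
    rw [map_smul, hx]
  lie_mem' {x y} hx hy := by
    change τ x = x at hx
    change τ y = y at hy
    change τ ⁅x, y⁆ = ⁅x, y⁆
    rw [LieEquiv.map_lie, hx, hy]

/-- The `β`-weight space of `g(0)` with respect to `h(0)`. -/
def foldRootSpace (τ : L ≃ₗ⁅ℂ⁆ L) (β : Dual ℂ (cartan0 B σ)) : Set L :=
  {x | x ∈ fixedSubalgebra τ ∧ ∀ t : cartan0 B σ, ⁅((t : H) : L), x⁆ = β t • x}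

/-- The pairs (positive root of `g(0)`, its coroot): `β` is a root of `g(0)` with respect to
`h(0)`, it is a nonnegative integral combination of the simple roots `β_p`, and `c ∈ h(0)` is the
bracket of a `β`-root vector and a `-β`-root vector with `β(c) = 2`. -/
def foldPosPairs (τ : L ≃ₗ⁅ℂ⁆ L) : Set (Dual ℂ (cartan0 B σ) × cartan0 B σ) :=
  {r | r.1 ≠ 0 ∧ (∃ x ∈ foldRootSpace B σ τ r.1, x ≠ 0) ∧
    r.1 ∈ AddSubmonoid.closure (Set.range fun i => res B σ (B.baseSupp i)) ∧
    r.1 r.2 = 2 ∧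
    ∃ x ∈ foldRootSpace B σ τ r.1, ∃ y ∈ foldRootSpace B σ τ (-r.1), ⁅x, y⁆ = ((r.2 : H) : L)}

/-- The map `f~` on the orbit of `res(lam)` determined by `f~ ∘ res = f` on the hat orbit. -/
def IsFoldOf (lam : Dual ℂ H) {P : Type v} [PartialOrder P]
    (f : orbit (weyl B) lam ≃ Filt P)
    (ft : orbit (foldWeyl B σ) (res B σ lam) → Filt P) : Prop :=
  ∀ (μ : orbit (weyl B) lam) (ν : orbit (foldWeyl B σ) (res B σ lam)),
    μ.1 ∈ hatOrbit B σ lam → ν.1 = res B σ μ.1 → ft ν = f μ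

end LieAlg

end FoldedOrbit

end

/-!
Write a weight of `W λ` as `λ - ∑ c_i α_i`. The coordinate vectors `c` form a finite set `O` of
nonnegative integer vectors in which a unit vector may be added exactly where the weight takes the
value `1`, and subtracted where it takes the value `-1` (`IsMinusculeOrbit`). Since the Cartan
matrix is positive (`IsDynkin.exists_pos`), `O` is closed under componentwise minimum and maximum,
and `≤_s` on `W λ` is the componentwise order on `O` (`reflLE_posPairs_iff`).

*The colored poset.* The join-irreducible elements of the distributive lattice `O` form a poset `P`,
labelled by simple roots so that `O` consists of the vectors that count the labels in the filters
of `P` (`IsLabelled`, `IsMinusculeOrbit.exists_isLabelled`). Such a poset is a heap: consecutive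
elements of the same label enclose exactly two elements with neighbouring labels
(`IsLabelled.isHeap`). For heaps over an acyclic diagram the `d_k`-intervals can be listed, which
gives d-completeness and the description of the top tree (`IsHeap.isDComplete`,
`IsHeap.topTree_bijOn`). A coloring as in the definition of `IsColoredMinusculePoset` is determined
by its values on the top tree, so it differs from the labelling by a diagram automorphism that fixes
`λ` and is itself a labelling (`IsLabelled.of_coloring`). Hence `f` sends `λ - ∑ c_i α_i` to the
filter with label counts `c`, and `S_i` changes the count of `i` in the same way as `s_i` does.

*Folding.* An orbit `p` of the diagram automorphism consists of pairwise orthogonal vertices or of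
two adjacent ones (`orth_or_pair`), and `s̃_p` is the restriction of an element `w_p` of `W` that
commutes with `σ` (`exists_foldRefl`, `res_foldRefl`). If `w ∈ W` commutes with `σ`, the values of
`w λ` on the coroots `h_i`, `i ∈ p`, are all nonnegative or all nonpositive, because `w⁻¹` maps
these coroots to positive or negative ones simultaneously (`isFoldSet_hatSet`). So if `w λ ≠ λ`,
some `w_p` strictly lowers its coordinates. Induction on the sum of the coordinates shows that
`res` is a bijection between the two orbits (`IsFolding.bijOn_res`), and that on its coordinates
`S̃_p` acts like `w_p` (`IsFoldSet.filtS_eq`). This yields the statement on the weak orders.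

*The strong order.* It has to be shown that the order generated by all positive reflections of
`g(0)` is the componentwise order of the coordinates (`IsFolding.reflLE_iff`). A simple reflection
maps a positive root that is not a multiple of the simple root to a positive root
(`isPositiveSystem_foldPosPairs`): it is induced by the automorphism
`exp(ad e) exp(-ad f) exp(ad e)` of `g(0)` for an `sl₂`-triple, and weights of `h(0)` on `g` are
restrictions of roots. Thus a step along a positive root is conjugated to one along a root of
smaller height, and the folded reflections are monotone wherever they move both weights in the same
direction (`IsFoldSet.foldStep_mono`). The case of a multiple of a simple root is settled by
`IsFolding.not_between`: no weight of the orbit lies strictly between `ν` and `s̃_p ν`. For the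
converse a weight is lowered along the simple reflections, and the two sides are compared by the
lifting property `IsFolding.reflLE_lift`.
-/

noncomputable section

set_option linter.unusedSectionVars false

namespace FoldedOrbit

open Relation

/-! ### Simply-laced Dynkin diagrams -/

/-- The vertex `i` of the Dynkin diagram of `A` has at least three neighbours. -/
def IsBranch {ι : Type*} (A : Matrix ι ι ℤ) (i : ι) : Prop :=
  ∃ a b c, a ≠ b ∧ a ≠ c ∧ b ≠ c ∧ A i a = -1 ∧ A i b = -1 ∧ A i c = -1

/-- The combinatorial properties of the Cartan matrices of type `A`, `D` and `E₆` that the argument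
uses. Vertices `i, j` are adjacent when `A i j = -1`. -/
structure IsDynkin {ι : Type*} [Fintype ι] (A : Matrix ι ι ℤ) : Prop where
  symm : ∀ i j, A i j = A j i
  diag : ∀ i, A i i = 2
  off : ∀ i j, i ≠ j → A i j = 0 ∨ A i j = -1
  /-- Finite type, in the form of a nonnegative vector with positive image. -/
  pos : ∃ u : ι → ℤ, (∀ i, 0 ≤ u i) ∧ ∀ j, 0 < ∑ i, A j i * u i
  /-- Acyclicity: two neighbours of `i` joined by a walk that avoids `i` are equal. -/
  tree : ∀ i a b, A i a = -1 → A i b = -1 →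
    ReflTransGen (fun u v => A u v = -1 ∧ v ≠ i) a b → a = b
  /-- Connectedness: a nonempty set that is closed under adjacency is everything. -/
  conn : ∀ S : Set ι, S.Nonempty → (∀ i j, i ∈ S → A i j = -1 → j ∈ S) → ∀ i, i ∈ S
  /-- No vertex has four neighbours. -/
  deg : ∀ i a b c d, A i a = -1 → A i b = -1 → A i c = -1 → A i d = -1 →
    a ≠ b → a ≠ c → a ≠ d → b ≠ c → b ≠ d → c ≠ d → False
  /-- At most one vertex has three neighbours. -/
  branch : ∀ i j, IsBranch A i → IsBranch A j → i = j

/-- A graph in which every vertex has at most one neighbour of smaller depth, and in which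
neighbours have different depths, has no cycles. -/
lemma tree_of_depth {ι : Type*} {A : Matrix ι ι ℤ} (symm : ∀ i j, A i j = A j i) (d : ι → ℕ)
    (hne : ∀ i j, A i j = -1 → d i ≠ d j)
    (huniq : ∀ i j k, A i j = -1 → A i k = -1 → d j < d i → d k < d i → j = k)
    (i a b : ι) (ha : A i a = -1) (hb : A i b = -1)
    (hw : ReflTransGen (fun u v => A u v = -1 ∧ v ≠ i) a b) : a = b := by
  -- a walk that starts at a child `a` of `i` and avoids `i` stays among the descendants of `a`
  have key : ∀ a b, A i a = -1 → A i b = -1 → d i < d a →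
      ReflTransGen (fun u v => A u v = -1 ∧ v ≠ i) a b → a = b := by
    intro a b ha hb hia hw
    have hdesc : ∀ v, ReflTransGen (fun u v => A u v = -1 ∧ v ≠ i) a v →
        ReflTransGen (fun x y => A x y = -1 ∧ d x < d y) a v := by
      intro v hv
      induction hv with
      | refl => exact .refl
      | @tail u v _ huv ih =>
        rcases lt_or_gt_of_ne (hne u v huv.1) with h | h
        · exact ih.tail ⟨huv.1, h⟩
        · rcases ReflTransGen.cases_tail ih with rfl | ⟨w, hw, hwu⟩
          · exact absurd (huniq u v i huv.1 (symm u i ▸ ha) h hia) huv.2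
          · have : w = v := huniq u w v (symm u w ▸ hwu.1) huv.1 hwu.2 h
            exact this ▸ hw
    have hle : ∀ v, ReflTransGen (fun x y => A x y = -1 ∧ d x < d y) a v → d a ≤ d v := by
      intro v hv
      induction hv with
      | refl => exact le_rfl
      | tail _ h ih => exact ih.trans h.2.le
    rcases ReflTransGen.cases_tail (hdesc b hw) with rfl | ⟨w, hw', hwb⟩
    · rfl
    · have h1 := hle w hw'
      have h2 : w = i := huniq b w i (symm b w ▸ hwb.1) (symm b i ▸ hb) hwb.2 (by
        have := hle b (hdesc b hw); omega)
      subst h2; omega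
  have hai : a ≠ i := fun h => hne i a ha (by rw [h])
  have hrev : ReflTransGen (fun u v => A u v = -1 ∧ v ≠ i) b a := by
    have : ∀ v, ReflTransGen (fun u v => A u v = -1 ∧ v ≠ i) a v →
        ReflTransGen (fun u v => A u v = -1 ∧ v ≠ i) v a := by
      intro v hv
      have : v ≠ i ∧ ReflTransGen (fun u v => A u v = -1 ∧ v ≠ i) v a := by
        induction hv with
        | refl => exact ⟨hai, .refl⟩
        | @tail u v _ h ih => exact ⟨h.2, .head ⟨symm v u ▸ h.1, ih.1⟩ ih.2⟩
      exact this.2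
    exact this b hw
  rcases lt_or_gt_of_ne (hne i a ha) with h | h
  · exact key a b ha hb h hw
  · rcases lt_or_gt_of_ne (hne i b hb) with h' | h'
    · exact (key b a hb ha h' hrev).symm
    · exact huniq i a b ha hb h h'

/-- If every vertex of positive depth has a neighbour of smaller depth, and there is only one
vertex of depth zero, the graph is connected. -/
lemma conn_of_depth {ι : Type*} {A : Matrix ι ι ℤ} (symm : ∀ i j, A i j = A j i) (d : ι → ℕ)
    (h0 : ∀ i j, d i = 0 → d j = 0 → i = j)
    (hpar : ∀ i, d i ≠ 0 → ∃ j, A i j = -1 ∧ d j < d i)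
    (S : Set ι) (hS : S.Nonempty) (hcl : ∀ i j, i ∈ S → A i j = -1 → j ∈ S) (i : ι) : i ∈ S := by
  have down : ∀ n i, d i = n → i ∈ S → ∃ r ∈ S, d r = 0 := by
    intro n
    induction n using Nat.strong_induction_on with
    | _ n ih =>
      intro i hi hiS
      by_cases hz : d i = 0
      · exact ⟨i, hiS, hz⟩
      · obtain ⟨j, hj, hlt⟩ := hpar i hz
        exact ih (d j) (hi ▸ hlt) j rfl (hcl i j hiS hj)
  obtain ⟨s, hs⟩ := hS
  obtain ⟨r, hr, hr0⟩ := down _ s rfl hs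
  have up : ∀ n i, d i = n → i ∈ S := by
    intro n
    induction n using Nat.strong_induction_on with
    | _ n ih =>
      intro i hi
      by_cases hz : d i = 0
      · exact h0 r i hr0 hz ▸ hr
      · obtain ⟨j, hj, hlt⟩ := hpar i hz
        exact hcl j i (ih (d j) (hi ▸ hlt) j rfl) (symm i j ▸ hj)
  exact up _ i rfl

lemma IsDynkin.submatrix {ι κ : Type*} [Fintype ι] [Fintype κ] {A : Matrix κ κ ℤ}
    (hA : IsDynkin A) (e : ι ≃ κ) : IsDynkin (A.submatrix e e) where
  symm i j := hA.symm _ _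
  diag i := hA.diag _
  off i j h := hA.off _ _ (e.injective.ne h)
  pos := by
    obtain ⟨u, hu, hAu⟩ := hA.pos
    refine ⟨fun i => u (e i), fun i => hu _, fun j => ?_⟩
    have := hAu (e j)
    rwa [← Equiv.sum_comp e] at this
  tree i a b ha hb hw := e.injective <| hA.tree (e i) (e a) (e b) ha hb <|
    hw.lift e fun u v h => ⟨h.1, e.injective.ne h.2⟩
  conn S hS hcl i := by
    have := hA.conn (e '' S) (hS.image e) (by
      rintro _ j ⟨i, hi, rfl⟩ hij
      exact ⟨e.symm j, hcl i _ hi (by simpa using hij), by simp⟩) (e i)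
    obtain ⟨j, hj, hji⟩ := this
    exact e.injective hji ▸ hj
  deg i a b c d h1 h2 h3 h4 g1 g2 g3 g4 g5 g6 := hA.deg (e i) (e a) (e b) (e c) (e d) h1 h2 h3 h4
    (e.injective.ne g1) (e.injective.ne g2) (e.injective.ne g3) (e.injective.ne g4)
    (e.injective.ne g5) (e.injective.ne g6)
  branch := by
    have : ∀ i, IsBranch (A.submatrix e e) i → IsBranch A (e i) := by
      rintro i ⟨a, b, c, h1, h2, h3, h⟩
      exact ⟨e a, e b, e c, e.injective.ne h1, e.injective.ne h2, e.injective.ne h3, h⟩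
    exact fun i j hi hj => e.injective (hA.branch _ _ (this i hi) (this j hj))

lemma typeA_adj {n : ℕ} {i j : Fin n} :
    CartanMatrix.A n i j = -1 ↔ i.val + 1 = j.val ∨ j.val + 1 = i.val := by
  simp only [CartanMatrix.A, Matrix.of_apply]
  split_ifs with h h' <;> simp_all

lemma typeD_adj {n : ℕ} (hn : 4 ≤ n) {i j : Fin n} :
    CartanMatrix.D n i j = -1 ↔
      (i.val + 1 = j.val ∧ j.val + 2 < n) ∨ (j.val + 1 = i.val ∧ i.val + 2 < n) ∨
      (i.val + 3 = n ∧ (j.val + 2 = n ∨ j.val + 1 = n)) ∨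
      (j.val + 3 = n ∧ (i.val + 2 = n ∨ i.val + 1 = n)) := by
  simp only [CartanMatrix.D, Matrix.of_apply]
  split_ifs with h h1 h2 h3 h4 h5 <;> simp_all
  all_goals omega

lemma sum_ite_le {ι : Type*} [Fintype ι] {p : ι → Prop} [DecidablePred p] {u : ι → ℤ} {b : ℤ}
    (hp : ∀ i j, p i → p j → i = j) (hb : 0 ≤ b) (hu : ∀ i, p i → u i ≤ b) :
    ∑ i, (if p i then u i else 0) ≤ b := by
  by_cases h : ∃ i, p i
  · obtain ⟨i, hi⟩ := h
    rw [Finset.sum_eq_single i (fun j _ hj => if_neg fun hpj => hj (hp j i hpj hi)) (by simp),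
      if_pos hi]
    exact hu i hi
  · push Not at h
    simpa [h] using hb

/-- A row of a Cartan matrix pairs positively with a nonnegative vector `u` if the at most three
neighbours `i` of `j` are described by predicates `p, q, r`, with bounds for `u` that add up to
less than `2 * u j`. -/
lemma row_sum_pos {ι : Type*} [Fintype ι] {A : Matrix ι ι ℤ} {u : ι → ℤ}
    (hdiag : ∀ i, A i i = 2) (hoff : ∀ i j, i ≠ j → A i j = 0 ∨ A i j = -1) (hu : ∀ i, 0 ≤ u i)
    (j : ι) (p q r : ι → Prop) (a b c : ℤ)
    (hp : ∀ i j, p i → p j → i = j) (hq : ∀ i j, q i → q j → i = j)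
    (hr : ∀ i j, r i → r j → i = j) (h : ∀ i, A j i = -1 → p i ∨ q i ∨ r i)
    (ha : 0 ≤ a) (hb : 0 ≤ b) (hc : 0 ≤ c)
    (hpa : ∀ i, p i → u i ≤ a) (hqb : ∀ i, q i → u i ≤ b) (hrc : ∀ i, r i → u i ≤ c)
    (hlt : a + b + c < 2 * u j) :
    0 < ∑ i, A j i * u i := by
  classical
  have h1 := sum_ite_le hp ha hpa
  have h2 := sum_ite_le hq hb hqb
  have h3 := sum_ite_le hr hc hrc
  have h4 : ∑ i, ((if i = j then 2 * u j else 0) - ((if p i then u i else 0) +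
      (if q i then u i else 0) + (if r i then u i else 0))) ≤ ∑ i, A j i * u i := by
    refine Finset.sum_le_sum fun i _ => ?_
    have h5 : ∀ s : Prop, [Decidable s] → 0 ≤ if s then u i else 0 := by
      intro s _; split_ifs; exacts [hu i, le_rfl]
    have hp' := h5 (p i)
    have hq' := h5 (q i)
    have hr' := h5 (r i)
    by_cases hij : i = j
    · subst hij; rw [if_pos rfl, hdiag]; linarith
    · rw [if_neg hij]
      rcases hoff j i (Ne.symm hij) with h0 | h0
      · rw [h0]; linarith
      · have hui := hu i
        rw [h0]
        rcases h i h0 with h' | h' | h' <;> rw [if_pos h'] at * <;> linarith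
  rw [Finset.sum_sub_distrib, Finset.sum_add_distrib, Finset.sum_add_distrib,
    Finset.sum_ite_eq' Finset.univ j, if_pos (Finset.mem_univ j)] at h4
  linarith

lemma typeA_off {n : ℕ} (i j : Fin n) (h : i ≠ j) :
    CartanMatrix.A n i j = 0 ∨ CartanMatrix.A n i j = -1 := by
  simp only [CartanMatrix.A, Matrix.of_apply, if_neg h]
  split_ifs <;> simp

lemma typeD_off {n : ℕ} (i j : Fin n) (h : i ≠ j) :
    CartanMatrix.D n i j = 0 ∨ CartanMatrix.D n i j = -1 := by
  simp only [CartanMatrix.D, Matrix.of_apply, if_neg h]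
  split_ifs <;> simp

/-- A graph in which all neighbourhoods have at most three elements. -/
lemma deg_of_card {ι : Type*} [Fintype ι] [DecidableEq ι] {p : ι → ι → Bool}
    (h : ∀ i, (Finset.univ.filter fun j => p i j = true).card ≤ 3) (i a b c d : ι)
    (h1 : p i a = true) (h2 : p i b = true) (h3 : p i c = true) (h4 : p i d = true)
    (g1 : a ≠ b) (g2 : a ≠ c) (g3 : a ≠ d) (g4 : b ≠ c) (g5 : b ≠ d) (g6 : c ≠ d) : False := by
  have hs : ({a, b, c, d} : Finset ι) ⊆ Finset.univ.filter fun j => p i j = true := by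
    intro x hx
    simp only [Finset.mem_insert, Finset.mem_singleton] at hx
    rcases hx with rfl | rfl | rfl | rfl <;> simpa
  have h5 := (Finset.card_le_card hs).trans (h i)
  rw [Finset.card_insert_of_notMem (by simp [g1, g2, g3]),
    Finset.card_insert_of_notMem (by simp [g4, g5]), Finset.card_pair g6] at h5
  omega

/-- Adjacency in the Dynkin diagram of type `E₆`, as a boolean. -/
def adjE (i j : Fin 6) : Bool := decide (CartanMatrix.E₆ i j = -1)

lemma adjE_iff {i j : Fin 6} : CartanMatrix.E₆ i j = -1 ↔ adjE i j = true := by simp [adjE]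

lemma isDynkin_A (n : ℕ) : IsDynkin (CartanMatrix.A n) where
  symm i j := congrFun (congrFun (CartanMatrix.A_transpose n) j) i
  diag i := congrFun (CartanMatrix.A_diag n) i
  off := typeA_off
  pos := by
    have hu : ∀ i : Fin n, (0 : ℤ) ≤ (i.val + 1) * (n - i.val) := fun i => by
      have : (0 : ℤ) ≤ n - i.val := by have := i.2; omega
      positivity
    refine ⟨fun i => (i.val + 1) * (n - i.val), hu, fun j => ?_⟩
    have hj : (j.val : ℤ) + 1 ≤ n := by have := j.2; omega
    refine row_sum_pos (A := CartanMatrix.A n) (fun i => congrFun (CartanMatrix.A_diag n) i)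
      typeA_off hu j
      (fun i => i.val + 1 = j.val) (fun i => j.val + 1 = i.val) (fun _ => False)
      (j.val * (n - j.val + 1)) ((j.val + 2) * (n - j.val - 1)) 0
      (fun i k h h' => by ext; omega) (fun i k h h' => by ext; omega) (by simp)
      (fun i h => by rw [typeA_adj] at h; omega)
      (mul_nonneg (by positivity) (by linarith)) (mul_nonneg (by positivity) (by linarith))
      le_rfl (fun i h => ?_) (fun i h => ?_) (by simp) (by nlinarith)
    · rw [← h]; push_cast; nlinarith
    · rw [← h]; push_cast; nlinarith
  tree := tree_of_depth (fun i j => congrFun (congrFun (CartanMatrix.A_transpose n) j) i)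
    (fun i => i.val) (fun i j h => by rw [typeA_adj] at h; omega)
    (fun i j k h h' hj hk => by
      rw [typeA_adj] at h h'; ext; omega)
  conn := conn_of_depth (fun i j => congrFun (congrFun (CartanMatrix.A_transpose n) j) i)
    (fun i => i.val) (fun i j h h' => by ext; omega)
    (fun i h => ⟨⟨i.val - 1, by omega⟩, by rw [typeA_adj]; simp only at h ⊢; omega,
      by simp only at h ⊢; omega⟩)
  deg i a b c d h1 h2 h3 h4 g1 g2 g3 g4 g5 g6 := by
    rw [typeA_adj] at *
    simp only [ne_eq, Fin.ext_iff] at *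
    omega
  branch := by
    rintro i j ⟨a, b, c, g1, g2, g3, h1, h2, h3⟩
    rw [typeA_adj] at *
    simp only [ne_eq, Fin.ext_iff] at *
    omega

lemma isDynkin_D (n : ℕ) (hn : 4 ≤ n) : IsDynkin (CartanMatrix.D n) where
  symm i j := congrFun (congrFun (CartanMatrix.D_transpose n) j) i
  diag i := by simp
  off := typeD_off
  pos := by
    obtain ⟨u, hu1, hu2⟩ : ∃ u : Fin n → ℤ,
        (∀ i, i.val + 2 < n → u i = 2 * (i.val + 1) * (2 * n - 2 - i.val)) ∧
        ∀ i, ¬ i.val + 2 < n → u i = n * (n - 1) :=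
      ⟨fun i => if i.val + 2 < n then 2 * (i.val + 1) * (2 * n - 2 - i.val) else n * (n - 1),
        fun i h => if_pos h, fun i h => if_neg h⟩
    have hn' : (4 : ℤ) ≤ n := by exact_mod_cast hn
    have hu : ∀ i : Fin n, 0 ≤ u i := fun i => by
      have hi := i.2
      by_cases h : i.val + 2 < n
      · rw [hu1 i h]
        have : (0 : ℤ) ≤ 2 * n - 2 - i.val := by omega
        positivity
      · rw [hu2 i h]; nlinarith
    refine ⟨u, hu, fun j => ?_⟩
    have hj := j.2
    by_cases h3 : j.val + 3 < n
    · have hj' : (j.val : ℤ) + 3 < n := by exact_mod_cast h3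
      refine row_sum_pos (fun i => by simp) typeD_off hu j
        (fun i => i.val + 1 = j.val) (fun i => j.val + 1 = i.val) (fun _ => False)
        (2 * j.val * (2 * n - 1 - j.val)) (2 * (j.val + 2) * (2 * n - 3 - j.val)) 0
        (fun i k h h' => by ext; omega) (fun i k h h' => by ext; omega) (by simp)
        (fun i h => by rw [typeD_adj hn] at h; omega)
        (mul_nonneg (by positivity) (by linarith)) (mul_nonneg (by positivity) (by linarith))
        le_rfl (fun i h => ?_) (fun i h => ?_) (by simp) ?_
      · rw [hu1 i (by omega), ← h]; push_cast; nlinarith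
      · rw [hu1 i (by omega), ← h]; push_cast; nlinarith
      · rw [hu1 j (by omega)]; nlinarith
    by_cases h2 : j.val + 3 = n
    · have hj' : (n : ℤ) = j.val + 3 := by exact_mod_cast h2.symm
      refine row_sum_pos (fun i => by simp) typeD_off hu j
        (fun i => i.val + 1 = j.val) (fun i => i.val + 2 = n) (fun i => i.val + 1 = n)
        (2 * j.val * (2 * n - 1 - j.val)) (n * (n - 1)) (n * (n - 1))
        (fun i k h h' => by ext; omega) (fun i k h h' => by ext; omega)
        (fun i k h h' => by ext; omega) (fun i h => by rw [typeD_adj hn] at h; omega)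
        (mul_nonneg (by positivity) (by linarith)) (by nlinarith) (by nlinarith)
        (fun i h => ?_) (fun i h => ?_) (fun i h => ?_) ?_
      · rw [hu1 i (by omega), ← h]; push_cast; nlinarith
      · rw [hu2 i (by omega)]
      · rw [hu2 i (by omega)]
      · rw [hu1 j (by omega), hj']; nlinarith
    · refine row_sum_pos (fun i => by simp) typeD_off hu j
        (fun i => i.val + 3 = n) (fun _ => False) (fun _ => False)
        (2 * (n - 2) * (n + 1)) 0 0
        (fun i k h h' => by ext; omega) (by simp) (by simp)
        (fun i h => by rw [typeD_adj hn] at h; omega)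
        (by nlinarith) le_rfl le_rfl
        (fun i h => ?_) (by simp) (by simp) ?_
      · have hi' : (n : ℤ) = i.val + 3 := by exact_mod_cast h.symm
        rw [hu1 i (by omega), hi']; nlinarith
      · rw [hu2 j (by omega)]; nlinarith
  tree := tree_of_depth (fun i j => congrFun (congrFun (CartanMatrix.D_transpose n) j) i)
    (fun i => i.val) (fun i j h => by rw [typeD_adj hn] at h; omega)
    (fun i j k h h' hj hk => by
      rw [typeD_adj hn] at h h'; ext; omega)
  conn := conn_of_depth (fun i j => congrFun (congrFun (CartanMatrix.D_transpose n) j) i)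
    (fun i => i.val) (fun i j h h' => by ext; omega)
    (fun i h => by
      by_cases hi : i.val + 1 = n
      · exact ⟨⟨n - 3, by omega⟩, by rw [typeD_adj hn]; simp only at h ⊢; omega,
          by simp only at h ⊢; omega⟩
      · exact ⟨⟨i.val - 1, by omega⟩, by rw [typeD_adj hn]; simp only at h ⊢; omega,
          by simp only at h ⊢; omega⟩)
  deg i a b c d h1 h2 h3 h4 g1 g2 g3 g4 g5 g6 := by
    rw [typeD_adj hn] at *
    simp only [ne_eq, Fin.ext_iff] at *
    omega
  branch := by
    have : ∀ i, IsBranch (CartanMatrix.D n) i → i.val + 3 = n := by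
      rintro i ⟨a, b, c, g1, g2, g3, h1, h2, h3⟩
      rw [typeD_adj hn] at *
      simp only [ne_eq, Fin.ext_iff] at *
      omega
    intro i j hi hj
    have h1 := this i hi
    have h2 := this j hj
    ext; omega

lemma isDynkin_E₆ : IsDynkin CartanMatrix.E₆ where
  symm i j := congrFun (congrFun CartanMatrix.E₆_transpose j) i
  diag := CartanMatrix.E₆_diag
  off i j h := by
    fin_cases i <;> fin_cases j <;> simp_all [CartanMatrix.E₆]
  pos := ⟨![16, 22, 30, 42, 30, 16], by decide, by decide⟩
  tree := tree_of_depth (fun i j => congrFun (congrFun CartanMatrix.E₆_transpose j) i)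
    ![2, 1, 1, 0, 1, 2] (by simp only [adjE_iff]; decide) (by simp only [adjE_iff]; decide)
  conn := conn_of_depth (fun i j => congrFun (congrFun CartanMatrix.E₆_transpose j) i)
    ![2, 1, 1, 0, 1, 2] (by decide) (by simp only [adjE_iff]; decide)
  deg := by
    simp only [adjE_iff]
    exact deg_of_card (by decide)
  branch := by
    have : ∀ i, IsBranch CartanMatrix.E₆ i → i = 3 := by
      simp only [IsBranch, adjE_iff]; decide
    exact fun i j hi hj => (this i hi).trans (this j hj).symm

lemma IsTypeADE6.isDynkin {ι : Type*} [Fintype ι] {A : Matrix ι ι ℤ} (h : IsTypeADE6 A) :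
    IsDynkin A := by
  rcases h with ⟨n, e, rfl⟩ | ⟨n, e, hn, rfl⟩ | ⟨e, rfl⟩
  · exact (isDynkin_A n).submatrix e
  · exact (isDynkin_D n hn).submatrix e
  · exact isDynkin_E₆.submatrix e

/-! ### Orbits of diagram automorphisms -/

/-- If the diagram has a branch vertex, then a diagram automorphism preserves the two classes of
the bipartition `par`, so that adjacent vertices are in different orbits. -/
lemma not_sameCycle_of_branch {ι : Type*} [Fintype ι] {A : Matrix ι ι ℤ} (hA : IsDynkin A)
    (σ : Equiv.Perm ι) (hσ : ∀ i j, A (σ i) (σ j) = A i j) (par : ι → Bool)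
    (hpar : ∀ i j, A i j = -1 → par i ≠ par j) {b : ι} (hb : IsBranch A b)
    {i j : ι} (hij : A i j = -1) : ¬ σ.SameCycle i j := by
  have hσb : σ b = b := by
    obtain ⟨x, y, z, h1, h2, h3, h⟩ := hb
    refine hA.branch _ _ ⟨σ x, σ y, σ z, σ.injective.ne h1, σ.injective.ne h2,
      σ.injective.ne h3, ?_⟩ ⟨x, y, z, h1, h2, h3, h⟩
    simpa only [hσ] using h
  have hp : ∀ i, par (σ i) = par i := by
    refine hA.conn {i | par (σ i) = par i} ⟨b, by simp [hσb]⟩ fun i j hi h => ?_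
    have h1 := hpar _ _ h
    have h2 := hpar (σ i) (σ j) (by rw [hσ, h])
    have h3 : par (σ i) = par i := hi
    change par (σ j) = par j
    revert h1 h2 h3
    cases par i <;> cases par j <;> cases par (σ i) <;> cases par (σ j) <;> simp
  intro h
  refine hpar i j hij ?_
  obtain ⟨k, rfl⟩ := h
  have : ∀ k : ℤ, ∀ i, par ((σ ^ k) i) = par i := by
    intro k
    induction k with
    | zero => simp
    | succ n ih => intro i; rw [zpow_add_one, Equiv.Perm.mul_apply, ih, hp]
    | pred n ih =>
      intro i
      rw [zpow_sub_one, Equiv.Perm.mul_apply, ih, ← hp (σ⁻¹ i), ← Equiv.Perm.mul_apply, mul_inv_cancel,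
        Equiv.Perm.one_apply]
  exact (this k i).symm

/-- An automorphism of the path with `n` vertices is the identity or the flip. -/
lemma typeA_aut {n : ℕ} (σ : Equiv.Perm (Fin n))
    (hσ : ∀ i j, CartanMatrix.A n (σ i) (σ j) = CartanMatrix.A n i j) :
    (∀ i, σ i = i) ∨ ∀ i, (σ i).val + i.val + 1 = n := by
  have hadj : ∀ i j : Fin n, i.val + 1 = j.val →
      (σ i).val + 1 = (σ j).val ∨ (σ j).val + 1 = (σ i).val := by
    intro i j h
    rw [← typeA_adj, hσ, typeA_adj]; omega
  have hadj' : ∀ i j : Fin n, (σ i).val + 1 = (σ j).val → i.val + 1 = j.val ∨ j.val + 1 = i.val := by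
    intro i j h
    rw [← typeA_adj, ← hσ, typeA_adj]; omega
  rcases Nat.eq_zero_or_pos n with rfl | hn
  · exact Or.inl fun i => i.elim0
  obtain ⟨o, ho⟩ : ∃ o : Fin n, o.val = 0 := ⟨⟨0, hn⟩, rfl⟩
  -- the image of the end vertex `o` is an end vertex
  have hend : (σ o).val = 0 ∨ (σ o).val + 1 = n := by
    by_contra! hcon
    obtain ⟨x, hx⟩ := σ.surjective ⟨(σ o).val - 1, by omega⟩
    obtain ⟨y, hy⟩ := σ.surjective ⟨(σ o).val + 1, by have := (σ o).2; omega⟩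
    have hx' : (σ x).val = (σ o).val - 1 := by rw [hx]
    have hy' : (σ y).val = (σ o).val + 1 := by rw [hy]
    have h1 := hadj' x o (by omega)
    have h2 := hadj' o y (by omega)
    have : x = y := by ext; omega
    subst this; omega
  have hinj : ∀ i j : Fin n, (σ i).val = (σ j).val → i.val = j.val := fun i j h =>
    congrArg Fin.val (σ.injective (Fin.ext h))
  rcases hend with h0 | h0
  · left
    have : ∀ k, ∀ i : Fin n, i.val = k → (σ i).val = k := by
      intro k
      induction k using Nat.strong_induction_on with
      | _ k ih =>
        intro i hi
        rcases Nat.eq_zero_or_pos k with rfl | hk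
        · have : i = o := by ext; omega
          rw [this, h0]
        · have h1 := ih (k - 1) (by omega) ⟨k - 1, by omega⟩ rfl
          have h2 := hadj ⟨k - 1, by omega⟩ i (by simp only; omega)
          rcases h2 with h2 | h2
          · omega
          · have h3 := ih (k - 2) (by omega) ⟨k - 2, by omega⟩ rfl
            have h4 := hinj i ⟨k - 2, by omega⟩ (by omega)
            simp only at h4
            omega
    exact fun i => Fin.ext (this _ i rfl)
  · right
    have : ∀ k, ∀ i : Fin n, i.val = k → (σ i).val + k + 1 = n := by
      intro k
      induction k using Nat.strong_induction_on with
      | _ k ih =>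
        intro i hi
        rcases Nat.eq_zero_or_pos k with rfl | hk
        · have : i = o := by ext; omega
          rw [this]; omega
        · have h1 := ih (k - 1) (by omega) ⟨k - 1, by omega⟩ rfl
          have h2 := hadj ⟨k - 1, by omega⟩ i (by simp only; omega)
          rcases h2 with h2 | h2
          · by_cases hk2 : k = 1
            · have := (σ i).2
              subst hk2
              omega
            · have h3 := ih (k - 2) (by omega) ⟨k - 2, by omega⟩ rfl
              have h4 := hinj i ⟨k - 2, by omega⟩ (by omega)
              simp only at h4
              omega
          · omega
    exact fun i => this _ i rfl

/-- Two adjacent vertices in the same orbit of a diagram automorphism form the whole orbit; this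
happens only for the flip in type `A` with an even number of vertices. -/
lemma IsTypeADE6.orbit_eq_pair {ι : Type*} [Fintype ι] {A : Matrix ι ι ℤ} (h : IsTypeADE6 A)
    (σ : Equiv.Perm ι) (hσ : ∀ i j, A (σ i) (σ j) = A i j) {i j : ι} (hij : A i j = -1)
    (hc : σ.SameCycle i j) (k : ι) (hk : σ.SameCycle i k) : k = i ∨ k = j := by
  have hA := h.isDynkin
  rcases h with ⟨n, e, rfl⟩ | ⟨n, e, hn, rfl⟩ | ⟨e, rfl⟩
  · rcases typeA_aut (e.permCongr σ) (fun i j => by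
      have := hσ (e.symm i) (e.symm j)
      simpa [Equiv.permCongr_apply] using this) with h | h
    · have hσ1 : σ = 1 := by
        ext x
        have := h (e x)
        simpa [Equiv.permCongr_apply] using this
      subst hσ1
      rw [Equiv.Perm.sameCycle_one] at hk
      exact Or.inl hk.symm
    · have h' : ∀ x, (e (σ x)).val + (e x).val + 1 = n := fun x => by
        simpa [Equiv.permCongr_apply] using h (e x)
      have hsq : ∀ x, σ (σ x) = x := fun x => by
        apply e.injective; ext
        have := h' x
        have := h' (σ x)
        omega
      have hcyc : ∀ x, σ.SameCycle i x → x = i ∨ x = σ i := by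
        rintro x ⟨m, rfl⟩
        induction m with
        | zero => simp
        | succ m ih =>
          rw [zpow_add_one, ← (Commute.zpow_self σ m).eq.symm, Equiv.Perm.mul_apply]
          rcases ih with h | h <;> rw [h] <;> simp [hsq]
        | pred m ih =>
          have hinv : ∀ x, σ⁻¹ x = σ x := fun x => by
            rw [Equiv.Perm.inv_eq_iff_eq, hsq]
          rw [zpow_sub_one, ← ((Commute.refl σ).zpow_left _).inv_right.eq.symm,
            Equiv.Perm.mul_apply, hinv]
          rcases ih with h | h <;> rw [h] <;> simp [hsq]
      have hne : i ≠ j := fun h => by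
        rw [h, hA.diag] at hij; omega
      rcases hcyc j hc with h1 | h1
      · exact absurd h1.symm hne
      · rw [h1]; exact hcyc k hk
  · refine absurd hc (not_sameCycle_of_branch hA σ hσ
      (fun i => decide ((if (e i).val + 1 = n then n - 2 else (e i).val) % 2 = 0)) ?_
      (b := e.symm ⟨n - 3, by omega⟩)
      ⟨e.symm ⟨n - 4, by omega⟩, e.symm ⟨n - 2, by omega⟩, e.symm ⟨n - 1, by omega⟩,
        ?_, ?_, ?_, ?_, ?_, ?_⟩ hij)
    · intro i j h
      rw [Matrix.submatrix_apply, typeD_adj hn] at h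
      simp only [ne_eq, decide_eq_decide]
      split_ifs <;> omega
    all_goals
      simp only [ne_eq, EmbeddingLike.apply_eq_iff_eq, Fin.mk.injEq, Matrix.submatrix_apply,
        Equiv.apply_symm_apply, typeD_adj hn]
      omega
  · refine absurd hc (not_sameCycle_of_branch hA σ hσ
      (fun i => ![true, false, false, true, false, true] (e i)) ?_
      (b := e.symm 3) ⟨e.symm 1, e.symm 2, e.symm 4, by simp, by simp, by simp, ?_, ?_, ?_⟩ hij)
    · intro i j h
      have : ∀ i j : Fin 6, CartanMatrix.E₆ i j = -1 →
          ![true, false, false, true, false, true] i ≠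
            ![true, false, false, true, false, true] j := by
        simp only [adjE_iff]; decide
      exact this _ _ h
    all_goals simp [CartanMatrix.E₆]

/-! ### Minuscule sets of integer vectors -/

section Minuscule

variable {ι : Type*} [Fintype ι]

/-- The value on the simple coroot `h_i` of the weight `λ - ∑ c_j α_j`, where `l` holds the values of
`λ` on the simple coroots. -/
def val (A : Matrix ι ι ℤ) (l c : ι → ℤ) (i : ι) : ℤ := l i - ∑ j, c j * A j i

variable {A : Matrix ι ι ℤ} {l : ι → ℤ}

lemma val_zero (i : ι) : val A l 0 i = l i := by simp [val]

lemma val_sub_val (c d : ι → ℤ) (i : ι) :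
    val A l c i - val A l d i = ∑ j, (d j - c j) * A j i := by
  simp [val, sub_mul, Finset.sum_sub_distrib]

lemma val_neg (c : ι → ℤ) (i : ι) : val A (-l) (-c) i = -val A l c i := by
  simp [val]; ring

variable [DecidableEq ι]

lemma val_add_single (c : ι → ℤ) (j : ι) (t : ℤ) (i : ι) :
    val A l (c + Pi.single j t) i = val A l c i - t * A j i := by
  simp only [val, Pi.add_apply, add_mul, Finset.sum_add_distrib]
  rw [Finset.sum_eq_single j (f := fun x => (Pi.single j t : ι → ℤ) x * A x i)]
  · simp; ring
  · intro k _ hk; simp [hk]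
  · simp

/-- A set of integer vectors `c`, standing for the weights `λ - ∑ c_j α_j`, that is stable under the
simple reflections and on which the simple coroots only take the values `-1, 0, 1`. -/
structure IsMinusculeSet (A : Matrix ι ι ℤ) (l : ι → ℤ) (O : Set (ι → ℤ)) : Prop where
  val_mem : ∀ c ∈ O, ∀ i, val A l c i = -1 ∨ val A l c i = 0 ∨ val A l c i = 1
  step : ∀ c ∈ O, ∀ i, c + Pi.single i (val A l c i) ∈ O

/-- A minuscule set with smallest element `0`, the dominant weight `λ` itself. -/
structure IsMinusculeOrbit (A : Matrix ι ι ℤ) (l : ι → ℤ) (O : Set (ι → ℤ)) : Prop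
    extends IsMinusculeSet A l O where
  zero_mem : 0 ∈ O
  nonneg : ∀ c ∈ O, 0 ≤ c

lemma IsDynkin.apply_nonpos (hA : IsDynkin A) {i j : ι} (h : i ≠ j) : A i j ≤ 0 := by
  rcases hA.off i j h with h | h <;> simp [h]

lemma IsDynkin.exists_pos (hA : IsDynkin A) {n : ι → ℤ} (hn : 0 ≤ n) (hn0 : n ≠ 0) :
    ∃ i, 0 < n i ∧ 0 < ∑ j, n j * A j i := by
  obtain ⟨u, hu, hAu⟩ := hA.pos
  have h1 : 0 < ∑ i, (∑ j, n j * A j i) * u i := by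
    simp only [Finset.sum_mul]
    rw [Finset.sum_comm]
    have h2 : ∀ j, ∑ i, n j * A j i * u i = n j * ∑ i, A j i * u i := fun j => by
      rw [Finset.mul_sum]; exact Finset.sum_congr rfl fun i _ => mul_assoc _ _ _
    simp only [h2]
    obtain ⟨j, hj⟩ := Function.ne_iff.mp hn0
    exact Finset.sum_pos' (fun j _ => mul_nonneg (hn j) (hAu j).le)
      ⟨j, Finset.mem_univ j, mul_pos (lt_of_le_of_ne (hn j) (Ne.symm hj)) (hAu j)⟩
  obtain ⟨i, -, hi⟩ := Finset.exists_lt_of_sum_lt (s := Finset.univ) (f := fun _ : ι => (0 : ℤ))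
    (g := fun i => (∑ j, n j * A j i) * u i) (by simpa using h1)
  have hi' : 0 < ∑ j, n j * A j i := lt_of_not_ge fun h => absurd hi
    (not_lt.mpr (mul_nonpos_of_nonpos_of_nonneg h (hu i)))
  refine ⟨i, ?_, hi'⟩
  by_contra hni
  have hni : n i = 0 := le_antisymm (not_lt.mp hni) (hn i)
  refine absurd hi' (not_lt.mpr (Finset.sum_nonpos fun j _ => ?_))
  by_cases hji : j = i
  · rw [hji, hni]; simp
  · exact mul_nonpos_of_nonneg_of_nonpos (hn j) (hA.apply_nonpos hji)

/-- The sum of `n_j A_ji` over `j ≠ i` is nonpositive, so the whole sum is at most `2 n_i`. -/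
lemma IsDynkin.sum_le (hA : IsDynkin A) {n : ι → ℤ} (hn : 0 ≤ n) (i : ι) :
    ∑ j, n j * A j i ≤ 2 * n i := by
  rw [← Finset.add_sum_erase _ _ (Finset.mem_univ i), hA.diag]
  have : ∑ j ∈ Finset.univ.erase i, n j * A j i ≤ 0 := Finset.sum_nonpos fun j hj =>
    mul_nonpos_of_nonneg_of_nonpos (hn j) (hA.apply_nonpos (Finset.ne_of_mem_erase hj))
  linarith

namespace IsMinusculeSet

variable {O : Set (ι → ℤ)}

lemma neg (hO : IsMinusculeSet A l O) : IsMinusculeSet A (-l) {c | -c ∈ O} where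
  val_mem c hc i := by
    have := hO.val_mem (-c) hc i
    rw [← neg_neg c, val_neg]
    omega
  step c hc i := by
    have := hO.step (-c) hc i
    have h := val_neg (A := A) (l := l) (-c) i
    rw [neg_neg] at h
    change -(c + _) ∈ O
    rw [h, neg_add, ← Pi.single_neg, neg_neg]
    exact this

lemma add_mem (hO : IsMinusculeSet A l O) {c : ι → ℤ} (hc : c ∈ O) {i : ι}
    (h : val A l c i = 1) : c + Pi.single i 1 ∈ O := h ▸ hO.step c hc i

lemma sub_mem (hO : IsMinusculeSet A l O) {c : ι → ℤ} (hc : c ∈ O) {i : ι}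
    (h : val A l c i = -1) : c - Pi.single i 1 ∈ O := by
  have := hO.step c hc i
  rwa [h, Pi.single_neg, ← sub_eq_add_neg] at this

lemma val_eq_one_of_add_mem (hA : IsDynkin A) (hO : IsMinusculeSet A l O) {c : ι → ℤ}
    (hc : c ∈ O) {i : ι} (h : c + Pi.single i 1 ∈ O) : val A l c i = 1 := by
  have h1 := hO.val_mem _ h i
  have h2 := hO.val_mem _ hc i
  rw [val_add_single, hA.diag] at h1
  omega

/-- The relation `c → c + e_i` within `O`: a step of the weak order. -/
def Step (O : Set (ι → ℤ)) (a b : ι → ℤ) : Prop :=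
  a ∈ O ∧ b ∈ O ∧ ∃ i, b = a + Pi.single i 1

/-- The componentwise order on a minuscule set is generated by the steps `c → c + e_i`. -/
lemma exists_path (hA : IsDynkin A) (hO : IsMinusculeSet A l O) {c d : ι → ℤ} (hc : c ∈ O)
    (hd : d ∈ O) (hcd : c ≤ d) : ReflTransGen (Step O) c d := by
  obtain ⟨n, hn⟩ : ∃ n : ℕ, ∑ i, (d i - c i) = n :=
    Int.eq_ofNat_of_zero_le (Finset.sum_nonneg fun i _ => sub_nonneg.mpr (hcd i))
  induction n generalizing c d with
  | zero =>
    have h0 := (Finset.sum_eq_zero_iff_of_nonneg (fun i _ => sub_nonneg.mpr (hcd i))).mp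
      (by exact_mod_cast hn)
    have : c = d := by ext i; have := h0 i (Finset.mem_univ i); linarith
    exact this ▸ .refl
  | succ n ih =>
    have hne : d - c ≠ 0 := by
      intro h
      have : ∑ i, (d i - c i) = 0 := Finset.sum_eq_zero fun i _ => congrFun h i
      rw [this] at hn; norm_cast at hn
    obtain ⟨i, hi, hs⟩ := hA.exists_pos (sub_nonneg.mpr hcd) hne
    have hi : 0 < d i - c i := hi
    have hs : 0 < ∑ j, (d j - c j) * A j i := hs
    rw [← val_sub_val (l := l)] at hs
    have h1 := hO.val_mem c hc i
    have h2 := hO.val_mem d hd i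
    have hsum : ∑ j, (Pi.single i 1 : ι → ℤ) j = 1 := by simp
    by_cases hci : val A l c i = 1
    · have hc' := hO.add_mem hc hci
      refine .head ⟨hc, hc', i, rfl⟩ (ih hc' hd ?_ ?_)
      · intro j
        by_cases hj : j = i
        · subst hj; simp; omega
        · simp [hj, hcd j]
      · simp only [Pi.add_apply, ← sub_sub, Finset.sum_sub_distrib] at hn ⊢
        push_cast at hn; linarith
    · have hdi : val A l d i = -1 := by omega
      have hd' := hO.sub_mem hd hdi
      refine .tail (ih hc hd' ?_ ?_) ⟨hd', hd, i, by simp⟩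
      · intro j
        by_cases hj : j = i
        · subst hj; simp; omega
        · simp [hj, hcd j]
      · simp only [Pi.sub_apply, Finset.sum_sub_distrib] at hn ⊢
        push_cast at hn; linarith

lemma le_of_path {c d : ι → ℤ} (h : ReflTransGen (Step O) c d) : c ≤ d := by
  induction h with
  | refl => exact le_rfl
  | tail _ h ih =>
    obtain ⟨-, -, i, rfl⟩ := h
    exact ih.trans (le_add_of_nonneg_right (Pi.single_nonneg.mpr zero_le_one))

/-- Parallel steps: a step at a coordinate in which `c ≤ d` agree is also possible at `d`. -/
lemma val_eq_one_of_le (hA : IsDynkin A) (hO : IsMinusculeSet A l O) {c d : ι → ℤ}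
    (hd : d ∈ O) (hcd : c ≤ d) {i : ι} (hi : val A l c i = 1) (hdi : d i ≤ c i) :
    val A l d i = 1 := by
  have h1 := hA.sum_le (sub_nonneg.mpr hcd) i
  have h2 := val_sub_val (A := A) (l := l) c d i
  have h3 := hO.val_mem d hd i
  simp only [Pi.sub_apply] at h1
  omega

lemma sup_mem_of_le (hA : IsDynkin A) (hO : IsMinusculeSet A l O) {a c d : ι → ℤ} (ha : a ∈ O)
    (hc : c ∈ O) (hd : d ∈ O) (hac : a ≤ c) (had : a ≤ d) : c ⊔ d ∈ O := by
  have hp := hO.exists_path hA ha hc hac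
  clear hac ha
  induction hp using ReflTransGen.head_induction_on generalizing d with
  | refl => rwa [sup_eq_right.mpr had]
  | @head a b h hbc ih =>
    obtain ⟨haO, hbO, i, rfl⟩ := h
    have hle := le_of_path hbc
    by_cases hdi : a i < d i
    · refine ih hd fun j => ?_
      by_cases hj : j = i
      · subst hj; simp; omega
      · simp [hj, had j]
    · have h1 := hO.val_eq_one_of_add_mem hA haO hbO
      have h2 := hO.val_eq_one_of_le hA hd had h1 (not_lt.mp hdi)
      have h3 := ih (hO.add_mem hd h2) (add_le_add_left had _)
      convert h3 using 1
      ext j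
      by_cases hj : j = i
      · subst hj
        have := hle j
        have := had j
        simp at this hdi ⊢
        simp at *
        omega
      · simp [hj]

lemma inf_mem_of_le (hA : IsDynkin A) (hO : IsMinusculeSet A l O) {a c d : ι → ℤ} (ha : a ∈ O)
    (hc : c ∈ O) (hd : d ∈ O) (hac : c ≤ a) (had : d ≤ a) : c ⊓ d ∈ O := by
  have := hO.neg.sup_mem_of_le hA (a := -a) (c := -c) (d := -d) (by simpa) (by simpa) (by simpa)
    (neg_le_neg hac) (neg_le_neg had)
  rw [← neg_inf] at this
  simpa using this

end IsMinusculeSet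

namespace IsMinusculeOrbit

variable {O : Set (ι → ℤ)}

lemma sup_mem (hA : IsDynkin A) (hO : IsMinusculeOrbit A l O) {c d : ι → ℤ} (hc : c ∈ O)
    (hd : d ∈ O) : c ⊔ d ∈ O :=
  hO.sup_mem_of_le hA hO.zero_mem hc hd (hO.nonneg c hc) (hO.nonneg d hd)

lemma inf_mem (hA : IsDynkin A) (hO : IsMinusculeOrbit A l O) {c d : ι → ℤ} (hc : c ∈ O)
    (hd : d ∈ O) : c ⊓ d ∈ O :=
  hO.inf_mem_of_le hA (hO.sup_mem hA hc hd) hc hd le_sup_left le_sup_right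

lemma l_nonneg (hO : IsMinusculeOrbit A l O) (i : ι) : 0 ≤ l i := by
  by_contra h
  have h1 := hO.val_mem 0 hO.zero_mem i
  rw [val_zero] at h1
  have h2 := hO.sub_mem hO.zero_mem (i := i) (by rw [val_zero]; omega)
  have h3 := hO.nonneg _ h2 i
  simp at h3

/-- A nonzero element of the orbit is not dominant. -/
lemma exists_val_neg (hA : IsDynkin A) (hO : IsMinusculeOrbit A l O) {c : ι → ℤ} (hc : c ∈ O)
    (h0 : c ≠ 0) : ∃ i, val A l c i = -1 := by
  rcases ReflTransGen.cases_tail (hO.exists_path hA hO.zero_mem hc (hO.nonneg c hc)) with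
    h | ⟨d, -, hd, -, i, rfl⟩
  · exact absurd h h0
  · refine ⟨i, ?_⟩
    have := hO.val_eq_one_of_add_mem hA hd hc
    rw [val_add_single, hA.diag]; omega

/-- A minuscule orbit is finite, since an element is determined by its values `-1, 0, 1` on the
simple coroots. -/
lemma finite (hinj : ∀ n : ι → ℤ, (∀ i, ∑ j, n j * A j i = 0) → n = 0)
    (hO : IsMinusculeSet A l O) : O.Finite := by
  have : Set.InjOn (val A l) O := by
    intro c _ d _ h
    have h1 := hinj (d - c) fun i => by
      have := val_sub_val (A := A) (l := l) c d i
      rw [h, sub_self] at this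
      exact this.symm
    exact (sub_eq_zero.mp h1).symm
  refine Set.Finite.of_finite_image (f := val A l) ?_ this
  refine (Set.Finite.pi' (t := fun _ : ι => ({-1, 0, 1} : Set ℤ))
    fun _ => Set.toFinite _).subset ?_
  rintro _ ⟨c, hc, rfl⟩ i
  simpa using hO.val_mem c hc i

/-- A nonzero minuscule dominant weight is a fundamental weight. Here `∑_{i ∈ S} e_i` is in the orbit
for growing connected sets `S` of vertices; a second vertex with `l = 1` would give the value `2`. -/
lemma eq_single (hA : IsDynkin A) (hO : IsMinusculeOrbit A l O) {i : ι} (hi : l i ≠ 0) :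
    l = Pi.single i 1 := by
  have hval0 : ∀ j, l j = 0 ∨ l j = 1 := fun j => by
    have h1 := hO.val_mem 0 hO.zero_mem j
    have h2 := hO.l_nonneg j
    rw [val_zero] at h1; omega
  have hli : l i = 1 := (hval0 i).resolve_left hi
  let good : Finset ι → Prop := fun S => i ∈ S ∧ (fun j => if j ∈ S then (1 : ℤ) else 0) ∈ O ∧
    ∀ j ∈ S, j ≠ i → l j = 0
  have hg0 : good {i} := by
    refine ⟨by simp, ?_, by simp⟩
    have := hO.add_mem hO.zero_mem (i := i) (by rw [val_zero, hli])
    convert this using 1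
    ext j
    simp [Pi.single_apply]
  obtain ⟨S, hS, hmax⟩ := Set.Finite.exists_maximal (Set.toFinite {S | good S}) ⟨_, hg0⟩
  obtain ⟨hiS, hSO, hSl⟩ := hS
  have hall := hA.conn (↑S) ⟨i, hiS⟩ (by
    intro a b ha hab
    by_contra hb
    have hb : b ∉ S := hb
    have ha : a ∈ S := ha
    have hsum : val A l (fun j => if j ∈ S then (1 : ℤ) else 0) b ≥ l b + 1 := by
      have h1 : ∑ j, (if j ∈ S then (1 : ℤ) else 0) * A j b ≤ -1 := by
        rw [← Finset.add_sum_erase _ _ (Finset.mem_univ a), if_pos ha, hab]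
        have : ∑ j ∈ Finset.univ.erase a, (if j ∈ S then (1 : ℤ) else 0) * A j b ≤ 0 := by
          refine Finset.sum_nonpos fun j _ => ?_
          split_ifs with hj
          · rw [one_mul]
            exact hA.apply_nonpos fun h => hb (h ▸ hj)
          · simp
        linarith
      simp only [val]; linarith
    have h2 := hO.val_mem _ hSO b
    have h3 := hO.l_nonneg b
    have h4 : good (insert b S) := by
      refine ⟨by simp [hiS], ?_, ?_⟩
      · have := hO.add_mem hSO (i := b) (by omega)
        convert this using 1
        ext j
        by_cases hj : j = b
        · subst hj; simp [hb]
        · simp [hj]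
      · intro j hj hji
        rcases Finset.mem_insert.mp hj with rfl | hj
        · omega
        · exact hSl j hj hji
    exact hb (hmax h4 (Finset.subset_insert b S) (Finset.mem_insert_self b S)))
  ext j
  by_cases hj : j = i
  · subst hj; simp [hli]
  · simp [hj, hSl j (hall j) hj]

end IsMinusculeOrbit

/-! ### Orbits under the simple reflections -/

/-- The orbit of `0` under the simple reflections `c ↦ c + val c i • e_i`. -/
def reach (A : Matrix ι ι ℤ) (l : ι → ℤ) : Set (ι → ℤ) :=
  {c | ReflTransGen (fun a b => ∃ i, b = a + Pi.single i (val A l a i)) 0 c}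

/-- The orbit of a minuscule dominant weight consists of weights below it: every element is reached
by steps `c → c + e_i` only. -/
lemma isMinusculeOrbit_reach (hA : IsDynkin A) (hl : 0 ≤ l)
    (hval : ∀ c ∈ reach A l, ∀ i, val A l c i = -1 ∨ val A l c i = 0 ∨ val A l c i = 1) :
    IsMinusculeOrbit A l (reach A l) where
  val_mem := hval
  step c hc i := hc.tail ⟨i, rfl⟩
  zero_mem := .refl
  nonneg := by
    let up : (ι → ℤ) → (ι → ℤ) → Prop := fun a b => ∃ i, val A l a i = 1 ∧ b = a + Pi.single i 1
    have hup : ∀ c, ReflTransGen up 0 c → c ∈ reach A l := by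
      intro c hc
      refine ReflTransGen.mono ?_ _ _ hc
      rintro a b ⟨i, h1, rfl⟩
      exact ⟨i, by rw [h1]⟩
    -- the set of elements reached by up-steps is closed under down-steps
    have hdown : ∀ c, ReflTransGen up 0 c → ∀ i, val A l c i = -1 →
        ReflTransGen up 0 (c - Pi.single i 1) := by
      intro c hc
      induction hc with
      | refl =>
        intro i hi
        rw [val_zero] at hi
        have := hl i
        simp only [Pi.zero_apply] at this
        omega
      | @tail a b ha hab ih =>
        obtain ⟨j, hj, rfl⟩ := hab
        intro i hi
        by_cases hij : i = j
        · subst hij; simpa using ha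
        · rw [val_add_single] at hi
          have h1 := hval a (hup a ha) i
          have h2 := hA.off j i (Ne.symm hij)
          have h3 : A j i = 0 := by omega
          have h4 := ih i (by omega)
          refine h4.tail ⟨j, ?_, by abel⟩
          rw [sub_eq_add_neg, ← Pi.single_neg, val_add_single, hA.symm i j, h3, hj]; simp
    have hcl : ∀ c ∈ reach A l, ReflTransGen up 0 c := by
      intro c hc
      induction hc with
      | refl => exact .refl
      | @tail a b ha hab ih =>
        obtain ⟨i, rfl⟩ := hab
        rcases hval a ha i with h | h | h
        · rw [h, Pi.single_neg, ← sub_eq_add_neg]; exact hdown a ih i h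
        · rw [h]; simpa using ih
        · rw [h]; exact ih.tail ⟨i, h, rfl⟩
    intro c hc
    replace hc := hcl c hc
    induction hc with
    | refl => exact le_rfl
    | tail _ h ih =>
      obtain ⟨i, -, rfl⟩ := h
      exact ih.trans (le_add_of_nonneg_right (Pi.single_nonneg.mpr zero_le_one))

end Minuscule

/-! ### Double-tailed diamonds -/

section Diamonds

variable {P : Type*} [PartialOrder P]

/-- The set `S` is a chain of `m` elements, followed by two incomparable elements, followed by a
chain of `n` elements. -/
def IsTailed (m n : ℕ) (S : Set P) : Prop :=
  ∃ (f : Fin m → P) (a b : P) (g : Fin n → P), StrictMono f ∧ StrictMono g ∧ ¬ a ≤ b ∧ ¬ b ≤ a ∧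
    (∀ i, f i < a ∧ f i < b) ∧ (∀ j, a < g j ∧ b < g j) ∧
    S = Set.range f ∪ ({a, b} ∪ Set.range g)

lemma nonempty_orderIso_iff {m n : ℕ} {S : Set P} :
    Nonempty (S ≃o Fin m ⊕ₗ ((Unit ⊕ Unit) ⊕ₗ Fin n)) ↔ IsTailed m n S := by
  constructor
  · rintro ⟨e⟩
    let ψ : Fin m ⊕ₗ ((Unit ⊕ Unit) ⊕ₗ Fin n) → P := fun t => (e.symm t : P)
    have hψ : ∀ s t, ψ s ≤ ψ t ↔ s ≤ t := fun s t => by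
      change ((e.symm s : S) : P) ≤ (e.symm t : S) ↔ _
      rw [Subtype.coe_le_coe, e.symm.le_iff_le]
    have hψ' : ∀ s t, ψ s < ψ t ↔ s < t := fun s t => by
      rw [lt_iff_le_not_ge, lt_iff_le_not_ge, hψ, hψ]
    have hlr : ∀ {α β : Type} [LE α] [LE β] (a : α) (b : β),
        ¬ (toLex (Sum.inr b) : α ⊕ₗ β) ≤ toLex (Sum.inl a) := by
      intro α β _ _ a b
      exact Sum.Lex.not_inr_le_inl
    refine ⟨fun i => ψ (toLex (.inl i)), ψ (toLex (.inr (toLex (.inl (.inl ()))))),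
      ψ (toLex (.inr (toLex (.inl (.inr ()))))), fun j => ψ (toLex (.inr (toLex (.inr j)))),
      ?_, ?_, ?_, ?_, ?_, ?_, ?_⟩
    · intro i j h; exact (hψ' _ _).2 (Sum.Lex.inl_lt_inl_iff.2 h)
    · intro i j h
      exact (hψ' _ _).2 (Sum.Lex.inr_lt_inr_iff.2 (Sum.Lex.inr_lt_inr_iff.2 h))
    · rw [hψ, Sum.Lex.inr_le_inr_iff, Sum.Lex.inl_le_inl_iff]; simp
    · rw [hψ, Sum.Lex.inr_le_inr_iff, Sum.Lex.inl_le_inl_iff]; simp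
    · intro i
      exact ⟨(hψ' _ _).2 (Sum.Lex.inl_lt_inr _ _), (hψ' _ _).2 (Sum.Lex.inl_lt_inr _ _)⟩
    · intro j
      exact ⟨(hψ' _ _).2 (Sum.Lex.inr_lt_inr_iff.2 (Sum.Lex.inl_lt_inr _ _)),
        (hψ' _ _).2 (Sum.Lex.inr_lt_inr_iff.2 (Sum.Lex.inl_lt_inr _ _))⟩
    · ext p
      constructor
      · intro hp
        have hp' : p = ψ (e ⟨p, hp⟩) := by simp [ψ]
        rw [hp']
        rcases e ⟨p, hp⟩ with i | (u | u) | j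
        · exact Or.inl ⟨i, rfl⟩
        · exact Or.inr (Or.inl (Or.inl rfl))
        · exact Or.inr (Or.inl (Or.inr rfl))
        · exact Or.inr (Or.inr ⟨j, rfl⟩)
      · rintro (⟨i, rfl⟩ | (rfl | rfl) | ⟨j, rfl⟩) <;> exact Subtype.coe_prop _
  · rintro ⟨f, a, b, g, hf, hg, hab, hba, hfa, hga, rfl⟩
    let ψ : Fin m ⊕ₗ ((Unit ⊕ Unit) ⊕ₗ Fin n) → P := fun t =>
      Sum.elim f (fun s => Sum.elim (Sum.elim (fun _ => a) (fun _ => b)) g (ofLex s)) (ofLex t)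
    have hψ : ∀ s t, ψ s ≤ ψ t ↔ s ≤ t := by
      have h1 : ∀ i j, f i < g j := fun i j => (hfa i).1.trans (hga j).1
      rintro (i | (u | u) | j) (i' | (u' | u') | j')
      · exact hf.le_iff_le.trans Sum.Lex.inl_le_inl_iff.symm
      · exact iff_of_true (hfa i).1.le (Sum.Lex.inl_le_inr _ _)
      · exact iff_of_true (hfa i).2.le (Sum.Lex.inl_le_inr _ _)
      · exact iff_of_true (h1 i j').le (Sum.Lex.inl_le_inr _ _)
      · exact iff_of_false (hfa i').1.not_ge Sum.Lex.not_inr_le_inl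
      · exact iff_of_true le_rfl le_rfl
      · refine iff_of_false hab fun h => ?_
        have h := Sum.Lex.inl_le_inl_iff.1 (Sum.Lex.inr_le_inr_iff.1 h)
        simp at h
      · exact iff_of_true (hga j').1.le (Sum.Lex.inr_le_inr_iff.2 (Sum.Lex.inl_le_inr _ _))
      · exact iff_of_false (hfa i').2.not_ge Sum.Lex.not_inr_le_inl
      · refine iff_of_false hba fun h => ?_
        have h := Sum.Lex.inl_le_inl_iff.1 (Sum.Lex.inr_le_inr_iff.1 h)
        simp at h
      · exact iff_of_true le_rfl le_rfl
      · exact iff_of_true (hga j').2.le (Sum.Lex.inr_le_inr_iff.2 (Sum.Lex.inl_le_inr _ _))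
      · exact iff_of_false (h1 i' j).not_ge Sum.Lex.not_inr_le_inl
      · exact iff_of_false (hga j).1.not_ge fun h =>
          Sum.Lex.not_inr_le_inl (Sum.Lex.inr_le_inr_iff.1 h)
      · exact iff_of_false (hga j).2.not_ge fun h =>
          Sum.Lex.not_inr_le_inl (Sum.Lex.inr_le_inr_iff.1 h)
      · exact hg.le_iff_le.trans
          (Sum.Lex.inr_le_inr_iff.trans Sum.Lex.inr_le_inr_iff).symm
    let φ : (Fin m ⊕ₗ ((Unit ⊕ Unit) ⊕ₗ Fin n)) ↪o P := OrderEmbedding.ofMapLEIff ψ hψ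
    have hr : Set.range φ = Set.range f ∪ ({a, b} ∪ Set.range g) := by
      ext p
      constructor
      · rintro ⟨(i | (u | u) | j), rfl⟩
        · exact Or.inl ⟨i, rfl⟩
        · exact Or.inr (Or.inl (Or.inl rfl))
        · exact Or.inr (Or.inl (Or.inr rfl))
        · exact Or.inr (Or.inr ⟨j, rfl⟩)
      · rintro (⟨i, rfl⟩ | (rfl | rfl) | ⟨j, rfl⟩)
        · exact ⟨toLex (.inl i), rfl⟩
        · exact ⟨toLex (.inr (toLex (.inl (.inl ())))), rfl⟩
        · exact ⟨toLex (.inr (toLex (.inl (.inr ())))), rfl⟩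
        · exact ⟨toLex (.inr (toLex (.inr j))), rfl⟩
    exact hr ▸ ⟨φ.orderIso.symm⟩

/-- The interval `[x, y]` is a double-tailed diamond, described recursively: a diamond is four
elements, and a longer one is a shorter one with a new minimum and a new maximum. -/
inductive DInt : ℕ → P → P → Prop
  | base {x a b y : P} : ¬ a ≤ b → ¬ b ≤ a → x < a → x < b → a < y → b < y →
      Set.Icc x y = {x, a, b, y} → DInt 3 x y
  | succ {k : ℕ} {x' y' x y : P} : DInt k x' y' → x < x' → y' < y →
      Set.Icc x y = insert x (insert y (Set.Icc x' y')) → DInt (k + 1) x y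

lemma DInt.three_le {k : ℕ} {x y : P} (h : DInt k x y) : 3 ≤ k := by
  induction h <;> omega

lemma DInt.lt {k : ℕ} {x y : P} (h : DInt k x y) : x < y := by
  induction h with
  | base _ _ h1 _ h2 _ _ => exact h1.trans h2
  | succ _ h1 h2 _ ih => exact h1.trans (ih.trans h2)

/-- Peeling off the minimum of a tailed set. -/
lemma IsTailed.peel_left {m n : ℕ} {x y : P} (h : IsTailed (m + 2) n (Set.Icc x y)) :
    ∃ x', x < x' ∧ Set.Icc x y = insert x (Set.Icc x' y) ∧ IsTailed (m + 1) n (Set.Icc x' y) := by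
  obtain ⟨f, a, b, g, hf, hg, hab, hba, hfa, hga, hS⟩ := h
  have hmem : ∀ p, p ∈ Set.Icc x y ↔ (∃ i, f i = p) ∨ (p = a ∨ p = b) ∨ ∃ j, g j = p := by
    intro p; rw [hS]; rfl
  have hxy : x ≤ y := by
    have := (hmem a).2 (by simp)
    exact this.1.trans this.2
  have hmin : ∀ p ∈ Set.Icc x y, f 0 ≤ p := by
    intro p hp
    rcases (hmem p).1 hp with ⟨i, rfl⟩ | (rfl | rfl) | ⟨j, rfl⟩
    · exact hf.monotone (Fin.zero_le i)
    · exact (hfa 0).1.le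
    · exact (hfa 0).2.le
    · exact ((hfa 0).1.trans (hga j).1).le
  have hx : f 0 = x := le_antisymm (hmin x ⟨le_rfl, hxy⟩) ((hmem (f 0)).2 (by simp)).1
  have h01 : f 0 < f 1 := hf (by simp)
  have hy : f 1 ≤ y := ((hmem (f 1)).2 (by simp)).2
  have hset : Set.Icc (f 1) y = Set.range (fun i : Fin (m + 1) => f i.succ) ∪
      ({a, b} ∪ Set.range g) := by
    ext p
    constructor
    · rintro ⟨h1, h2⟩
      have hp : p ∈ Set.Icc x y := ⟨hx ▸ (h01.le.trans h1), h2⟩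
      rcases (hmem p).1 hp with ⟨i, rfl⟩ | h | h
      · refine Or.inl ?_
        rcases Fin.eq_zero_or_eq_succ i with rfl | ⟨j, rfl⟩
        · exact absurd h1 h01.not_ge
        · exact ⟨j, rfl⟩
      · exact Or.inr (Or.inl h)
      · exact Or.inr (Or.inr h)
    · rintro (⟨i, rfl⟩ | (rfl | rfl) | ⟨j, rfl⟩)
      · refine ⟨hf.monotone ?_, ((hmem _).2 (by simp)).2⟩
        exact Fin.succ_le_succ_iff.2 (Fin.zero_le i)
      · exact ⟨(hfa 1).1.le, ((hmem _).2 (by simp)).2⟩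
      · exact ⟨(hfa 1).2.le, ((hmem _).2 (by simp)).2⟩
      · exact ⟨((hfa 1).1.trans (hga j).1).le, ((hmem _).2 (by simp)).2⟩
  refine ⟨f 1, hx ▸ h01, ?_, fun i => f i.succ, a, b, g, fun i j h => hf (Fin.succ_lt_succ_iff.2 h),
    hg, hab, hba, fun i => hfa _, hga, hset⟩
  ext p
  constructor
  · intro hp
    rw [hset]
    rcases (hmem p).1 hp with ⟨i, rfl⟩ | h | h
    · rcases Fin.eq_zero_or_eq_succ i with rfl | ⟨j, rfl⟩
      · exact Or.inl hx
      · exact Or.inr (Or.inl ⟨j, rfl⟩)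
    · exact Or.inr (Or.inr (Or.inl h))
    · exact Or.inr (Or.inr (Or.inr h))
  · rintro (rfl | h)
    · exact ⟨le_rfl, hxy⟩
    · exact ⟨(hx ▸ h01.le).trans h.1, h.2⟩

lemma IsTailed.anti {Q : Type*} [PartialOrder Q] (e : P ≃ Q) (he : ∀ p q, e p ≤ e q ↔ q ≤ p)
    {m n : ℕ} {S : Set P} {T : Set Q} (hST : ∀ p, e p ∈ T ↔ p ∈ S) (h : IsTailed m n S) :
    IsTailed n m T := by
  have he' : ∀ p q, e p < e q ↔ q < p := fun p q => by
    rw [lt_iff_le_not_ge, lt_iff_le_not_ge, he, he]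
  obtain ⟨f, a, b, g, hf, hg, hab, hba, hfa, hga, hS⟩ := h
  refine ⟨fun j => e (g j.rev), e a, e b, fun i => e (f i.rev),
    fun i j h => (he' _ _).2 (hg (Fin.rev_lt_rev.2 h)),
    fun i j h => (he' _ _).2 (hf (Fin.rev_lt_rev.2 h)), by rwa [he], by rwa [he],
    fun j => ⟨(he' _ _).2 (hga _).1, (he' _ _).2 (hga _).2⟩,
    fun i => ⟨(he' _ _).2 (hfa _).1, (he' _ _).2 (hfa _).2⟩, ?_⟩
  ext q
  obtain ⟨p, rfl⟩ := e.surjective q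
  have : p ∈ S ↔ (∃ i, f i = p) ∨ (p = a ∨ p = b) ∨ ∃ j, g j = p := by
    rw [hS]; rfl
  rw [hST, this]
  constructor
  · rintro (⟨i, rfl⟩ | (rfl | rfl) | ⟨j, rfl⟩)
    · exact Or.inr (Or.inr ⟨i.rev, by simp⟩)
    · exact Or.inr (Or.inl (Or.inl rfl))
    · exact Or.inr (Or.inl (Or.inr rfl))
    · exact Or.inl ⟨j.rev, by simp⟩
  · rintro (⟨j, h⟩ | (h | h) | ⟨i, h⟩)
    · exact Or.inr (Or.inr ⟨_, e.injective h⟩)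
    · exact Or.inr (Or.inl (Or.inl (e.injective h)))
    · exact Or.inr (Or.inl (Or.inr (e.injective h)))
    · exact Or.inl ⟨_, e.injective h⟩

lemma IsTailed.dual {m n : ℕ} {S : Set P} (h : IsTailed m n S) :
    IsTailed (P := Pᵒᵈ) n m (OrderDual.ofDual ⁻¹' S) :=
  h.anti OrderDual.toDual (fun _ _ => Iff.rfl) fun _ => Iff.rfl

lemma IsTailed.of_dual {m n : ℕ} {S : Set P}
    (h : IsTailed (P := Pᵒᵈ) n m (OrderDual.ofDual ⁻¹' S)) : IsTailed m n S :=
  h.anti OrderDual.ofDual (fun _ _ => Iff.rfl) fun _ => Iff.rfl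

/-- Adding a new minimum to a tailed interval. -/
lemma IsTailed.cons {m n : ℕ} {x x' : P} {S : Set P} (h : IsTailed m n S) (hx : x < x')
    (hS : ∀ p ∈ S, x' ≤ p) : IsTailed (m + 1) n (insert x S) := by
  obtain ⟨f, a, b, g, hf, hg, hab, hba, hfa, hga, rfl⟩ := h
  have hlt : ∀ p ∈ Set.range f ∪ ({a, b} ∪ Set.range g), x < p := fun p hp => hx.trans_le (hS p hp)
  refine ⟨Fin.cons x f, a, b, g, ?_, hg, hab, hba, ?_, hga, ?_⟩
  · intro i j h
    rcases Fin.eq_zero_or_eq_succ i with rfl | ⟨i, rfl⟩ <;>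
      rcases Fin.eq_zero_or_eq_succ j with rfl | ⟨j, rfl⟩
    · exact absurd h (lt_irrefl _)
    · exact hlt _ (Or.inl ⟨j, rfl⟩)
    · exact absurd h (Fin.not_lt_zero _)
    · exact hf (Fin.succ_lt_succ_iff.1 h)
  · intro i
    rcases Fin.eq_zero_or_eq_succ i with rfl | ⟨i, rfl⟩
    · exact ⟨hlt _ (by simp), hlt _ (by simp)⟩
    · exact hfa i
  · rw [Fin.range_cons]
    exact (Set.insert_union (a := x) (s := Set.range f) (t := {a, b} ∪ Set.range g)).symm

lemma IsTailed.peel_right {m n : ℕ} {x y : P} (h : IsTailed m (n + 2) (Set.Icc x y)) :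
    ∃ y', y' < y ∧ Set.Icc x y = insert y (Set.Icc x y') ∧ IsTailed m (n + 1) (Set.Icc x y') := by
  have h' : IsTailed (n + 2) m (Set.Icc (OrderDual.toDual y) (OrderDual.toDual x)) := by
    have := h.dual
    rwa [← Set.Icc_toDual] at this
  obtain ⟨y', h1, h2, h3⟩ := h'.peel_left
  refine ⟨y'.ofDual, h1, ?_, ?_⟩
  · ext p
    have := Set.ext_iff.1 h2 (OrderDual.toDual p)
    simp only [Set.mem_insert_iff, Set.mem_Icc] at this ⊢
    constructor
    · intro hp
      exact (this.1 ⟨hp.2, hp.1⟩).imp id fun h => ⟨h.2, h.1⟩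
    · intro hp
      have := this.2 (hp.imp id fun h => ⟨h.2, h.1⟩)
      exact ⟨this.2, this.1⟩
  · refine IsTailed.of_dual ?_
    convert h3 using 1
    ext p
    exact and_comm

lemma IsTailed.snoc {m n : ℕ} {y y' : P} {S : Set P} (h : IsTailed m n S) (hy : y' < y)
    (hS : ∀ p ∈ S, p ≤ y') : IsTailed m (n + 1) (insert y S) :=
  (h.dual.cons (x := OrderDual.toDual y) (x' := OrderDual.toDual y') hy hS).of_dual

lemma dInt_iff_isTailed {j : ℕ} {x y : P} :
    DInt (j + 3) x y ↔ IsTailed (j + 1) (j + 1) (Set.Icc x y) := by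
  induction j generalizing x y with
  | zero =>
    constructor
    · intro h
      cases h with
      | @base _ a b _ h1 h2 h3 h4 h5 h6 h7 =>
        refine ⟨fun _ => x, a, b, fun _ => y, fun i j h => by omega, fun i j h => by omega,
          h1, h2, fun _ => ⟨h3, h4⟩, fun _ => ⟨h5, h6⟩, ?_⟩
        rw [h7, Set.range_const, Set.range_const]
        ext p; simp only [Set.mem_insert_iff, Set.mem_singleton_iff, Set.mem_union]; tauto
      | succ h => exact absurd h.three_le (by omega)
    · rintro ⟨f, a, b, g, -, -, hab, hba, hfa, hga, hS⟩
      have hmem : ∀ p, p ∈ Set.Icc x y ↔ (∃ i, f i = p) ∨ (p = a ∨ p = b) ∨ ∃ j, g j = p := by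
        intro p; rw [hS]; rfl
      have hxy : x ≤ y := by
        have := (hmem a).2 (by simp)
        exact this.1.trans this.2
      have hf0 : ∀ i, f i = f 0 := fun i => by rw [Fin.fin_one_eq_zero i]
      have hg0 : ∀ i, g i = g 0 := fun i => by rw [Fin.fin_one_eq_zero i]
      have hx : f 0 = x := by
        refine le_antisymm ?_ ((hmem (f 0)).2 (by simp)).1
        rcases (hmem x).1 ⟨le_rfl, hxy⟩ with ⟨i, h⟩ | (rfl | rfl) | ⟨j, rfl⟩
        · rw [← h, hf0 i]
        · exact (hfa 0).1.le
        · exact (hfa 0).2.le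
        · exact ((hfa 0).1.trans (hga j).1).le
      have hy : g 0 = y := by
        refine le_antisymm ((hmem (g 0)).2 (by simp)).2 ?_
        rcases (hmem y).1 ⟨hxy, le_rfl⟩ with ⟨i, rfl⟩ | (rfl | rfl) | ⟨j, h⟩
        · exact ((hfa i).1.trans (hga 0).1).le
        · exact (hga 0).1.le
        · exact (hga 0).2.le
        · rw [← h, hg0 j]
      refine .base hab hba (hx ▸ (hfa 0).1) (hx ▸ (hfa 0).2) (hy ▸ (hga 0).1) (hy ▸ (hga 0).2) ?_
      ext p
      rw [hmem]
      constructor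
      · rintro (⟨i, rfl⟩ | h | ⟨j, rfl⟩)
        · left; rw [hf0, hx]
        · right; rcases h with h | h <;> simp [h]
        · simp [hg0 j, hy]
      · rintro (h | h | h | h)
        · exact Or.inl ⟨0, by rw [hx, h]⟩
        · exact Or.inr (Or.inl (Or.inl h))
        · exact Or.inr (Or.inl (Or.inr h))
        · exact Or.inr (Or.inr ⟨0, by rw [hy]; exact h.symm⟩)
  | succ j ih =>
    constructor
    · intro h
      cases h with
      | @succ _ x' y' _ _ h1 h2 h3 h4 =>
        have h5 := ih.1 h1
        have h6 := (h5.snoc h3 (fun p hp => hp.2)).cons h2 (by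
          rintro p (rfl | hp)
          · exact h1.lt.le.trans h3.le
          · exact hp.1)
        rwa [← h4] at h6
    · intro h
      obtain ⟨x', hx, hS, h1⟩ := h.peel_left
      obtain ⟨y', hy, hS', h2⟩ := h1.peel_right
      exact .succ (ih.2 h2) hx hy (by rw [hS, hS'])

lemma isDInterval_iff {k : ℕ} {x y : P} : IsDInterval k x y ↔ DInt k x y := by
  constructor
  · rintro ⟨hk, h⟩
    obtain ⟨j, rfl⟩ := Nat.exists_eq_add_of_le' hk
    exact dInt_iff_isTailed.2 (nonempty_orderIso_iff.1 h)
  · intro h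
    refine ⟨h.three_le, ?_⟩
    obtain ⟨j, rfl⟩ := Nat.exists_eq_add_of_le' h.three_le
    exact nonempty_orderIso_iff.2 (dInt_iff_isTailed.1 h)

/-- An interval isomorphic to a double-tailed diamond without its maximum consists of a shorter
double-tailed diamond and a new minimum. -/
lemma exists_dInt_of_minus {k : ℕ} (hk : 4 ≤ k) {x y : P}
    (h : Nonempty (Set.Icc x y ≃o DoubleTailedMinus k)) :
    ∃ x', x < x' ∧ Set.Icc x y = insert x (Set.Icc x' y) ∧ DInt (k - 1) x' y := by
  obtain ⟨j, rfl⟩ := Nat.exists_eq_add_of_le' hk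
  have h1 : IsTailed (j + 2) (j + 1) (Set.Icc x y) := nonempty_orderIso_iff.1 h
  obtain ⟨x', hx, hS, h2⟩ := h1.peel_left
  exact ⟨x', hx, hS, dInt_iff_isTailed.2 h2⟩

end Diamonds

/-! ### Heaps -/

section Heap

variable {ι : Type*} [Fintype ι] {A : Matrix ι ι ℤ} {P : Type*} [PartialOrder P]

/-- A finite poset colored by the vertices of a Dynkin diagram in the way the heap of a minuscule
Weyl group element is. -/
structure IsHeap (A : Matrix ι ι ℤ) (κ : P → ι) : Prop where
  finite : Finite P
  comp_same : ∀ x y, κ x = κ y → x ≤ y ∨ y ≤ x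
  comp_adj : ∀ x y, A (κ x) (κ y) = -1 → x ≤ y ∨ y ≤ x
  cover_adj : ∀ x y, x ⋖ y → A (κ x) (κ y) = -1
  /-- Between consecutive elements of a color there are exactly two elements of adjacent colors. -/
  two : ∀ x y, x < y → κ x = κ y → (∀ z, x < z → z < y → κ z ≠ κ x) →
    ∃ a b, a ≠ b ∧ ∀ z, (x < z ∧ z < y ∧ A (κ x) (κ z) = -1) ↔ (z = a ∨ z = b)
  /-- Above the top element of a color there is at most one element of an adjacent color. -/
  one : ∀ x, (∀ y, x < y → κ y ≠ κ x) → ∀ a b, x < a → x < b → A (κ x) (κ a) = -1 →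
    A (κ x) (κ b) = -1 → a = b

/-- `y` is the next element above `x` of the color of `x`. -/
def IsNext (κ : P → ι) (x y : P) : Prop :=
  x < y ∧ κ x = κ y ∧ ∀ z, x < z → z < y → κ z ≠ κ x

namespace IsHeap

variable {κ : P → ι}

lemma ne_of_adj (hA : IsDynkin A) {i j : ι} (h : A i j = -1) : i ≠ j := by
  rintro rfl
  rw [hA.diag] at h
  omega

lemma exists_next (hκ : IsHeap A κ) {x y : P} (hxy : x < y) (h : κ x = κ y) :
    ∃ z, IsNext κ x z := by
  have := hκ.finite
  obtain ⟨z, ⟨hz1, hz2⟩, hz⟩ := Set.Finite.exists_minimal (Set.toFinite {z | x < z ∧ κ x = κ z})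
    ⟨y, hxy, h⟩
  refine ⟨z, hz1, hz2, fun u hu1 hu2 hu3 => ?_⟩
  exact hu2.not_ge (hz ⟨hu1, hu3.symm⟩ hu2.le)

lemma exists_next_of_two (hκ : IsHeap A κ) {x a b : P} (hab : a ≠ b) (ha : x < a) (hb : x < b)
    (ha' : A (κ x) (κ a) = -1) (hb' : A (κ x) (κ b) = -1) : ∃ z, IsNext κ x z := by
  by_contra hcon
  refine hab (hκ.one x (fun y hy h => hcon ?_) a b ha hb ha' hb')
  exact hκ.exists_next hy h.symm

/-- Along a saturated chain the colors perform a walk in the Dynkin diagram. -/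
lemma walk (hκ : IsHeap A κ) {i : ι} {u v : P} (huv : u ≤ v)
    (hi : ∀ w, u ≤ w → w ≤ v → κ w ≠ i) :
    ReflTransGen (fun s t => A s t = -1 ∧ t ≠ i) (κ u) (κ v) := by
  have := hκ.finite
  classical
  have := Fintype.ofFinite P
  let _ : LocallyFiniteOrder P := Fintype.toLocallyFiniteOrder
  have h := le_iff_reflTransGen_covBy.1 huv
  clear huv
  induction h with
  | refl => exact .refl
  | @tail w v hw hwv ih =>
    have h1 : u ≤ w := le_iff_reflTransGen_covBy.2 hw
    exact (ih fun t ht ht' => hi t ht (ht'.trans hwv.1.le)).tail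
      ⟨hκ.cover_adj _ _ hwv, hi v (h1.trans hwv.1.le) le_rfl⟩

lemma exists_covBy_le (hκ : IsHeap A κ) {x u : P} (h : x < u) : ∃ c, x ⋖ c ∧ c ≤ u := by
  have := hκ.finite
  obtain ⟨c, ⟨h1, h2⟩, hc⟩ := Set.Finite.exists_minimal (Set.toFinite {z | x < z ∧ z ≤ u})
    ⟨u, h, le_rfl⟩
  exact ⟨c, ⟨h1, fun z hz hz' => hz'.not_ge (hc ⟨hz, hz'.le.trans h2⟩ hz'.le)⟩, h2⟩

lemma exists_le_covBy (hκ : IsHeap A κ) {u y : P} (h : u < y) : ∃ c, c ⋖ y ∧ u ≤ c := by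
  have := hκ.finite
  obtain ⟨c, ⟨h1, h2⟩, hc⟩ := Set.Finite.exists_maximal (Set.toFinite {z | z < y ∧ u ≤ z})
    ⟨u, h, le_rfl⟩
  exact ⟨c, ⟨h1, fun z hz hz' => hz.not_ge (hc ⟨hz', h2.trans hz.le⟩ hz.le)⟩, h2⟩

/-- If `a, b` are the two elements of adjacent color between the consecutive elements `x, y`, then
everything strictly between `x` and `y` is squeezed between `a` and `b`. -/
lemma squeeze (hA : IsDynkin A) (hκ : IsHeap A κ) {x y a b : P} (hn : IsNext κ x y)
    (hab : ∀ z, (x < z ∧ z < y ∧ A (κ x) (κ z) = -1) ↔ (z = a ∨ z = b)) {u : P} (h1 : x < u)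
    (h2 : u < y) : (a ≤ u ∨ b ≤ u) ∧ (u ≤ a ∨ u ≤ b) := by
  obtain ⟨c, hc, hcu⟩ := hκ.exists_covBy_le h1
  obtain ⟨d, hd, hud⟩ := hκ.exists_le_covBy h2
  have h3 := (hab c).1 ⟨hc.1, hcu.trans_lt h2, hκ.cover_adj _ _ hc⟩
  have h4 := (hab d).1 ⟨h1.trans_le hud, hd.1, by
    rw [hn.2.1, hA.symm]; exact hκ.cover_adj _ _ hd⟩
  refine ⟨?_, ?_⟩
  · rcases h3 with rfl | rfl
    exacts [.inl hcu, .inr hcu]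
  · rcases h4 with rfl | rfl
    exacts [.inl hud, .inr hud]

lemma Icc_eq_diamond (hA : IsDynkin A) (hκ : IsHeap A κ) {x y a b : P} (hn : IsNext κ x y)
    (hab : ∀ z, (x < z ∧ z < y ∧ A (κ x) (κ z) = -1) ↔ (z = a ∨ z = b)) (h1 : ¬ a ≤ b)
    (h2 : ¬ b ≤ a) : Set.Icc x y = {x, a, b, y} := by
  obtain ⟨ha1, ha2, -⟩ := (hab a).2 (.inl rfl)
  obtain ⟨hb1, hb2, -⟩ := (hab b).2 (.inr rfl)
  ext u
  simp only [Set.mem_Icc, Set.mem_insert_iff, Set.mem_singleton_iff]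
  constructor
  · rintro ⟨hu1, hu2⟩
    rcases eq_or_lt_of_le hu1 with rfl | hu1
    · simp
    rcases eq_or_lt_of_le hu2 with rfl | hu2
    · simp
    rcases hκ.squeeze hA hn hab hu1 hu2 with ⟨h3 | h3, h4 | h4⟩
    · exact .inr (.inl (le_antisymm h4 h3))
    · exact absurd (h3.trans h4) h1
    · exact absurd (h3.trans h4) h2
    · exact .inr (.inr (.inl (le_antisymm h4 h3)))
  · rintro (rfl | rfl | rfl | rfl)
    · exact ⟨le_rfl, hn.1.le⟩
    · exact ⟨ha1.le, ha2.le⟩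
    · exact ⟨hb1.le, hb2.le⟩
    · exact ⟨hn.1.le, le_rfl⟩

lemma Icc_eq_insert (hA : IsDynkin A) (hκ : IsHeap A κ) {x y a b : P} (hn : IsNext κ x y)
    (hab : ∀ z, (x < z ∧ z < y ∧ A (κ x) (κ z) = -1) ↔ (z = a ∨ z = b)) (hlt : a < b) :
    Set.Icc x y = insert x (insert y (Set.Icc a b)) := by
  obtain ⟨ha1, ha2, -⟩ := (hab a).2 (.inl rfl)
  obtain ⟨hb1, hb2, -⟩ := (hab b).2 (.inr rfl)
  ext u
  simp only [Set.mem_Icc, Set.mem_insert_iff]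
  constructor
  · rintro ⟨hu1, hu2⟩
    rcases eq_or_lt_of_le hu1 with rfl | hu1
    · simp
    rcases eq_or_lt_of_le hu2 with rfl | hu2
    · simp
    obtain ⟨h3, h4⟩ := hκ.squeeze hA hn hab hu1 hu2
    exact .inr (.inr ⟨h3.elim id hlt.le.trans, h4.elim (fun h => h.trans hlt.le) id⟩)
  · rintro (rfl | rfl | ⟨h1, h2⟩)
    · exact ⟨le_rfl, hn.1.le⟩
    · exact ⟨hn.1.le, le_rfl⟩
    · exact ⟨ha1.le.trans h1, h2.trans hb2.le⟩

/-- Two comparable elements of colors adjacent to the color of the consecutive elements around them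
have the same color, since the Dynkin diagram has no cycles. -/
lemma color_eq_of_between (hA : IsDynkin A) (hκ : IsHeap A κ) {x y a b : P} (hn : IsNext κ x y)
    (hab : a ≤ b) (ha : x < a) (hb : b < y) (ha' : A (κ x) (κ a) = -1)
    (hb' : A (κ x) (κ b) = -1) : κ a = κ b :=
  hA.tree (κ x) _ _ ha' hb' <| hκ.walk hab fun w hw hw' => hn.2.2 w (ha.trans_le hw) (hw'.trans_lt hb)

/-- Two consecutive elements of the same color bound a double-tailed diamond. -/
lemma exists_dInt (hA : IsDynkin A) (hκ : IsHeap A κ) {x y : P} (hn : IsNext κ x y) :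
    ∃ k, DInt k x y := by
  have := hκ.finite
  induction x using WellFoundedGT.induction generalizing y with
  | _ x ih =>
    obtain ⟨a, b, hne, hab⟩ := hκ.two x y hn.1 hn.2.1 hn.2.2
    have key : ∀ a b, a < b → (∀ z, (x < z ∧ z < y ∧ A (κ x) (κ z) = -1) ↔ (z = a ∨ z = b)) →
        ∃ k, DInt k x y := by
      intro a b hlt hab
      obtain ⟨ha1, ha2, ha3⟩ := (hab a).2 (.inl rfl)
      obtain ⟨hb1, hb2, hb3⟩ := (hab b).2 (.inr rfl)
      have hc := hκ.color_eq_of_between hA hn hlt.le ha1 hb2 ha3 hb3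
      obtain ⟨k, hk⟩ := @ih a ha1 b ⟨hlt, hc, fun z hz hz' hzc => by
        rcases (hab z).1 ⟨ha1.trans hz, hz'.trans hb2, by rw [hzc, ha3]⟩ with rfl | rfl
        exacts [lt_irrefl _ hz, lt_irrefl _ hz']⟩
      exact ⟨k + 1, .succ hk ha1 hb2 (hκ.Icc_eq_insert hA hn hab hlt)⟩
    by_cases h1 : a ≤ b
    · exact key a b (lt_of_le_of_ne h1 hne) hab
    by_cases h2 : b ≤ a
    · exact key b a (lt_of_le_of_ne h2 hne.symm) fun z => (hab z).trans or_comm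
    obtain ⟨ha1, ha2, -⟩ := (hab a).2 (.inl rfl)
    obtain ⟨hb1, hb2, -⟩ := (hab b).2 (.inr rfl)
    exact ⟨3, .base h1 h2 ha1 hb1 ha2 hb2 (hκ.Icc_eq_diamond hA hn hab h1 h2)⟩

lemma covBy_of_Icc {x x' y : P} (hx : x < x') (hxy : x' ≤ y)
    (h : Set.Icc x y = insert x (Set.Icc x' y)) : x ⋖ x' := by
  refine ⟨hx, fun u h1 h2 => ?_⟩
  have : u ∈ Set.Icc x y := ⟨h1.le, h2.le.trans hxy⟩
  rw [h] at this
  rcases this with rfl | h3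
  · exact lt_irrefl _ h1
  · exact h2.not_ge h3.1

/-- A double-tailed diamond `[x', y']` with a new element `x` below it is completed by the next
element of the color of `x`. -/
lemma exists_next_of_minus (hA : IsDynkin A) (hκ : IsHeap A κ) {x x' y' : P}
    (hn : IsNext κ x' y') (hx : x < x') (h : Set.Icc x y' = insert x (Set.Icc x' y')) :
    ∃ z, IsNext κ x z ∧ y' < z ∧
      ∀ u, (x < u ∧ u < z ∧ A (κ x) (κ u) = -1) ↔ (u = x' ∨ u = y') := by
  have hcov := covBy_of_Icc hx hn.1.le h
  have h1 := hκ.cover_adj _ _ hcov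
  have h2 : A (κ x) (κ y') = -1 := hn.2.1 ▸ h1
  obtain ⟨z, hz⟩ := hκ.exists_next_of_two hn.1.ne hx (hx.trans hn.1) h1 h2
  obtain ⟨a, b, hne, hab⟩ := hκ.two x z hz.1 hz.2.1 hz.2.2
  have hzy : y' < z := by
    rcases hκ.comp_adj z y' (hz.2.1 ▸ h2) with h3 | h3
    · exfalso
      have h3 : z < y' := lt_of_le_of_ne h3 fun h => ne_of_adj hA h2 (h ▸ hz.2.1)
      have hin : ∀ u, x < u → u < y' → x' ≤ u := by
        intro u hu hu'
        have : u ∈ Set.Icc x y' := ⟨hu.le, hu'.le⟩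
        rw [h] at this
        exact (this.resolve_left hu.ne').1
      have hx'z : x' < z := lt_of_le_of_ne (hin z hz.1 h3)
        fun h => ne_of_adj hA h1 (h ▸ hz.2.1)
      -- the second element of adjacent color between `x` and `z` would have the color of `x'`
      have hex : ∃ b, b ≠ x' ∧ x < b ∧ b < z ∧ A (κ x) (κ b) = -1 := by
        by_cases hax : a = x'
        · exact ⟨b, hax ▸ hne.symm, (hab b).2 (.inr rfl)⟩
        · exact ⟨a, hax, (hab a).2 (.inl rfl)⟩
      obtain ⟨b, hbx, hb1, hb2, hb3⟩ := hex
      have hb4 := hin b hb1 (hb2.trans h3)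
      have hc := hκ.color_eq_of_between hA hz hb4 hx hb2 h1 hb3
      exact hn.2.2 b (lt_of_le_of_ne hb4 hbx.symm) (hb2.trans h3) hc.symm
    · exact lt_of_le_of_ne h3 fun h => ne_of_adj hA h2 (h ▸ hz.2.1)
  refine ⟨z, hz, hzy, ?_⟩
  have hx' := (hab x').1 ⟨hx, hn.1.trans hzy, h1⟩
  have hy' := (hab y').1 ⟨hx.trans hn.1, hzy, h2⟩
  have hne' := hn.1.ne
  intro u
  rw [hab]
  rcases hx' with rfl | rfl <;> rcases hy' with rfl | rfl
  · exact absurd rfl hne'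
  · rfl
  · exact or_comm
  · exact absurd rfl hne'

/-- The ends of a double-tailed diamond are consecutive elements of the same color. Simultaneously:
the diagram has a branch vertex among the colors of the diamond as soon as the color of its ends has
a neighbour that does not occur in the diamond; and the color of its ends has at most one neighbour
that is not the color of a lower cover of the maximum. -/
lemma isNext_of_dInt (hA : IsDynkin A) (hκ : IsHeap A κ) {k : ℕ} {x y : P} (h : DInt k x y) :
    IsNext κ x y ∧
    (∀ c, A (κ x) c = -1 → (∀ u, x ≤ u → u ≤ y → κ u ≠ c) →
      ∃ u, x ≤ u ∧ u ≤ y ∧ IsBranch A (κ u)) ∧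
    ∀ c d, A (κ x) c = -1 → A (κ x) d = -1 → (∀ u, x < u → u ⋖ y → κ u ≠ c ∧ κ u ≠ d) → c = d := by
  induction h with
  | @base x a b y hab hba hxa hxb hay hby hI =>
    have hmem : ∀ u, x ≤ u → u ≤ y → u = x ∨ u = a ∨ u = b ∨ u = y := fun u h1 h2 => by
      have : u ∈ Set.Icc x y := ⟨h1, h2⟩
      rw [hI] at this
      simpa using this
    have hc1 : x ⋖ a := ⟨hxa, fun u h1 h2 => by
      rcases hmem u h1.le (h2.trans hay).le with rfl | rfl | rfl | rfl
      exacts [lt_irrefl _ h1, lt_irrefl _ h2, hba h2.le, h2.not_gt hay]⟩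
    have hc2 : x ⋖ b := ⟨hxb, fun u h1 h2 => by
      rcases hmem u h1.le (h2.trans hby).le with rfl | rfl | rfl | rfl
      exacts [lt_irrefl _ h1, hab h2.le, lt_irrefl _ h2, h2.not_gt hby]⟩
    have hc3 : a ⋖ y := ⟨hay, fun u h1 h2 => by
      rcases hmem u (hxa.trans h1).le h2.le with rfl | rfl | rfl | rfl
      exacts [h1.not_gt hxa, lt_irrefl _ h1, hab h1.le, lt_irrefl _ h2]⟩
    have hc4 : b ⋖ y := ⟨hby, fun u h1 h2 => by
      rcases hmem u (hxb.trans h1).le h2.le with rfl | rfl | rfl | rfl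
      exacts [h1.not_gt hxb, hba h1.le, lt_irrefl _ h1, lt_irrefl _ h2]⟩
    have h1 := hκ.cover_adj _ _ hc1
    have h2 := hκ.cover_adj _ _ hc2
    have h3 := hκ.cover_adj _ _ hc3
    have h4 := hκ.cover_adj _ _ hc4
    have hne : κ a ≠ κ b := fun h => (hκ.comp_same a b h).elim hab hba
    have hxy : κ x = κ y := by
      by_contra hxy
      refine hne (hA.tree (κ x) _ _ h1 h2 ?_)
      exact .head ⟨h3, Ne.symm hxy⟩ (.single ⟨by rw [hA.symm]; exact h4, (ne_of_adj hA h2).symm⟩)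
    refine ⟨⟨hxa.trans hay, hxy, fun z hz hz' => ?_⟩, fun c hc hcu => ?_, fun c d hc hd hu => ?_⟩
    · rcases hmem z hz.le hz'.le with rfl | rfl | rfl | rfl
      exacts [absurd hz (lt_irrefl _), (ne_of_adj hA h1).symm, (ne_of_adj hA h2).symm,
        absurd hz' (lt_irrefl _)]
    · exact ⟨x, le_rfl, (hxa.trans hay).le, κ a, κ b, c, hne, hcu a hxa.le hay.le,
        hcu b hxb.le hby.le, h1, h2, hc⟩
    · by_contra hcd
      have ha := hu a hxa hc3
      have hb := hu b hxb hc4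
      exact hA.deg (κ x) (κ a) (κ b) c d h1 h2 hc hd hne ha.1 ha.2 hb.1 hb.2 hcd
  | @succ k x' y' x y hd hx hy hI ih =>
    obtain ⟨hn, hB, hD⟩ := ih
    have hmem : ∀ u, x < u → u < y → x' ≤ u ∧ u ≤ y' := fun u h1 h2 => by
      have : u ∈ Set.Icc x y := ⟨h1.le, h2.le⟩
      rw [hI] at this
      exact (this.resolve_left h1.ne').resolve_left h2.ne
    have hI' : Set.Icc x y' = insert x (Set.Icc x' y') := by
      ext u
      constructor
      · rintro ⟨h1, h2⟩
        rcases eq_or_lt_of_le h1 with rfl | h1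
        · exact .inl rfl
        · exact .inr (hmem u h1 (h2.trans_lt hy))
      · rintro (rfl | h)
        · exact ⟨le_rfl, (hx.trans hn.1).le⟩
        · exact ⟨hx.le.trans h.1, h.2⟩
    obtain ⟨z, hz, hyz, hadj⟩ := hκ.exists_next_of_minus hA hn hx hI'
    have hcov : y' ⋖ y := ⟨hy, fun u h1 h2 =>
      h1.not_ge (hmem u ((hx.trans hn.1).trans h1) h2).2⟩
    have h1 : A (κ x) (κ x') = -1 := ((hadj x').2 (.inl rfl)).2.2
    have h2 : A (κ y') (κ y) = -1 := hκ.cover_adj _ _ hcov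
    have hxy : κ x = κ y := by
      refine hD (κ x) (κ y) (by rw [hA.symm]; exact h1) (hn.2.1 ▸ h2) fun u hu huc => ⟨?_, ?_⟩
      · exact hz.2.2 u (hx.trans hu) (huc.1.trans hyz)
      · intro huy
        -- `u` and `y` would be consecutive with the single element `y'` between them
        have hbet : ∀ w, u < w → w < y → w = y' := by
          intro w hw1 hw2
          have hw3 := (hmem w ((hx.trans hu).trans hw1) hw2).2
          exact (eq_or_lt_of_le hw3).resolve_right fun h => huc.2 hw1 h
        obtain ⟨a, b, hne, hab⟩ := hκ.two u y (huc.1.trans hy) huy fun w hw1 hw2 => by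
          rw [hbet w hw1 hw2]
          exact (ne_of_adj hA (hκ.cover_adj _ _ huc)).symm
        have ha := (hab a).2 (.inl rfl)
        have hb := (hab b).2 (.inr rfl)
        exact hne ((hbet a ha.1 ha.2.1).trans (hbet b hb.1 hb.2.1).symm)
    have hyz' : y = z := by
      rcases hκ.comp_same y z (hxy.symm.trans hz.2.1) with h | h
      · rcases eq_or_lt_of_le h with h | h
        · exact h
        · exact absurd hxy.symm (hz.2.2 y ((hx.trans hn.1).trans hy) h)
      · rcases eq_or_lt_of_le h with h | h
        · exact h.symm
        · exact absurd h (hcov.2 hyz)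
    subst hyz'
    have hno : ∀ u, x' ≤ u → u ≤ y' → κ u ≠ κ x := fun u h3 h4 =>
      hz.2.2 u (hx.trans_le h3) (h4.trans_lt hy)
    have hbr := hB (κ x) (by rw [hA.symm]; exact h1) hno
    obtain ⟨u, hu1, hu2, hu3⟩ := hbr
    refine ⟨hz, fun c hc hcu => ⟨u, hx.le.trans hu1, hu2.trans hy.le, hu3⟩, fun c d hc hd hcd => ?_⟩
    by_contra hne
    have h3 := hcd y' (hx.trans hn.1) hcov
    rw [← hn.2.1] at h3
    exact hno u hu1 hu2 (hA.branch _ _ hu3 ⟨κ x', c, d, h3.1, h3.2, hne, h1, hc, hd⟩)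

/-! ### The heap is d-complete -/

theorem isDComplete (hA : IsDynkin A) (hκ : IsHeap A κ) : IsDComplete P where
  finite := hκ.finite
  complete := by
    rintro k S (⟨rfl, w, x, y, hne, hwx, hwy, rfl⟩ | ⟨hk, x, y', rfl, hiso⟩)
    · have h1 := hκ.cover_adj _ _ hwx
      have h2 := hκ.cover_adj _ _ hwy
      obtain ⟨z, hz⟩ := hκ.exists_next_of_two hne hwx.1 hwy.1 h1 h2
      obtain ⟨a, b, hab', hab⟩ := hκ.two w z hz.1 hz.2.1 hz.2.2
      have hlt : ∀ x, w ⋖ x → A (κ w) (κ x) = -1 → x < z := by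
        intro x hwx h1
        rcases hκ.comp_adj z x (hz.2.1 ▸ h1) with h | h
        · rcases eq_or_lt_of_le h with h | h
          · exact absurd (h ▸ hz.2.1) (ne_of_adj hA h1)
          · exact absurd h (hwx.2 hz.1)
        · exact lt_of_le_of_ne h fun h => ne_of_adj hA h1 (h ▸ hz.2.1)
      have hxz := hlt x hwx h1
      have hyz := hlt y hwy h2
      have hxy : ¬ x ≤ y := fun h => hwy.2 hwx.1 (lt_of_le_of_ne h hne)
      have hyx : ¬ y ≤ x := fun h => hwx.2 hwy.1 (lt_of_le_of_ne h hne.symm)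
      have hab2 : ∀ u, (w < u ∧ u < z ∧ A (κ w) (κ u) = -1) ↔ (u = x ∨ u = y) := by
        have hx' := (hab x).1 ⟨hwx.1, hxz, h1⟩
        have hy' := (hab y).1 ⟨hwy.1, hyz, h2⟩
        intro u
        rw [hab]
        rcases hx' with rfl | rfl <;> rcases hy' with rfl | rfl
        · exact absurd rfl hne
        · rfl
        · exact or_comm
        · exact absurd rfl hne
      have hI := hκ.Icc_eq_diamond hA hz hab2 hxy hyx
      refine ⟨z, w, z, ?_, isDInterval_iff.2 (.base hxy hyx hwx.1 hwy.1 hxz hyz hI)⟩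
      rw [hI]
      ext u
      simp only [Set.mem_insert_iff, Set.mem_singleton_iff]
      tauto
    · obtain ⟨x', hx, hI, hd⟩ := exists_dInt_of_minus hk hiso
      obtain ⟨hn, -⟩ := hκ.isNext_of_dInt hA hd
      obtain ⟨z, hz, hyz, hadj⟩ := hκ.exists_next_of_minus hA hn hx hI
      have hI2 := hκ.Icc_eq_insert hA hz hadj hn.1
      refine ⟨z, x, z, ?_, isDInterval_iff.2 ?_⟩
      · rw [hI2, hI, Set.insert_comm]
      · have := DInt.succ hd hx hyz hI2
        rwa [Nat.sub_add_cancel (by omega)] at this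
  covers := by
    intro k x y h z hz
    obtain ⟨hn, -⟩ := hκ.isNext_of_dInt hA (isDInterval_iff.1 h)
    refine ⟨?_, hz.1.le⟩
    have h1 := hκ.cover_adj _ _ hz
    rw [← hn.2.1] at h1
    rcases hκ.comp_adj _ _ h1 with h2 | h2
    · rcases eq_or_lt_of_le h2 with h2 | h2
      · exact h2.ge
      · exact absurd hn.1 (hz.2 h2)
    · exact h2
  nonoverlapping := by
    -- two elements covered by the same element are equal if they have the same color
    have hcov : ∀ w w' x : P, w ⋖ x → w' ⋖ x → κ w = κ w' → w = w' := by
      intro w w' x h h' hc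
      rcases hκ.comp_same _ _ hc with h1 | h1
      · exact (eq_or_lt_of_le h1).resolve_right fun h2 => h.2 h2 h'.1
      · exact ((eq_or_lt_of_le h1).resolve_right fun h2 => h'.2 h2 h.1).symm
    rintro k S S' m m' (⟨rfl, w, x, y, hne, hwx, hwy, rfl⟩ | ⟨hk, x, y, rfl, hiso⟩)
      (⟨hk', w', x', y', hne', hwx', hwy', rfl⟩ | ⟨hk', x', y', rfl, hiso'⟩) hm hm' hS
    · have hmw : m = w := by
        rcases hm.1 with h | h | h
        · exact h
        · exact absurd (hm.2 (.inl rfl)) (h ▸ hwx.1.not_ge)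
        · exact absurd (hm.2 (.inl rfl)) (h ▸ hwy.1.not_ge)
      have hmw' : m' = w' := by
        rcases hm'.1 with h | h | h
        · exact h
        · exact absurd (hm'.2 (.inl rfl)) (h ▸ hwx'.1.not_ge)
        · exact absurd (hm'.2 (.inl rfl)) (h ▸ hwy'.1.not_ge)
      subst hmw hmw'
      have hcov' : ∀ u, u = x ∨ u = y → m' ⋖ u := by
        intro u hu
        have h1 : u ∈ ({m, x, y} : Set P) \ {m} := by
          refine ⟨?_, ?_⟩
          · rcases hu with rfl | rfl <;> simp
          · rcases hu with rfl | rfl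
            exacts [hwx.1.ne', hwy.1.ne']
        rw [hS] at h1
        rcases h1 with ⟨h1 | h1 | h1, h2⟩
        · exact absurd h1 h2
        · exact h1 ▸ hwx'
        · exact h1 ▸ hwy'
      refine hcov m m' x hwx (hcov' x (.inl rfl)) ?_
      have h1 := hκ.cover_adj _ _ hwx
      have h2 := hκ.cover_adj _ _ hwy
      have h3 := hκ.cover_adj _ _ (hcov' x (.inl rfl))
      have h4 := hκ.cover_adj _ _ (hcov' y (.inr rfl))
      by_contra hc
      have h5 : κ x = κ y := hA.tree (κ m) _ _ h1 h2
        (.head ⟨by rw [hA.symm]; exact h3, Ne.symm hc⟩ (.single ⟨h4, (ne_of_adj hA h2).symm⟩))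
      rcases hκ.comp_same _ _ h5 with h | h
      · exact hwy.2 hwx.1 (lt_of_le_of_ne h hne)
      · exact hwx.2 hwy.1 (lt_of_le_of_ne h hne.symm)
    · omega
    · omega
    · obtain ⟨x1, hx, hI, hd⟩ := exists_dInt_of_minus hk hiso
      obtain ⟨x1', hx', hI', hd'⟩ := exists_dInt_of_minus hk' hiso'
      obtain ⟨hn, -, hD⟩ := hκ.isNext_of_dInt hA hd
      obtain ⟨hn', -⟩ := hκ.isNext_of_dInt hA hd'
      have hmx : m = x := le_antisymm (hm.2 ⟨le_rfl, (hx.trans hn.1).le⟩) hm.1.1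
      have hmx' : m' = x' := le_antisymm (hm'.2 ⟨le_rfl, (hx'.trans hn'.1).le⟩) hm'.1.1
      subst hmx hmx'
      have h1 : Set.Icc m y \ {m} = Set.Icc x1 y := by
        rw [hI]
        ext u
        simp only [Set.mem_sdiff, Set.mem_insert_iff, Set.mem_singleton_iff]
        constructor
        · rintro ⟨h | h, h2⟩
          exacts [absurd h h2, h]
        · exact fun h => ⟨.inr h, fun h2 => hx.not_ge (h2 ▸ h.1)⟩
      have h1' : Set.Icc m' y' \ {m'} = Set.Icc x1' y' := by
        rw [hI']
        ext u
        simp only [Set.mem_sdiff, Set.mem_insert_iff, Set.mem_singleton_iff]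
        constructor
        · rintro ⟨h | h, h2⟩
          exacts [absurd h h2, h]
        · exact fun h => ⟨.inr h, fun h2 => hx'.not_ge (h2 ▸ h.1)⟩
      rw [h1, h1'] at hS
      obtain ⟨rfl, rfl⟩ := (Set.Icc_eq_Icc_iff hn.1.le).1 hS
      have hc1 := covBy_of_Icc hx hn.1.le hI
      have hc1' := covBy_of_Icc hx' hn.1.le hI'
      refine hcov m m' x1 hc1 hc1' (hD _ _ ?_ ?_ fun u hu huy => ⟨?_, ?_⟩)
      · rw [hA.symm]; exact hκ.cover_adj _ _ hc1
      · rw [hA.symm]; exact hκ.cover_adj _ _ hc1'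
      · obtain ⟨z, hz, hyz, -⟩ := hκ.exists_next_of_minus hA hn hx hI
        exact hz.2.2 u (hx.trans hu) (huy.1.trans hyz)
      · obtain ⟨z, hz, hyz, -⟩ := hκ.exists_next_of_minus hA hn hx' hI'
        exact hz.2.2 u (hx'.trans hu) (huy.1.trans hyz)

/-! ### The top tree -/

/-- The top tree consists of the top elements of the colors. -/
lemma mem_topTree_iff (hA : IsDynkin A) (hκ : IsHeap A κ) {x : P} :
    x ∈ topTree P ↔ ∀ y, x < y → κ y ≠ κ x := by
  have := hκ.finite
  constructor
  · intro hx y hy hc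
    obtain ⟨z, hz⟩ := hκ.exists_next hy hc.symm
    obtain ⟨k, hk⟩ := hκ.exists_dInt hA hz
    clear hz hy hc
    induction hk with
    | @base x a b y hab hba hxa hxb hay hby hI =>
      have hc : ∀ a b, x < a → x < b → ¬ b ≤ a → a < y → Set.Icc x y = {x, a, b, y} → x ⋖ a := by
        intro a b h1 h2 h3 h4 h5
        refine ⟨h1, fun u hu hu' => ?_⟩
        have : u ∈ Set.Icc x y := ⟨hu.le, (hu'.trans h4).le⟩
        rw [h5] at this
        rcases this with rfl | rfl | rfl | rfl
        exacts [lt_irrefl _ hu, lt_irrefl _ hu', h3 hu'.le, hu'.not_gt h4]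
      have h1 := hc a b hxa hxb hba hay hI
      have h2 := hc b a hxb hxa hab hby (by rw [hI, Set.insert_comm a b])
      exact hab (hx x le_rfl h1 h2).le
    | succ h hx' hy hI ih => exact ih fun u hu => hx u (hx'.le.trans hu)
  · intro hx
    have htop : ∀ y, x ≤ y → ∀ z, y < z → κ z ≠ κ y := by
      intro y hxy
      classical
      have := Fintype.ofFinite P
      let _ : LocallyFiniteOrder P := Fintype.toLocallyFiniteOrder
      have h := le_iff_reflTransGen_covBy.1 hxy
      clear hxy
      induction h with
      | refl => exact hx
      | @tail u v _ huv ih =>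
        intro z hz hc
        have h1 := hκ.cover_adj _ _ huv
        exact hz.ne (hκ.one u ih v z huv.1 (huv.1.trans hz) h1 (hc ▸ h1))
    intro y hy z hz z' hz'
    exact hκ.one y (htop y hy) z z' hz.1 hz'.1 (hκ.cover_adj _ _ hz) (hκ.cover_adj _ _ hz')

lemma topTree_upper {x y : P} (hx : x ∈ topTree P) (hxy : x ≤ y) : y ∈ topTree P :=
  fun z hz => hx z (hxy.trans hz)

lemma topTree_bijOn (hA : IsDynkin A) (hκ : IsHeap A κ) (hsurj : Function.Surjective κ) :
    Set.BijOn κ (topTree P) Set.univ := by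
  have := hκ.finite
  refine ⟨fun _ _ => Set.mem_univ _, fun x hx y hy h => ?_, fun i _ => ?_⟩
  · rw [hκ.mem_topTree_iff hA] at hx hy
    rcases hκ.comp_same x y h with h1 | h1
    · exact (eq_or_lt_of_le h1).resolve_right fun h2 => hx y h2 h.symm
    · exact ((eq_or_lt_of_le h1).resolve_right fun h2 => hy x h2 h).symm
  · obtain ⟨x, rfl⟩ := hsurj i
    obtain ⟨z, hz1, hz⟩ := Set.Finite.exists_maximal (Set.toFinite {z | κ z = κ x}) ⟨x, rfl⟩
    refine ⟨z, (hκ.mem_topTree_iff hA).2 fun y hy hc => hy.not_ge (hz (hc.trans hz1) hy.le), hz1⟩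

lemma topTree_adj (hA : IsDynkin A) (hκ : IsHeap A κ) (x y : topTree P) :
    (SimpleGraph.hasse (topTree P)).Adj x y ↔ A (κ x) (κ y) = -1 := by
  have hcov : ∀ x y : topTree P, x ⋖ y ↔ x < y ∧ A (κ x) (κ y) = -1 := by
    intro x y
    constructor
    · intro h
      refine ⟨h.1, hκ.cover_adj _ _ ⟨h.1, fun u h1 h2 => ?_⟩⟩
      exact h.2 (c := ⟨u, topTree_upper x.2 h1.le⟩) h1 h2
    · rintro ⟨h1, h2⟩
      obtain ⟨c, hc, hcy⟩ := hκ.exists_covBy_le (show (x : P) < y from h1)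
      have h3 := hκ.one x ((hκ.mem_topTree_iff hA).1 x.2) c y hc.1 h1 (hκ.cover_adj _ _ hc) h2
      subst h3
      exact ⟨h1, fun u hu hu' => hc.2 hu hu'⟩
  rw [SimpleGraph.hasse_adj, hcov, hcov]
  constructor
  · rintro (h | h)
    · exact h.2
    · rw [hA.symm]; exact h.2
  · intro h
    have hne : x ≠ y := fun e => ne_of_adj hA h (by rw [e])
    rcases hκ.comp_adj _ _ h with h1 | h1
    · exact .inl ⟨lt_of_le_of_ne h1 hne, h⟩
    · exact .inr ⟨lt_of_le_of_ne h1 hne.symm, by rw [hA.symm]; exact h⟩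

lemma ends (hA : IsDynkin A) (hκ : IsHeap A κ) {k : ℕ} {x y : P} (h : IsDInterval k x y) :
    κ x = κ y :=
  (hκ.isNext_of_dInt hA (isDInterval_iff.1 h)).1.2.1

end IsHeap

end Heap

/-! ### Posets whose filters are labelled by a minuscule orbit -/

section Labelled

variable {ι : Type*} {P : Type*} [PartialOrder P]

/-- The number of elements of each color in a set. -/
def cnt (κ : P → ι) (F : Set P) (i : ι) : ℤ := ({x | x ∈ F ∧ κ x = i}.ncard : ℤ)

lemma cnt_empty (κ : P → ι) : cnt κ ∅ = 0 := by ext i; simp [cnt]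

lemma cnt_mono [Finite P] (κ : P → ι) {F G : Set P} (h : F ⊆ G) : cnt κ F ≤ cnt κ G := fun _ =>
  Int.ofNat_le.2 (Set.ncard_le_ncard (fun _ hx => ⟨h hx.1, hx.2⟩) (Set.toFinite _))

lemma cnt_insert [Finite P] [DecidableEq ι] (κ : P → ι) {F : Set P} {x : P} (hx : x ∉ F) :
    cnt κ (insert x F) = cnt κ F + Pi.single (κ x) 1 := by
  ext i
  by_cases hi : i = κ x
  · subst hi
    have : {y | y ∈ insert x F ∧ κ y = κ x} = insert x {y | y ∈ F ∧ κ y = κ x} := by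
      ext y
      simp only [Set.mem_insert_iff, Set.mem_ofPred_eq]
      constructor
      · rintro ⟨h | h, h'⟩
        exacts [.inl h, .inr ⟨h, h'⟩]
      · rintro (rfl | h)
        exacts [⟨.inl rfl, rfl⟩, ⟨.inr h.1, h.2⟩]
    simp only [cnt, Pi.add_apply, Pi.single_eq_same]
    rw [this, Set.ncard_insert_of_notMem (fun h => hx h.1) (Set.toFinite _)]
    push_cast; rfl
  · have : {y | y ∈ insert x F ∧ κ y = i} = {y | y ∈ F ∧ κ y = i} := by
      ext y
      simp only [Set.mem_insert_iff, Set.mem_ofPred_eq]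
      constructor
      · rintro ⟨rfl | h, h'⟩
        exacts [absurd h'.symm hi, ⟨h, h'⟩]
      · exact fun h => ⟨.inr h.1, h.2⟩
    simp only [cnt, Pi.add_apply]
    rw [this, Pi.single_eq_of_ne hi, add_zero]

lemma mem_of_cnt_eq [Finite P] (κ : P → ι) {F G : Set P} (h : F ⊆ G) {x : P} (hx : x ∈ G)
    (hc : cnt κ F (κ x) = cnt κ G (κ x)) : x ∈ F := by
  have h1 : {y | y ∈ F ∧ κ y = κ x} = {y | y ∈ G ∧ κ y = κ x} :=
    Set.eq_of_subset_of_ncard_le (fun _ hy => ⟨h hy.1, hy.2⟩) (Int.ofNat_le.1 hc.ge)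
      (Set.toFinite _)
  have h2 : x ∈ {y | y ∈ G ∧ κ y = κ x} := ⟨hx, rfl⟩
  rw [← h1] at h2
  exact h2.1

open Classical in
lemma sum_cnt [Fintype ι] [Fintype P] (κ : P → ι) (F : Set P) (g : ι → ℤ) :
    ∑ j, cnt κ F j * g j = ∑ x, if x ∈ F then g (κ x) else 0 := by
  have h : ∀ j, cnt κ F j * g j = ∑ x, if x ∈ F ∧ κ x = j then g (κ x) else 0 := by
    intro j
    have : {x | x ∈ F ∧ κ x = j}.ncard = (Finset.univ.filter fun x => x ∈ F ∧ κ x = j).card := by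
      rw [← Set.ncard_coe_finset]; congr; ext x; simp
    rw [cnt, this, Finset.card_filter]
    push_cast
    rw [Finset.sum_mul]
    refine Finset.sum_congr rfl fun x _ => ?_
    split_ifs with hx
    · rw [hx.2, one_mul]
    · simp
  simp only [h]
  rw [Finset.sum_comm]
  refine Finset.sum_congr rfl fun x _ => ?_
  by_cases hx : x ∈ F
  · simp [hx]
  · simp [hx]

variable [Fintype ι] [DecidableEq ι] {A : Matrix ι ι ℤ} {l : ι → ℤ} {O : Set (ι → ℤ)}

/-- Counting colors identifies the order filters of `P` with the set `O` of integer vectors. -/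
structure IsLabelled (O : Set (ι → ℤ)) (κ : P → ι) : Prop where
  finite : Finite P
  mem : ∀ F, IsUpperSet F → cnt κ F ∈ O
  surj : ∀ c ∈ O, ∃ F, IsUpperSet F ∧ cnt κ F = c
  sub : ∀ F G, IsUpperSet F → IsUpperSet G → cnt κ F ≤ cnt κ G → F ⊆ G

lemma isUpperSet_insert {F : Set P} (hF : IsUpperSet F) {x : P} (h : ∀ y, x < y → y ∈ F) :
    IsUpperSet (insert x F) := by
  rintro a b hab (rfl | ha)
  · rcases eq_or_lt_of_le hab with rfl | hlt
    exacts [.inl rfl, .inr (h b hlt)]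
  · exact .inr (hF hab ha)

lemma isUpperSet_diff_singleton {F : Set P} (hF : IsUpperSet F) {x : P}
    (h : ∀ y, y < x → y ∉ F) : IsUpperSet (F \ {x}) := by
  rintro a b hab ⟨ha, hax⟩
  refine ⟨hF hab ha, ?_⟩
  rintro rfl
  exact h a (lt_of_le_of_ne hab hax) ha

lemma isUpperSet_nle (x : P) : IsUpperSet {z | ¬ z ≤ x} := fun _ _ hab ha h => ha (hab.trans h)

lemma isUpperSet_insert_nle (x : P) : IsUpperSet (insert x {z | ¬ z ≤ x}) :=
  isUpperSet_insert (isUpperSet_nle x) fun _ h => h.not_ge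

namespace IsLabelled

variable {κ : P → ι}

lemma val_insert (hA : IsDynkin A) (hO : IsMinusculeSet A l O) (hL : IsLabelled O κ) {F : Set P}
    (hF : IsUpperSet F) {x : P} (hx : x ∉ F) (hxF : IsUpperSet (insert x F)) :
    val A l (cnt κ F) (κ x) = 1 := by
  have := hL.finite
  refine hO.val_eq_one_of_add_mem hA (hL.mem F hF) ?_
  rw [← cnt_insert κ hx]
  exact hL.mem _ hxF

lemma val_diff (hA : IsDynkin A) (hO : IsMinusculeSet A l O) (hL : IsLabelled O κ) {F : Set P}
    (hF : IsUpperSet F) {x : P} (hx : x ∈ F) (hxF : IsUpperSet (F \ {x})) :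
    val A l (cnt κ F) (κ x) = -1 := by
  have := hL.finite
  have h0 : insert x (F \ {x}) = F := by simp [Set.insert_eq_of_mem hx]
  have h1 := hL.val_insert hA hO hxF (x := x) (by simp) (by rwa [h0])
  have h2 := cnt_insert κ (F := F \ {x}) (x := x) (by simp)
  rw [h0] at h2
  rw [h2, val_add_single, hA.diag, h1]
  norm_num

lemma exists_insert (hO : IsMinusculeSet A l O) (hL : IsLabelled O κ) {F : Set P}
    (hF : IsUpperSet F) {i : ι} (hi : val A l (cnt κ F) i = 1) :
    ∃ x, x ∉ F ∧ IsUpperSet (insert x F) ∧ κ x = i := by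
  have := hL.finite
  obtain ⟨G, hG, hGc⟩ := hL.surj _ (hO.add_mem (hL.mem F hF) hi)
  have hFG : F ⊆ G := hL.sub F G hF hG (by
    rw [hGc]; exact le_add_of_nonneg_right (Pi.single_nonneg.mpr zero_le_one))
  have hne : (G \ F).Nonempty := by
    by_contra h
    rw [Set.not_nonempty_iff_eq_empty, Set.sdiff_eq_empty] at h
    rw [Set.Subset.antisymm h hFG] at hGc
    have := congrFun hGc i
    simp at this
  obtain ⟨x, ⟨hxG, hxF⟩, hmax⟩ := Set.Finite.exists_maximal (Set.toFinite (G \ F)) hne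
  have hup : IsUpperSet (insert x F) := isUpperSet_insert hF fun y hy => by
    by_contra hyF
    exact hy.not_ge (hmax ⟨hG hy.le hxG, hyF⟩ hy.le)
  refine ⟨x, hxF, hup, ?_⟩
  have h1 := cnt_mono κ (Set.insert_subset hxG hFG)
  rw [hGc, cnt_insert κ hxF] at h1
  have h2 := h1 (κ x)
  simp only [Pi.add_apply, Pi.single_eq_same] at h2
  by_contra hne
  rw [Pi.single_eq_of_ne hne] at h2
  omega

lemma insert_unique (hL : IsLabelled O κ) {F : Set P} {x y : P} (hx : x ∉ F) (hy : y ∉ F)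
    (hxF : IsUpperSet (insert x F)) (hyF : IsUpperSet (insert y F)) (h : κ x = κ y) : x = y := by
  have := hL.finite
  have h1 : insert x F ⊆ insert y F := hL.sub _ _ hxF hyF (by
    rw [cnt_insert κ hx, cnt_insert κ hy, h])
  exact (h1 (Set.mem_insert x F)).resolve_right hx

lemma comp_same (hL : IsLabelled O κ) (x y : P) (h : κ x = κ y) : x ≤ y ∨ y ≤ x := by
  by_contra! hcon
  obtain ⟨h1, h2⟩ := hcon
  have hF : IsUpperSet (Set.Ioi x ∪ Set.Ioi y) := (isUpperSet_Ioi x).union (isUpperSet_Ioi y)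
  have hx : x ∉ Set.Ioi x ∪ Set.Ioi y := fun h => h.elim (lt_irrefl x) fun h => h2 h.le
  have hy : y ∉ Set.Ioi x ∪ Set.Ioi y := fun h => h.elim (fun h => h1 h.le) (lt_irrefl y)
  exact h1 (hL.insert_unique hx hy (isUpperSet_insert hF fun _ h => .inl h)
    (isUpperSet_insert hF fun _ h => .inr h) h).le

lemma comp_adj (hA : IsDynkin A) (hO : IsMinusculeSet A l O) (hL : IsLabelled O κ) (x y : P)
    (h : A (κ x) (κ y) = -1) : x ≤ y ∨ y ≤ x := by
  have := hL.finite
  by_contra! hcon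
  obtain ⟨h1, h2⟩ := hcon
  have hF : IsUpperSet (Set.Ioi x ∪ Set.Ioi y) := (isUpperSet_Ioi x).union (isUpperSet_Ioi y)
  have hx : x ∉ Set.Ioi x ∪ Set.Ioi y := fun h => h.elim (lt_irrefl x) fun h => h2 h.le
  have hy : y ∉ Set.Ioi x ∪ Set.Ioi y := fun h => h.elim (fun h => h1 h.le) (lt_irrefl y)
  have hxF := isUpperSet_insert hF fun z (h : x < z) => .inl h
  have hyF := isUpperSet_insert hF fun z (h : y < z) => .inr h
  have h3 := hL.val_insert hA hO hF hy hyF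
  have h4 := hL.val_insert hA hO hxF (x := y)
    (fun h => h.elim (fun h => h1 h.ge) hy) (isUpperSet_insert hxF fun z h => .inr (.inr h))
  rw [cnt_insert κ hx, val_add_single, h] at h4
  omega

lemma cover_adj (hA : IsDynkin A) (hO : IsMinusculeSet A l O) (hL : IsLabelled O κ) (x y : P)
    (h : x ⋖ y) : A (κ x) (κ y) = -1 := by
  have := hL.finite
  have hF : IsUpperSet (Set.Ioi x) := isUpperSet_Ioi x
  have hF' : IsUpperSet (Set.Ioi x \ {y}) := isUpperSet_diff_singleton hF fun z hz hz' => h.2 hz' hz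
  have hxF := isUpperSet_insert hF fun z (h : x < z) => h
  have h0 : insert y (Set.Ioi x \ {y}) = Set.Ioi x := by
    simp [Set.insert_eq_of_mem (show y ∈ Set.Ioi x from h.1)]
  have h1 := hL.val_insert hA hO hF' (x := y) (by simp) (by rwa [h0])
  have h2 := hL.val_insert hA hO hF (x := x) (by simp) hxF
  have h3 := cnt_insert κ (F := Set.Ioi x \ {y}) (x := y) (by simp)
  rw [h0] at h3
  rw [h3, val_add_single] at h2
  by_cases hxy : κ x = κ y
  · rw [hxy, hA.diag] at h2; omega
  rcases hA.off _ _ hxy with h4 | h4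
  · exfalso
    rw [hA.symm, h4] at h2
    obtain ⟨z, hz, hzF, hzc⟩ := hL.exists_insert hO hF' (i := κ x) (by omega)
    rcases hL.comp_same z x hzc with h5 | h5
    · rcases eq_or_lt_of_le h5 with rfl | h5
      · rcases hzF h.1.le (Set.mem_insert z _) with h6 | h6
        exacts [h.1.ne' h6, h6.2 rfl]
      · rcases hzF h5.le (Set.mem_insert z _) with h6 | h6
        exacts [h5.ne' h6, lt_irrefl x h6.1]
    · rcases eq_or_lt_of_le h5 with rfl | h5
      · rcases hzF h.1.le (Set.mem_insert x _) with h6 | h6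
        exacts [h.1.ne' h6, h6.2 rfl]
      · by_cases hzy : z = y
        · exact hxy (by rw [← hzc, hzy])
        · exact hz ⟨h5, hzy⟩
  · exact h4

lemma two (hA : IsDynkin A) (hO : IsMinusculeSet A l O) (hL : IsLabelled O κ) (x y : P)
    (hxy : x < y) (hc : κ x = κ y) (hno : ∀ z, x < z → z < y → κ z ≠ κ x) :
    ∃ a b, a ≠ b ∧ ∀ z, (x < z ∧ z < y ∧ A (κ x) (κ z) = -1) ↔ (z = a ∨ z = b) := by
  classical
  have := hL.finite
  have := Fintype.ofFinite P
  have hx : x ∉ {z | ¬ z ≤ x} := fun h => h le_rfl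
  have hy : y ∉ {z | ¬ z ≤ y} := fun h => h le_rfl
  have h1 := hL.val_insert hA hO (isUpperSet_nle x) hx (isUpperSet_insert_nle x)
  have h2 := hL.val_insert hA hO (isUpperSet_nle y) hy (isUpperSet_insert_nle y)
  have h3 := val_add_single (A := A) (l := l) (cnt κ {z | ¬ z ≤ y}) (κ y) 1 (κ y)
  rw [← cnt_insert κ hy, h2, hA.diag] at h3
  have h4 := val_sub_val (A := A) (l := l) (cnt κ (insert y {z | ¬ z ≤ y})) (cnt κ {z | ¬ z ≤ x})
    (κ x)
  rw [h1, hc, h3] at h4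
  simp only [sub_mul, Finset.sum_sub_distrib] at h4
  rw [sum_cnt κ _ fun j => A j (κ y), sum_cnt κ _ fun j => A j (κ y), ← Finset.sum_sub_distrib] at h4
  replace h4 : 1 - 1 * 2 - 1 = ∑ z, -(if x < z ∧ z < y ∧ A (κ x) (κ z) = -1 then (1 : ℤ) else 0) := by
    refine h4.trans (Finset.sum_congr rfl fun z _ => ?_)
    simp only [Set.mem_insert_iff, Set.mem_ofPred_eq]
    by_cases hzy : z < y
    · have h6 : ¬ (z = y ∨ ¬ z ≤ y) := by
        rintro (h | h)
        exacts [hzy.ne h, h hzy.le]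
      rw [if_neg h6, sub_zero]
      by_cases hxz : x < z
      · have hne : κ z ≠ κ y := hc ▸ hno z hxz hzy
        rw [if_pos hxz.not_ge]
        rcases hA.off _ _ hne with h7 | h7
        · rw [h7, if_neg]
          · simp
          · rintro ⟨-, -, h8⟩
            rw [hc, hA.symm, h7] at h8
            omega
        · rw [h7, if_pos ⟨hxz, hzy, by rw [hc, hA.symm, h7]⟩]
      · rw [if_neg (fun h : x < z ∧ z < y ∧ A (κ x) (κ z) = -1 => hxz h.1)]
        by_cases hzx : z ≤ x
        · simp [hzx]
        · -- `z` is incomparable to `x`, hence its color is neither that of `x` nor adjacent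
          have hxz' : ¬ x ≤ z := fun h => hxz (lt_of_le_of_ne h fun h' : x = z => hzx h'.ge)
          have hne : κ z ≠ κ y := fun h =>
            (hL.comp_same z x (h.trans hc.symm)).elim hzx hxz'
          rcases hA.off _ _ hne with h7 | h7
          · simp [h7]
          · exact ((hL.comp_adj hA hO z x (by rw [hc, h7])).elim hzx hxz').elim
    · rw [if_neg (fun h : x < z ∧ z < y ∧ A (κ x) (κ z) = -1 => hzy h.2.1)]
      have h6 : ¬ z ≤ x := fun h => hzy (h.trans_lt hxy)
      have h7 : z = y ∨ ¬ z ≤ y := by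
        by_cases h : z = y
        exacts [.inl h, .inr fun h' => hzy (lt_of_le_of_ne h' h)]
      simp [h6, h7]
  rw [Finset.sum_neg_distrib, Finset.sum_boole] at h4
  have h6 : (Finset.univ.filter fun z => x < z ∧ z < y ∧ A (κ x) (κ z) = -1).card = 2 := by
    have : ((Finset.univ.filter fun z => x < z ∧ z < y ∧ A (κ x) (κ z) = -1).card : ℤ) = 2 := by
      push_cast at h4 ⊢
      linarith
    exact_mod_cast this
  obtain ⟨a, b, hab, h7⟩ := Finset.card_eq_two.1 h6
  refine ⟨a, b, hab, fun z => ?_⟩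
  have := Finset.ext_iff.1 h7 z
  simpa using this

lemma one (hA : IsDynkin A) (hO : IsMinusculeOrbit A l O) (hL : IsLabelled O κ) (x : P)
    (hno : ∀ y, x < y → κ y ≠ κ x) (a b : P) (ha : x < a) (hb : x < b)
    (ha' : A (κ x) (κ a) = -1) (hb' : A (κ x) (κ b) = -1) : a = b := by
  classical
  have := hL.finite
  have := Fintype.ofFinite P
  have hx : x ∉ {z | ¬ z ≤ x} := fun h => h le_rfl
  have h1 := hL.val_insert hA hO.1 (isUpperSet_nle x) hx (isUpperSet_insert_nle x)
  obtain ⟨F, hF⟩ : ∃ F, F = {z | ¬ z ≤ x} := ⟨_, rfl⟩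
  have hmem : ∀ z, z ∈ F ↔ ¬ z ≤ x := fun z => by rw [hF]; rfl
  rw [← hF, val, sum_cnt κ _ fun j => A j (κ x)] at h1
  by_contra hab
  have h2 : ∑ z, (if z ∈ F then A (κ z) (κ x) else 0) ≤
      ∑ z, ((if z = a then -1 else 0) + (if z = b then -1 else 0)) := by
    refine Finset.sum_le_sum fun z _ => ?_
    by_cases hza : z = a
    · subst hza
      rw [if_pos ((hmem _).2 ha.not_ge), if_pos rfl, if_neg hab, hA.symm, ha']; norm_num
    by_cases hzb : z = b
    · subst hzb
      rw [if_pos ((hmem _).2 hb.not_ge), if_neg hza, if_pos rfl, hA.symm, hb']; norm_num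
    rw [if_neg hza, if_neg hzb]
    split_ifs with hz
    · have hne : κ z ≠ κ x := fun h => by
        rcases hL.comp_same z x h with h' | h'
        · exact (hmem z).1 hz h'
        · exact hno z (lt_of_le_of_ne h' fun h'' : x = z => (hmem z).1 hz h''.ge) h
      simpa using hA.apply_nonpos hne
    · simp
  have h3 := hO.l_nonneg (κ x)
  rw [Finset.sum_add_distrib] at h2
  simp at h2 h1
  linarith

lemma isHeap (hA : IsDynkin A) (hO : IsMinusculeOrbit A l O) (hL : IsLabelled O κ) :
    IsHeap A κ where
  finite := hL.finite
  comp_same := hL.comp_same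
  comp_adj := hL.comp_adj hA hO.1
  cover_adj := hL.cover_adj hA hO.1
  two := hL.two hA hO.1
  one := hL.one hA hO

lemma color_of_maximal (hA : IsDynkin A) (hO : IsMinusculeOrbit A l O) (hL : IsLabelled O κ)
    {x : P} (hx : ∀ y, ¬ x < y) : l (κ x) = 1 := by
  have := hL.val_insert hA hO.1 (F := ∅) isUpperSet_empty (x := x) (by simp)
    (isUpperSet_insert isUpperSet_empty fun y h => absurd h (hx y))
  rwa [cnt_empty, val_zero] at this

/-- If `λ` is the fundamental weight `Λ_i`, the poset has a maximum, and it has color `i`. -/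
lemma exists_top (hA : IsDynkin A) (hO : IsMinusculeOrbit A l O) (hL : IsLabelled O κ) {i : ι}
    (hl : l = Pi.single i 1) : ∃ m : P, IsTop m ∧ κ m = i := by
  have := hL.finite
  have hmaxc : ∀ x : P, (∀ y, ¬ x < y) → κ x = i := by
    intro x hx
    have := hL.color_of_maximal hA hO hx
    by_contra h
    rw [hl, Pi.single_eq_of_ne h] at this
    omega
  obtain ⟨m, -, hm, hmi⟩ := hL.exists_insert hO.1 (F := ∅) isUpperSet_empty (i := i)
    (by rw [cnt_empty, val_zero, hl]; simp)
  have hmmax : ∀ y, ¬ m < y := fun y hy => by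
    rcases hm hy.le (Set.mem_insert m ∅) with h | h
    exacts [hy.ne' h, h]
  refine ⟨m, fun x => ?_, hmi⟩
  obtain ⟨z, hxz, hz⟩ := Set.Finite.exists_le_maximal (Set.toFinite (Set.univ : Set P))
    (Set.mem_univ x)
  have hz' : ∀ y, ¬ z < y := fun y hy => hy.not_ge (hz.2 (Set.mem_univ y) hy.le)
  have : z = m := hL.insert_unique (F := ∅) (by simp) (by simp)
    (isUpperSet_insert isUpperSet_empty fun y h => absurd h (hz' y)) hm ((hmaxc z hz').trans hmi.symm)
  exact this ▸ hxz

lemma surjective (hA : IsDynkin A) (hO : IsMinusculeOrbit A l O) (hL : IsLabelled O κ) {i : ι}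
    (hl : l = Pi.single i 1) : Function.Surjective κ := by
  classical
  have := hL.finite
  have := Fintype.ofFinite P
  obtain ⟨m, -, hm⟩ := hL.exists_top hA hO hl
  refine hA.conn (Set.range κ) ⟨i, m, hm⟩ ?_
  rintro _ j ⟨x, rfl⟩ hxj
  by_contra hj
  have h1 := hO.val_mem _ (hL.mem _ isUpperSet_univ) j
  have h2 : 0 < val A l (cnt κ Set.univ) j := by
    rw [val, sum_cnt κ _ fun i => A i j]
    simp only [Set.mem_univ, if_true]
    have h3 : ∑ z, A (κ z) j < 0 := by
      refine Finset.sum_neg' (fun z _ => ?_) ⟨x, Finset.mem_univ x, ?_⟩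
      · exact hA.apply_nonpos fun h => hj ⟨z, h⟩
      · simp [hxj]
    have := hO.l_nonneg j
    linarith
  obtain ⟨y, hy, -⟩ := hL.exists_insert hO.1 isUpperSet_univ (i := j) (by omega)
  exact hy (Set.mem_univ y)

/-! ### The involutions `S_c` -/

section Involution

variable {C : Type*} (π : ι → C) (p : C)

lemma filtA_eq (hA : IsDynkin A) (hO : IsMinusculeSet A l O) (hL : IsLabelled O κ)
    {F G : Filt P} (hle : cnt κ F.1 ≤ cnt κ G.1)
    (hsupp : ∀ i, π i ≠ p → cnt κ F.1 i = cnt κ G.1 i)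
    (hG : ∀ i, π i = p → val A l (cnt κ G.1) i ≠ 1) :
    filtA (fun x => π (κ x)) p F = G.1 := by
  have := hL.finite
  have hFG := hL.sub _ _ F.2 G.2 hle
  refine Set.Subset.antisymm ?_ (Set.subset_biUnion_of_mem
    (u := fun F' : Set P => F') ⟨G.2, fun x hx => ?_⟩)
  · refine Set.iUnion₂_subset ?_
    rintro F' ⟨hF', hc⟩
    by_contra hcon
    obtain ⟨x, ⟨hx1, hx2⟩, hmax⟩ := Set.Finite.exists_maximal (Set.toFinite (F' \ G.1))
      (by rwa [Set.nonempty_iff_ne_empty, ne_eq, Set.sdiff_eq_empty])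
    refine hG (κ x) (hc ⟨hx1, fun h => hx2 (hFG h)⟩) (hL.val_insert hA hO G.2 hx2 ?_)
    refine isUpperSet_insert G.2 fun y hy => ?_
    by_contra hyG
    exact hy.not_ge (hmax ⟨hF' hy.le hx1, hyG⟩ hy.le)
  · by_contra hxp
    exact hx.2 (mem_of_cnt_eq κ hFG hx.1 (hsupp _ hxp))

lemma filtR_eq (hA : IsDynkin A) (hO : IsMinusculeSet A l O) (hL : IsLabelled O κ)
    {F G : Filt P} (hle : cnt κ G.1 ≤ cnt κ F.1)
    (hsupp : ∀ i, π i ≠ p → cnt κ F.1 i = cnt κ G.1 i)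
    (hG : ∀ i, π i = p → val A l (cnt κ G.1) i ≠ -1) :
    filtR (fun x => π (κ x)) p F = G.1 := by
  have := hL.finite
  have hGF := hL.sub _ _ G.2 F.2 hle
  refine Set.Subset.antisymm (Set.biInter_subset_of_mem
    (t := fun F' : Set P => F') ⟨G.2, fun x hx => ?_⟩) ?_
  · by_contra hxp
    exact hx.2 (mem_of_cnt_eq κ hGF hx.1 (hsupp _ hxp).symm)
  · refine Set.subset_iInter₂ ?_
    rintro F' ⟨hF', hc⟩
    by_contra hcon
    obtain ⟨x, ⟨hx1, hx2⟩, hmin⟩ := Set.Finite.exists_minimal (Set.toFinite (G.1 \ F'))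
      (by rwa [Set.nonempty_iff_ne_empty, ne_eq, Set.sdiff_eq_empty])
    refine hG (κ x) (hc ⟨hGF hx1, hx2⟩) (hL.val_diff hA hO G.2 hx1 ?_)
    refine isUpperSet_diff_singleton G.2 fun y hy hyG => ?_
    exact hy.not_ge (hmin ⟨hyG, fun h => hx2 (hF' hy.le h)⟩ hy.le)

lemma filtS_eq_of_le (hA : IsDynkin A) (hO : IsMinusculeSet A l O) (hL : IsLabelled O κ)
    {F G : Filt P} (hle : cnt κ F.1 ≤ cnt κ G.1)
    (hsupp : ∀ i, π i ≠ p → cnt κ F.1 i = cnt κ G.1 i)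
    (hF : ∀ i, π i = p → val A l (cnt κ F.1) i ≠ -1)
    (hG : ∀ i, π i = p → val A l (cnt κ G.1) i ≠ 1) :
    filtS (fun x => π (κ x)) p F = G := by
  have h : (filtA (fun x => π (κ x)) p F \ F.1) ∪ filtR (fun x => π (κ x)) p F = G.1 := by
    rw [hL.filtA_eq π p hA hO hle hsupp hG,
      hL.filtR_eq π p hA hO le_rfl (fun _ _ => rfl) hF, Set.sdiff_union_self,
      Set.union_eq_left.2 (hL.sub _ _ F.2 G.2 hle)]
  unfold filtS
  rw [dif_pos (h ▸ G.2)]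
  exact Subtype.ext h

lemma filtS_eq_of_ge (hA : IsDynkin A) (hO : IsMinusculeSet A l O) (hL : IsLabelled O κ)
    {F G : Filt P} (hle : cnt κ G.1 ≤ cnt κ F.1)
    (hsupp : ∀ i, π i ≠ p → cnt κ F.1 i = cnt κ G.1 i)
    (hF : ∀ i, π i = p → val A l (cnt κ F.1) i ≠ 1)
    (hG : ∀ i, π i = p → val A l (cnt κ G.1) i ≠ -1) :
    filtS (fun x => π (κ x)) p F = G := by
  have h : (filtA (fun x => π (κ x)) p F \ F.1) ∪ filtR (fun x => π (κ x)) p F = G.1 := by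
    rw [hL.filtA_eq π p hA hO le_rfl (fun _ _ => rfl) hF,
      hL.filtR_eq π p hA hO hle hsupp hG, Set.sdiff_self, Set.empty_union]
  unfold filtS
  rw [dif_pos (h ▸ G.2)]
  exact Subtype.ext h

/-- The involution `S_i` on filters is the simple reflection `s_i` on the orbit. -/
lemma filtS_eq (hA : IsDynkin A) (hO : IsMinusculeSet A l O) (hL : IsLabelled O κ)
    {F G : Filt P} {i : ι} (h : cnt κ G.1 = cnt κ F.1 + Pi.single i (val A l (cnt κ F.1) i)) :
    filtS κ i F = G := by
  have hv : val A l (cnt κ G.1) i = -val A l (cnt κ F.1) i := by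
    rw [h, val_add_single, hA.diag]; ring
  have hs : ∀ j, id j ≠ i → cnt κ F.1 j = cnt κ G.1 j := fun j hj => by
    rw [h, Pi.add_apply, Pi.single_eq_of_ne (show j ≠ i from hj), add_zero]
  rcases hO.val_mem _ (hL.mem _ F.2) i with h1 | h1 | h1
  · refine hL.filtS_eq_of_ge id i hA hO ?_ hs ?_ ?_
    · rw [h, h1, Pi.single_neg]
      exact add_le_of_nonpos_right (neg_nonpos.2 (Pi.single_nonneg.mpr zero_le_one))
    · rintro j hj; rw [show j = i from hj, h1]; decide
    · rintro j hj; rw [show j = i from hj]; omega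
  · refine hL.filtS_eq_of_le id i hA hO ?_ hs ?_ ?_
    · rw [h, h1, Pi.single_zero, add_zero]
    · rintro j hj; rw [show j = i from hj, h1]; decide
    · rintro j hj; rw [show j = i from hj]; omega
  · refine hL.filtS_eq_of_le id i hA hO ?_ hs ?_ ?_
    · rw [h, h1]
      exact le_add_of_nonneg_right (Pi.single_nonneg.mpr zero_le_one)
    · rintro j hj; rw [show j = i from hj, h1]; decide
    · rintro j hj; rw [show j = i from hj]; omega

end Involution

end IsLabelled

end Labelled

/-! ### Reconstructing a poset and its labels from the lattice of filters -/

section Lattice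

variable {P : Type*} [PartialOrder P] {Q : Type*} [PartialOrder Q]

/-- The principal filters are singled out by the order of all filters. -/
lemma eq_principal_iff (F : Filt P) :
    (∃ x, F = ⟨Set.Ici x, isUpperSet_Ici x⟩) ↔ ∃ G < F, ∀ K < F, K ≤ G := by
  constructor
  · rintro ⟨x, rfl⟩
    refine ⟨⟨Set.Ioi x, isUpperSet_Ioi x⟩, ⟨fun y hy => le_of_lt hy, fun h => ?_⟩, ?_⟩
    · exact lt_irrefl x (h (Set.mem_Ici.2 le_rfl))
    · rintro K ⟨h1, h2⟩ y hy
      refine lt_of_le_of_ne (h1 hy) ?_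
      rintro rfl
      exact h2 fun z hz => K.2 hz hy
  · rintro ⟨G, hG, h⟩
    obtain ⟨x, hx, hxG⟩ := Set.not_subset.1 hG.2
    refine ⟨x, ?_⟩
    by_contra hne
    have h1 : (⟨Set.Ici x, isUpperSet_Ici x⟩ : Filt P) ≤ F := fun y hy => F.2 hy hx
    exact hxG (h _ (lt_of_le_of_ne h1 fun h' => hne h'.symm) (Set.mem_Ici.2 le_rfl))

lemma exists_principal (e : Filt P ≃o Filt Q) (x : P) :
    ∃ y : Q, e ⟨Set.Ici x, isUpperSet_Ici x⟩ = ⟨Set.Ici y, isUpperSet_Ici y⟩ := by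
  rw [eq_principal_iff]
  obtain ⟨G, hG, h⟩ := (eq_principal_iff _).1 ⟨x, rfl⟩
  refine ⟨e G, e.lt_iff_lt.2 hG, fun K hK => ?_⟩
  rw [← e.apply_symm_apply K, e.le_iff_le]
  exact h _ (by rwa [← e.lt_iff_lt, e.apply_symm_apply])

lemma principal_le_iff (x y : P) :
    (⟨Set.Ici x, isUpperSet_Ici x⟩ : Filt P) ≤ ⟨Set.Ici y, isUpperSet_Ici y⟩ ↔ y ≤ x :=
  Set.Ici_subset_Ici

/-- A poset is determined by its lattice of filters. -/
lemma nonempty_orderIso_of_filt (e : Filt P ≃o Filt Q) : Nonempty (P ≃o Q) := by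
  choose g hg using exists_principal e
  choose g' hg' using exists_principal e.symm
  have hle : ∀ x y, g x ≤ g y ↔ x ≤ y := fun x y => by
    rw [← principal_le_iff, ← hg, ← hg, e.le_iff_le, principal_le_iff]
  have hsurj : Function.Surjective g := fun y => by
    refine ⟨g' y, ?_⟩
    have h1 := hg (g' y)
    rw [← hg', e.apply_symm_apply] at h1
    exact le_antisymm ((principal_le_iff _ _).1 h1.le) ((principal_le_iff _ _).1 h1.ge)
  exact ⟨RelIso.ofSurjective (OrderEmbedding.ofMapLEIff g fun x y => hle x y) hsurj⟩

/-- If the lattice of filters has an order-reversing bijection, the poset is self-dual. -/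
lemma selfDual_of_antitone (ψ : Filt P ≃ Filt P) (hψ : ∀ F G, F ≤ G ↔ ψ G ≤ ψ F) :
    Nonempty (P ≃o Pᵒᵈ) := by
  refine nonempty_orderIso_of_filt (P := P) (Q := Pᵒᵈ) ?_
  let e : Filt P ≃ Filt Pᵒᵈ :=
    { toFun := fun F => ⟨{x | OrderDual.ofDual x ∉ F.1}, fun _ _ hab ha hb => ha (F.2 hab hb)⟩
      invFun := fun F => ⟨{x | OrderDual.toDual x ∉ F.1}, fun _ _ hab ha hb => ha (F.2 hab hb)⟩
      left_inv := fun F => Subtype.ext (by ext x; simp)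
      right_inv := fun F => Subtype.ext (by ext x; simp) }
  refine ⟨ψ.trans e, fun {F G} => ?_⟩
  rw [hψ]
  exact Set.compl_subset_compl (s := (ψ F).1) (t := (ψ G).1)

end Lattice

lemma hasse_connected {P : Type*} [PartialOrder P] [Finite P] {m : P} (hm : IsTop m) :
    (SimpleGraph.hasse P).Connected := by
  have h : ∀ x : P, (SimpleGraph.hasse P).Reachable x m := by
    intro x
    induction x using WellFoundedGT.induction with
    | _ x ih =>
      rcases eq_or_lt_of_le (hm x) with rfl | hlt
      · rfl
      · obtain ⟨y, hxy⟩ := exists_covBy_of_wellFoundedLT hlt.not_isMax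
        exact (SimpleGraph.Adj.reachable (SimpleGraph.hasse_adj.2 (.inl hxy))).trans (ih y hxy.lt)
  have : Nonempty P := ⟨m⟩
  exact ⟨fun x y => (h x).trans (h y).symm⟩

section Reconstruct

variable {ι : Type*} [Fintype ι] [DecidableEq ι] {A : Matrix ι ι ℤ} {l : ι → ℤ} {O : Set (ι → ℤ)}

/-- A minuscule orbit is a finite distributive lattice, hence a lattice of filters. -/
lemma IsMinusculeOrbit.exists_poset (hA : IsDynkin A) (hO : IsMinusculeOrbit A l O)
    (hfin : O.Finite) : ∃ (P : Type) (_ : PartialOrder P) (φ : O ≃ Filt P),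
      ∀ a b, a.1 ≤ b.1 ↔ φ a ≤ φ b := by
  classical
  let S : Sublattice (ι → ℤ) := ⟨O, fun a ha b hb => hO.sup_mem hA ha hb,
    fun a ha b hb => hO.inf_mem hA ha hb⟩
  have : Finite S := hfin
  have := Fintype.ofFinite S
  let _ : OrderBot S := { bot := ⟨0, hO.zero_mem⟩, bot_le := fun a => hO.nonneg _ a.2 }
  let e : S ≃o LowerSet {a : S // SupIrred a} := OrderIso.lowerSetSupIrred
  obtain ⟨Q, ⟨g⟩⟩ : ∃ Q : Type, Nonempty ({a : S // SupIrred a} ≃ Q) :=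
    let ⟨n, h⟩ := Finite.exists_equiv_fin {a : S // SupIrred a}
    ⟨Fin n, h⟩
  let _ : PartialOrder (Q) := PartialOrder.lift (fun x => OrderDual.toDual (g.symm x))
    fun _ _ h => g.symm.injective (OrderDual.toDual.injective h)
  have hle : ∀ x y : Q, x ≤ y ↔ g.symm y ≤ g.symm x := fun x y => Iff.rfl
  let φ : S ≃ Filt (Q) :=
    { toFun := fun a => ⟨{x | g.symm x ∈ e a}, fun _ _ hxy hx => (e a).lower hxy hx⟩
      invFun := fun F => e.symm ⟨{x | g x ∈ F.1}, fun _ _ hxy hx => F.2 ((hle _ _).2 (by simpa)) hx⟩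
      left_inv := fun a => by
        rw [OrderIso.symm_apply_eq]
        ext x
        change g.symm (g x) ∈ e a ↔ x ∈ e a
        rw [g.symm_apply_apply]
      right_inv := fun F => by
        refine Subtype.ext ?_
        ext x
        simp only [OrderIso.apply_symm_apply, Set.mem_ofPred_eq]
        change g (g.symm x) ∈ F.1 ↔ _
        rw [g.apply_symm_apply] }
  refine ⟨Q, inferInstance, φ, fun a b => ?_⟩
  have h1 : a.1 ≤ b.1 ↔ e a ≤ e b := (e.le_iff_le (x := a) (y := b)).symm
  rw [h1]
  constructor
  · exact fun h x hx => h hx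
  · intro h x hx
    have : g x ∈ (φ b).1 := h (show g.symm (g x) ∈ e a by rwa [g.symm_apply_apply])
    rw [← g.symm_apply_apply x]
    exact this

variable {P : Type*} [PartialOrder P]

lemma finite_of_filt [Finite (Filt P)] : Finite P :=
  Finite.of_injective (fun x : P => (⟨Set.Ici x, isUpperSet_Ici x⟩ : Filt P)) fun _ _ h =>
    Set.Ici_injective (congrArg Subtype.val h)

/-- An order isomorphism between a minuscule orbit and a lattice of filters comes from labels: along
each cover `F ⊂ F ∪ {x}` one coordinate grows by one, and which one depends only on `x`. -/
lemma IsMinusculeOrbit.exists_isLabelled (hA : IsDynkin A) (hO : IsMinusculeOrbit A l O)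
    (hfin : O.Finite) (φ : O ≃ Filt P) (hφ : ∀ a b, a.1 ≤ b.1 ↔ φ a ≤ φ b) :
    ∃ κ : P → ι, IsLabelled O κ ∧ ∀ a, cnt κ (φ a).1 = a.1 := by
  have := hfin.to_subtype
  have : Finite (Filt P) := Finite.of_equiv _ φ
  have : Finite P := finite_of_filt
  let g : Filt P → (ι → ℤ) := fun F => (φ.symm F).1
  have hg : ∀ F, g F ∈ O := fun F => (φ.symm F).2
  have hle : ∀ F G, g F ≤ g G ↔ F ≤ G := fun F G => by
    rw [hφ, φ.apply_symm_apply, φ.apply_symm_apply]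
  have hinj : ∀ F G, g F = g G → F = G := fun F G h => φ.symm.injective (Subtype.ext h)
  have hsurj : ∀ c ∈ O, ∃ F, g F = c := fun c hc => ⟨φ ⟨c, hc⟩, by simp [g]⟩
  have hcov : ∀ (F : Filt P) (x : P) (hx : x ∉ F.1) (hxF : IsUpperSet (insert x F.1)),
      ∃ i, g ⟨_, hxF⟩ = g F + Pi.single i 1 := by
    intro F x hx hxF
    have h1 : g F ≤ g ⟨_, hxF⟩ := (hle _ _).2 (Set.subset_insert x F.1)
    rcases ReflTransGen.cases_head (hO.exists_path hA (hg _) (hg _) h1) with h | ⟨c, ⟨-, hc, i, hi⟩, h⟩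
    · have := congrArg Subtype.val (hinj _ _ h)
      exact absurd (this ▸ Set.mem_insert x F.1 : x ∈ F.1) hx
    · obtain ⟨G, hG⟩ := hsurj c hc
      have h2 := IsMinusculeSet.le_of_path h
      rw [← hG, hle] at h2
      have h3 : F ≤ G := by
        rw [← hle, hG, hi]
        exact le_add_of_nonneg_right (Pi.single_nonneg.mpr zero_le_one)
      have h4 : x ∈ G.1 := by
        by_contra hxG
        have : F = G := le_antisymm h3 fun y hy =>
          (h2 hy).resolve_left (by rintro rfl; exact hxG hy)
        rw [← hG, ← this] at hi
        have := congrFun hi i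
        simp at this
      have h5 : (⟨_, hxF⟩ : Filt P) = G :=
        le_antisymm (Set.insert_subset h4 h3) h2
      exact ⟨i, by rw [h5, hG, hi]⟩
  have hIoi : ∀ x : P, IsUpperSet (insert x (Set.Ioi x)) := fun x =>
    isUpperSet_insert (isUpperSet_Ioi x) fun _ h => h
  choose κ hκ using fun x : P => hcov ⟨Set.Ioi x, isUpperSet_Ioi x⟩ x (lt_irrefl x) (hIoi x)
  have hstep : ∀ (F : Filt P) (x : P) (hx : x ∉ F.1) (hxF : IsUpperSet (insert x F.1)),
      g ⟨_, hxF⟩ = g F + Pi.single (κ x) 1 := by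
    intro F x hx hxF
    obtain ⟨j, hj⟩ := hcov F x hx hxF
    have h1 : Set.Ioi x ⊆ F.1 := fun y hy =>
      (hxF hy.le (Set.mem_insert x _)).resolve_left hy.ne'
    have h2 : g ⟨Set.Ioi x, isUpperSet_Ioi x⟩ ≤ g F := (hle _ _).2 h1
    have h3 : g ⟨_, hIoi x⟩ ≤ g ⟨_, hxF⟩ := (hle _ _).2 (Set.insert_subset_insert h1)
    rw [hκ, hj] at h3
    by_cases hjx : j = κ x
    · rw [hj, hjx]
    · exfalso
      -- otherwise `F` would already contain `x`
      have h4 : g ⟨_, hIoi x⟩ ≤ g F := by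
        rw [hκ]
        intro i
        by_cases hi : i = κ x
        · have := h3 i
          simp only [Pi.add_apply, Pi.single_eq_of_ne (show i ≠ j from fun h => hjx (h ▸ hi)),
            add_zero] at this
          exact this
        · simpa [hi] using h2 i
      exact hx ((hle _ _).1 h4 (Set.mem_insert x _))
  have hempty : g ⟨∅, isUpperSet_empty⟩ = 0 := by
    obtain ⟨F, hF⟩ := hsurj 0 hO.zero_mem
    refine le_antisymm ?_ (hO.nonneg _ (hg _))
    rw [← hF, hle]
    exact Set.empty_subset _
  have hcnt : ∀ F : Filt P, cnt κ F.1 = g F := by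
    intro F
    induction hn : F.1.ncard using Nat.strong_induction_on generalizing F with
    | _ n ih =>
      rcases Set.eq_empty_or_nonempty F.1 with h | h
      · have : F = ⟨∅, isUpperSet_empty⟩ := Subtype.ext h
        rw [this, hempty, cnt_empty]
      · obtain ⟨x, hx, hmin⟩ := Set.Finite.exists_minimal (Set.toFinite F.1) h
        have hF' : IsUpperSet (F.1 \ {x}) := isUpperSet_diff_singleton F.2 fun y hy hyF =>
          hy.not_ge (hmin hyF hy.le)
        have h0 : insert x (F.1 \ {x}) = F.1 := by simp [Set.insert_eq_of_mem hx]
        have hlt : (F.1 \ {x}).ncard < n := hn ▸ Set.ncard_sdiff_singleton_lt_of_mem hx (Set.toFinite _)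
        have h1 := ih _ hlt ⟨_, hF'⟩ rfl
        have h2 := hstep ⟨_, hF'⟩ x (by simp) (by rw [h0]; exact F.2)
        have h3 := cnt_insert κ (F := F.1 \ {x}) (x := x) (by simp)
        rw [h0, h1] at h3
        rw [h3, ← h2]
        exact congrArg g (Subtype.ext h0)
  refine ⟨κ, ⟨inferInstance, fun F hF => ?_, fun c hc => ?_, fun F G hF hG h => ?_⟩, fun a => ?_⟩
  · rw [hcnt ⟨F, hF⟩]; exact hg _
  · obtain ⟨F, hF⟩ := hsurj c hc
    exact ⟨F.1, F.2, (hcnt F).trans hF⟩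
  · rw [hcnt ⟨F, hF⟩, hcnt ⟨G, hG⟩, hle] at h
    exact h
  · rw [hcnt]; simp [g]

/-- A diagram automorphism that fixes `λ` preserves the orbit of `λ`. -/
lemma reach_comp {ρ : Equiv.Perm ι} (hρ : ∀ i j, A (ρ i) (ρ j) = A i j) (hl : ∀ i, l (ρ i) = l i)
    {c : ι → ℤ} (hc : c ∈ reach A l) : (fun i => c (ρ i)) ∈ reach A l := by
  induction hc with
  | refl => exact .refl
  | @tail b c _ h ih =>
    obtain ⟨i, rfl⟩ := h
    refine ih.tail ⟨ρ.symm i, ?_⟩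
    have h1 : val A l (fun i => b (ρ i)) (ρ.symm i) = val A l b i := by
      unfold val
      rw [← hl (ρ.symm i), ρ.apply_symm_apply, ← Equiv.sum_comp ρ fun j => b j * A j i]
      congr 1
      refine Finset.sum_congr rfl fun j _ => ?_
      rw [← hρ j, ρ.apply_symm_apply]
    ext j
    simp only [Pi.add_apply, h1]
    congr 1
    by_cases hj : ρ j = i
    · subst hj; simp
    · rw [Pi.single_eq_of_ne hj, Pi.single_eq_of_ne]
      rintro rfl; simp at hj

/-- A coloring with the properties (a), (b), (c) of the definition of a colored minuscule poset
differs from the labels only by a diagram automorphism that fixes `λ`, and hence is itself a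
labelling. -/
lemma IsLabelled.of_coloring (hA : IsDynkin A) {i : ι} (hl : l = Pi.single i 1)
    (hO : IsMinusculeOrbit A l (reach A l)) {κ' κ : P → ι} (hL : IsLabelled (reach A l) κ')
    (hbij : Set.BijOn κ (topTree P) Set.univ)
    (hadj : ∀ x y : topTree P, (SimpleGraph.hasse (topTree P)).Adj x y ↔
      κ x ≠ κ y ∧ A (κ x) (κ y) ≠ 0)
    (hends : ∀ (k : ℕ) (x y : P), IsDInterval k x y → κ x = κ y)
    {m : P} (hm : IsTop m) (hmi : κ m = i) : IsLabelled (reach A l) κ := by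
  have hfin := hL.finite
  have hH := hL.isHeap hA hO
  have hbij' := hH.topTree_bijOn hA (hL.surjective hA hO hl)
  let e : topTree P ≃ ι := (hbij.equiv κ).trans (Equiv.Set.univ ι)
  let e' : topTree P ≃ ι := (hbij'.equiv κ').trans (Equiv.Set.univ ι)
  have he : ∀ x, e x = κ x := fun x => rfl
  have he' : ∀ x, e' x = κ' x := fun x => rfl
  let ρ : Equiv.Perm ι := e'.symm.trans e
  have hρ : ∀ x : topTree P, ρ (κ' x) = κ x := fun x => by
    rw [← he', ← he]; simp [ρ]
  have hρA : ∀ a b, A (ρ a) (ρ b) = A a b := by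
    intro a b
    obtain ⟨x, rfl⟩ := e'.surjective a
    obtain ⟨y, rfl⟩ := e'.surjective b
    rw [he', he', hρ, hρ]
    by_cases hxy : x = y
    · rw [hxy, hA.diag, hA.diag]
    have h1 : κ x ≠ κ y := fun h => hxy (e.injective h)
    have h2 : κ' x ≠ κ' y := fun h => hxy (e'.injective h)
    have h3 := hadj x y
    rw [hH.topTree_adj hA] at h3
    rcases hA.off _ _ h1 with h4 | h4 <;> rcases hA.off _ _ h2 with h5 | h5
    · rw [h4, h5]
    · exact absurd h4 (h3.1 h5).2
    · have := h3.2 ⟨h1, by rw [h4]; decide⟩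
      omega
    · rw [h4, h5]
  have hm' : κ' m = i := by
    obtain ⟨m', hm', h⟩ := hL.exists_top hA hO hl
    rw [le_antisymm (hm' m) (hm m')]; exact h
  have hmt : m ∈ topTree P := (hH.mem_topTree_iff hA).2 fun y hy => absurd hy (hm y).not_gt
  have hρi : ρ i = i := by
    have := hρ ⟨m, hmt⟩
    rwa [hm', hmi] at this
  have hρl : ∀ j, l (ρ j) = l j := fun j => by
    rw [hl]
    by_cases h : j = i
    · rw [h, hρi]
    · rw [Pi.single_eq_of_ne h, Pi.single_eq_of_ne]
      intro h'
      exact h (ρ.injective (h'.trans hρi.symm))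
  have hκ : ∀ x, κ x = ρ (κ' x) := by
    intro x
    induction x using WellFoundedGT.induction with
    | _ x ih =>
      by_cases hx : x ∈ topTree P
      · exact (hρ ⟨x, hx⟩).symm
      · have h1 : ∃ y, x < y ∧ κ' y = κ' x := by
          rw [hH.mem_topTree_iff hA] at hx
          push Not at hx
          exact hx
        obtain ⟨y, hxy, hc⟩ := h1
        obtain ⟨z, hz⟩ := hH.exists_next hxy hc.symm
        obtain ⟨k, hk⟩ := hH.exists_dInt hA hz
        rw [hends k x z (isDInterval_iff.2 hk), ih z hz.1, hz.2.1]
  have hcnt : ∀ F : Set P, cnt κ F = fun j => cnt κ' F (ρ.symm j) := by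
    intro F
    ext j
    simp only [cnt]
    have : {x | x ∈ F ∧ κ x = j} = {x | x ∈ F ∧ κ' x = ρ.symm j} := by
      ext x
      simp only [Set.mem_ofPred_eq, hκ x, Equiv.eq_symm_apply]
    rw [this]
  have hcnt' : ∀ F : Set P, cnt κ' F = fun j => cnt κ F (ρ j) := fun F => by
    rw [hcnt]; simp
  have hρA' : ∀ a b, A (ρ.symm a) (ρ.symm b) = A a b := fun a b => by
    rw [← hρA]; simp
  have hρl' : ∀ j, l (ρ.symm j) = l j := fun j => by rw [← hρl]; simp
  refine ⟨hfin, fun F hF => ?_, fun c hc => ?_, fun F G hF hG h => ?_⟩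
  · rw [hcnt]
    exact reach_comp hρA' hρl' (hL.mem F hF)
  · obtain ⟨F, hF, hFc⟩ := hL.surj _ (reach_comp hρA hρl hc)
    refine ⟨F, hF, ?_⟩
    rw [hcnt, hFc]
    simp
  · refine hL.sub F G hF hG ?_
    rw [hcnt', hcnt']
    exact fun j => h _

end Reconstruct

open Module

/-! ### Reflection groups -/

section Reflection

variable {V : Type*} [AddCommGroup V] [Module ℂ V]

/-- The reflection `ν ↦ ν - ν(c) β`. -/
def refl (r : Dual ℂ V × V) (hr : r.1 r.2 = 2) : Dual ℂ V ≃ₗ[ℂ] Dual ℂ V :=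
  Module.reflection (x := r.1) (f := Dual.eval ℂ V r.2) hr

lemma refl_mul_self (r : Dual ℂ V × V) (hr : r.1 r.2 = 2) : refl r hr * refl r hr = 1 :=
  LinearEquiv.ext fun ν => Module.involutive_reflection (f := Dual.eval ℂ V r.2) hr ν

variable {Φ : Set (Dual ℂ V × V)}

lemma refl_mem {r : Dual ℂ V × V} (hr : r ∈ Φ) (h2 : r.1 r.2 = 2) : refl r h2 ∈ reflGroup Φ :=
  Subgroup.subset_closure ⟨r, hr, fun _ => rfl⟩

/-- Induction over a reflection group, multiplying by one reflection at a time. -/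
lemma reflGroup_induction (hΦ : ∀ r ∈ Φ, r.1 r.2 = 2)
    {p : (Dual ℂ V ≃ₗ[ℂ] Dual ℂ V) → Prop} (one : p 1)
    (mul : ∀ r (hr : r ∈ Φ), ∀ g ∈ reflGroup Φ, p g → p (refl r (hΦ r hr) * g)) :
    ∀ g ∈ reflGroup Φ, p g := by
  have key : ∀ s, (∃ r ∈ Φ, ∀ ν, s ν = ν - ν r.2 • r.1) → ∃ r, ∃ hr : r ∈ Φ, s = refl r (hΦ r hr) := by
    rintro s ⟨r, hr, h⟩
    exact ⟨r, hr, LinearEquiv.ext h⟩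
  intro g hg
  induction hg using Subgroup.closure_induction_left with
  | one => exact one
  | mul_left s hs g hg ih =>
    obtain ⟨r, hr, rfl⟩ := key s hs
    exact mul r hr g hg ih
  | inv_mul_cancel s hs g hg ih =>
    obtain ⟨r, hr, rfl⟩ := key s hs
    rw [inv_eq_of_mul_eq_one_left (refl_mul_self r _)]
    exact mul r hr g hg ih

end Reflection

/-! ### The Weyl group orbit as a set of integer vectors -/

section Dictionary

variable {L : Type*} [LieRing L] [LieAlgebra ℂ L] {H : LieSubalgebra ℂ L}
variable {ι : Type*} [Fintype ι] (B : LieAlgebra.Basis ι H)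

lemma simplePairs_two : ∀ r ∈ simplePairs B, r.1 r.2 = 2 := by
  have : IsAddTorsionFree L := .of_isTorsionFree ℂ L
  rintro _ ⟨i, rfl⟩
  simp

/-- The simple reflection `s_i`. -/
def simpleRefl (i : ι) : Dual ℂ H ≃ₗ[ℂ] Dual ℂ H :=
  refl (B.baseSupp i, B.h' i) (simplePairs_two B _ ⟨i, rfl⟩)

lemma simpleRefl_apply (i : ι) (ν : Dual ℂ H) :
    simpleRefl B i ν = ν - ν (B.h' i) • B.baseSupp i := rfl

lemma simpleRefl_mem (i : ι) : simpleRefl B i ∈ weyl B := refl_mem (Set.mem_range_self i) _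

lemma weyl_induction {p : (Dual ℂ H ≃ₗ[ℂ] Dual ℂ H) → Prop} (one : p 1)
    (mul : ∀ i, ∀ g ∈ weyl B, p g → p (simpleRefl B i * g)) : ∀ g ∈ weyl B, p g := by
  refine reflGroup_induction (simplePairs_two B) one ?_
  rintro _ ⟨i, rfl⟩ g hg h
  exact mul i g hg h

lemma mem_orbit_self {V : Type*} [AddCommGroup V] [Module ℂ V]
    (W : Subgroup (Dual ℂ V ≃ₗ[ℂ] Dual ℂ V)) (ν : Dual ℂ V) : ν ∈ orbit W ν :=
  ⟨1, W.one_mem, rfl⟩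

lemma map_mem_orbit {V : Type*} [AddCommGroup V] [Module ℂ V]
    {W : Subgroup (Dual ℂ V ≃ₗ[ℂ] Dual ℂ V)} {ν μ : Dual ℂ V} {g : Dual ℂ V ≃ₗ[ℂ] Dual ℂ V}
    (hg : g ∈ W) (hμ : μ ∈ orbit W ν) : g μ ∈ orbit W ν := by
  obtain ⟨w, hw, rfl⟩ := hμ
  exact ⟨g * w, W.mul_mem hg hw, rfl⟩

/-- The weight `λ - ∑ c_i α_i`. -/
def wt (lam : Dual ℂ H) (c : ι → ℤ) : Dual ℂ H := lam - ∑ i, (c i : ℂ) • B.baseSupp i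

variable {lam : Dual ℂ H} {l : ι → ℤ}

lemma wt_zero : wt B lam 0 = lam := by simp [wt]

lemma wt_apply (hl : ∀ i, lam (B.h' i) = l i) (c : ι → ℤ) (i : ι) :
    wt B lam c (B.h' i) = val B.A l c i := by
  simp [wt, val, hl]

lemma wt_sub_wt (c d : ι → ℤ) :
    wt B lam c - wt B lam d = ∑ i, ((d i - c i : ℤ) : ℂ) • B.baseSupp i := by
  simp [wt, sub_smul]

lemma sum_injective {a b : ι → ℂ} (h : ∑ i, a i • B.baseSupp i = ∑ i, b i • B.baseSupp i) : a = b := by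
  have := Fintype.linearIndependent_iff.1 B.linearIndependent_baseSupp (fun i => a i - b i)
    (by simp [sub_smul, h])
  ext i
  exact sub_eq_zero.1 (this i)

lemma wt_injective : Function.Injective (wt B lam) := fun c d h => by
  have h1 := wt_sub_wt B (lam := lam) c d
  rw [h, sub_self] at h1
  have h2 := sum_injective B (a := fun i => ((d i - c i : ℤ) : ℂ)) (b := 0) (by rw [← h1]; simp)
  ext i
  have h3 := congrFun h2 i
  simp only [Pi.zero_apply, Int.cast_eq_zero] at h3
  omega

variable [DecidableEq ι]

lemma simpleRefl_wt (hl : ∀ i, lam (B.h' i) = l i) (c : ι → ℤ) (i : ι) :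
    simpleRefl B i (wt B lam c) = wt B lam (c + Pi.single i (val B.A l c i)) := by
  rw [simpleRefl_apply, wt_apply B hl, ← sub_eq_zero, sub_right_comm, wt_sub_wt, sub_eq_zero]
  rw [Finset.sum_eq_single i]
  · simp
  · intro j _ hj; simp [hj]
  · simp

lemma wt_mem_orbit_iff (hl : ∀ i, lam (B.h' i) = l i) (μ : Dual ℂ H) :
    μ ∈ orbit (weyl B) lam ↔ ∃ c ∈ reach B.A l, wt B lam c = μ := by
  constructor
  · rintro ⟨g, hg, rfl⟩
    refine weyl_induction B (p := fun g => ∃ c ∈ reach B.A l, wt B lam c = g lam) ?_ ?_ g hg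
    · exact ⟨0, .refl, wt_zero B⟩
    · rintro i g - ⟨c, hc, h⟩
      refine ⟨_, hc.tail ⟨i, rfl⟩, ?_⟩
      rw [← simpleRefl_wt B hl, h]
      rfl
  · rintro ⟨c, hc, rfl⟩
    induction hc with
    | refl => rw [wt_zero]; exact mem_orbit_self _ _
    | tail _ h ih =>
      obtain ⟨i, rfl⟩ := h
      rw [← simpleRefl_wt B hl]
      exact map_mem_orbit (simpleRefl_mem B i) ih

/-- The orbit of `λ`, in coordinates with respect to the simple roots. -/
def orbitEquiv (hl : ∀ i, lam (B.h' i) = l i) : orbit (weyl B) lam ≃ reach B.A l :=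
  (Equiv.ofBijective (fun c : reach B.A l =>
      (⟨wt B lam c, (wt_mem_orbit_iff B hl _).2 ⟨c, c.2, rfl⟩⟩ : orbit (weyl B) lam))
    ⟨fun _ _ h => Subtype.ext (wt_injective B (congrArg Subtype.val h)), fun μ =>
      let ⟨c, hc, h⟩ := (wt_mem_orbit_iff B hl _).1 μ.2
      ⟨⟨c, hc⟩, Subtype.ext h⟩⟩).symm

lemma wt_orbitEquiv (hl : ∀ i, lam (B.h' i) = l i) (μ : orbit (weyl B) lam) :
    wt B lam (orbitEquiv B hl μ).1 = μ.1 :=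
  congrArg Subtype.val ((orbitEquiv B hl).symm_apply_apply μ)

lemma orbitEquiv_eq (hl : ∀ i, lam (B.h' i) = l i) {μ : orbit (weyl B) lam} {c : ι → ℤ}
    (h : wt B lam c = μ.1) : (orbitEquiv B hl μ).1 = c :=
  wt_injective B ((wt_orbitEquiv B hl μ).trans h.symm)

lemma isMinusculeOrbit (hA : IsDynkin B.A) (hlam : IsMinuscule B lam)
    (hl : ∀ i, lam (B.h' i) = l i) : IsMinusculeOrbit B.A l (reach B.A l) := by
  refine isMinusculeOrbit_reach hA (fun i => ?_) fun c hc i => ?_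
  · obtain ⟨n, hn⟩ := hlam.1 i
    have : (l i : ℂ) = (n : ℤ) := by rw [← hl, hn]; simp
    rw [Int.cast_injective this]
    exact Int.natCast_nonneg n
  · have h := hlam.2 _ ((wt_mem_orbit_iff B hl _).2 ⟨c, hc, rfl⟩) i
    rw [wt_apply B hl] at h
    exact_mod_cast h

lemma finite_reach (hO : IsMinusculeOrbit B.A l (reach B.A l)) : (reach B.A l).Finite := by
  refine IsMinusculeOrbit.finite (fun n hn => ?_) hO.1
  exact Matrix.eq_zero_of_vecMul_eq_zero B.nondegen.det_ne_zero (funext fun i => by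
    simpa [Matrix.vecMul, dotProduct] using hn i)

lemma mem_closure_iff (β : Dual ℂ H) : β ∈ AddSubmonoid.closure (Set.range B.baseSupp) ↔
    ∃ n : ι → ℕ, β = ∑ i, (n i : ℂ) • B.baseSupp i := by
  constructor
  · intro h
    induction h using AddSubmonoid.closure_induction with
    | mem x hx =>
      obtain ⟨i, rfl⟩ := hx
      refine ⟨Pi.single i 1, ?_⟩
      rw [Finset.sum_eq_single i]
      · simp
      · intro j _ hj; simp [hj]
      · simp
    | zero => exact ⟨0, by simp⟩
    | add x y _ _ hx hy =>
      obtain ⟨n, rfl⟩ := hx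
      obtain ⟨m, rfl⟩ := hy
      exact ⟨n + m, by simp [add_smul, Finset.sum_add_distrib]⟩
  · rintro ⟨n, rfl⟩
    refine sum_mem fun i _ => ?_
    rw [Nat.cast_smul_eq_nsmul]
    exact nsmul_mem (AddSubmonoid.subset_closure (Set.mem_range_self i)) _

/-- If one weight is obtained from another by subtracting a positive multiple of a nonnegative
combination of simple roots, its coordinates are larger. -/
lemma le_of_wt_eq {c d : ι → ℤ} {t : ℂ} (ht : 0 < t) {n : ι → ℕ}
    (h : wt B lam d = wt B lam c - t • ∑ i, (n i : ℂ) • B.baseSupp i) : c ≤ d := by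
  have h1 := wt_sub_wt B (lam := lam) c d
  rw [h, sub_sub_cancel, Finset.smul_sum] at h1
  simp only [smul_smul] at h1
  have h2 := sum_injective B (a := fun i => t * n i) (b := fun i => ((d i - c i : ℤ) : ℂ)) h1
  intro i
  have h3 := congrFun h2 i
  have h4 : (0 : ℂ) ≤ ((d i - c i : ℤ) : ℂ) := by
    rw [← h3]; exact mul_nonneg ht.le (Nat.cast_nonneg _)
  have : (0 : ℤ) ≤ d i - c i := by exact_mod_cast h4
  exact sub_nonneg.1 this

end Dictionary

/-! ### Roots -/

section Roots

open LieAlgebra LieAlgebra.IsKilling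

variable {L : Type*} [LieRing L] [LieAlgebra ℂ L] [FiniteDimensional ℂ L] [IsKilling ℂ L]
variable {H : LieSubalgebra ℂ L} [H.IsCartanSubalgebra]
variable {ι : Type*} [Fintype ι] (B : LieAlgebra.Basis ι H)

lemma root_baseSupp' (i : ι) : (rootSystem H).root (B.baseSupp' i) = B.baseSupp i := rfl

lemma coroot_baseSupp' (i : ι) : (rootSystem H).coroot (B.baseSupp' i) = B.h' i :=
  B.coroot_eq_h' i

lemma simplePairs_subset_posPairs : simplePairs B ⊆ posPairs B := by
  rintro _ ⟨i, rfl⟩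
  exact ⟨AddSubmonoid.subset_closure ⟨i, rfl⟩, B.baseSupp' i, root_baseSupp' B i, coroot_baseSupp' B i⟩

lemma root_pos_or_neg (x : H.root) :
    (rootSystem H).root x ∈ AddSubmonoid.closure (Set.range B.baseSupp) ∨
    -(rootSystem H).root x ∈ AddSubmonoid.closure (Set.range B.baseSupp) := by
  have := B.root_mem_or_mem_neg x
  rwa [← Set.range_comp] at this

lemma coroot_pos_or_neg (x : H.root) :
    (rootSystem H).coroot x ∈ AddSubmonoid.closure (Set.range B.h') ∨
    -(rootSystem H).coroot x ∈ AddSubmonoid.closure (Set.range B.h') := by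
  have := B.base.coroot_mem_or_neg_mem x
  have h : (rootSystem H).coroot '' B.base.support = Set.range B.h' := by
    ext y
    constructor
    · rintro ⟨z, hz, rfl⟩
      obtain ⟨i, hi⟩ := B.baseSupportEquiv.surjective ⟨z, hz⟩
      refine ⟨i, ?_⟩
      have := B.coroot_eq_h' i
      rw [hi] at this
      exact this.symm
    · rintro ⟨i, rfl⟩
      exact ⟨B.baseSupportEquiv i, (B.baseSupportEquiv i).2, B.coroot_eq_h' i⟩
  rwa [h] at this

lemma root_reflectionPerm (i : ι) (x : H.root) :
    (rootSystem H).root ((rootSystem H).reflectionPerm (B.baseSupp' i) x) =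
      simpleRefl B i ((rootSystem H).root x) := by
  rw [RootPairing.root_reflectionPerm, RootPairing.reflection_apply, simpleRefl_apply,
    ← coroot_baseSupp']
  rfl

lemma exists_coroot_of_mem_weyl {g : Dual ℂ H ≃ₗ[ℂ] Dual ℂ H} (hg : g ∈ weyl B) (x : H.root) :
    ∃ y : H.root, ∀ ν : Dual ℂ H, (g ν) ((rootSystem H).coroot x) = ν ((rootSystem H).coroot y) := by
  refine weyl_induction B (p := fun g => ∀ x : H.root, ∃ y : H.root, ∀ ν : Dual ℂ H,
    (g ν) ((rootSystem H).coroot x) = ν ((rootSystem H).coroot y)) (fun x => ⟨x, fun _ => rfl⟩) ?_ g hg x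
  intro i g _ ih x
  obtain ⟨y, hy⟩ := ih ((rootSystem H).reflectionPerm (B.baseSupp' i) x)
  refine ⟨y, fun ν => ?_⟩
  rw [← hy, RootPairing.coroot_reflectionPerm, RootPairing.coreflection_apply, map_sub, map_smul,
    coroot_baseSupp']
  change simpleRefl B i (g ν) _ = _
  rw [simpleRefl_apply, LinearMap.sub_apply, LinearMap.smul_apply, smul_eq_mul, smul_eq_mul,
    mul_comm]
  rfl

lemma exists_root_of_mem_weyl {g : Dual ℂ H ≃ₗ[ℂ] Dual ℂ H} (hg : g ∈ weyl B) (x : H.root) :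
    ∃ y : H.root, g ((rootSystem H).root x) = (rootSystem H).root y := by
  refine weyl_induction B (p := fun g => ∀ x : H.root, ∃ y : H.root,
    g ((rootSystem H).root x) = (rootSystem H).root y) (fun x => ⟨x, rfl⟩) ?_ g hg x
  intro i g _ ih x
  obtain ⟨y, hy⟩ := ih x
  refine ⟨(rootSystem H).reflectionPerm (B.baseSupp' i) y, ?_⟩
  rw [root_reflectionPerm, ← hy]
  rfl

/-- A Weyl group element takes each simple coroot to a positive or a negative coroot. -/
lemma exists_coeff_of_mem_weyl {g : Dual ℂ H ≃ₗ[ℂ] Dual ℂ H} (hg : g ∈ weyl B) (i : ι) :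
    ∃ k : ι → ℕ, (∀ ν : Dual ℂ H, (g ν) (B.h' i) = ∑ j, (k j : ℂ) * ν (B.h' j)) ∨
      ∀ ν : Dual ℂ H, (g ν) (B.h' i) = -∑ j, (k j : ℂ) * ν (B.h' j) := by
  classical
  have key : ∀ x ∈ AddSubmonoid.closure (Set.range B.h'), ∃ k : ι → ℕ, ∀ ν : Dual ℂ H,
      ν x = ∑ j, (k j : ℂ) * ν (B.h' j) := by
    intro x hx
    induction hx using AddSubmonoid.closure_induction with
    | mem x hx =>
      obtain ⟨i, rfl⟩ := hx
      refine ⟨Pi.single i 1, fun ν => ?_⟩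
      rw [Finset.sum_eq_single i]
      · simp
      · intro j _ hj; simp [hj]
      · simp
    | zero => exact ⟨0, by simp⟩
    | add x y _ _ hx hy =>
      obtain ⟨n, hn⟩ := hx
      obtain ⟨m, hm⟩ := hy
      exact ⟨n + m, fun ν => by simp [hn, hm, add_mul, Finset.sum_add_distrib]⟩
  obtain ⟨y, hy⟩ := exists_coroot_of_mem_weyl B hg (B.baseSupp' i)
  rw [coroot_baseSupp'] at hy
  rcases coroot_pos_or_neg B y with h | h
  · obtain ⟨k, hk⟩ := key _ h
    exact ⟨k, .inl fun ν => by rw [hy, hk]⟩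
  · obtain ⟨k, hk⟩ := key _ h
    exact ⟨k, .inr fun ν => by rw [hy, ← hk, map_neg, neg_neg]⟩

lemma eq_zero_of_mem_closure {β : Dual ℂ H} (h : β ∈ AddSubmonoid.closure (Set.range B.baseSupp))
    (h' : -β ∈ AddSubmonoid.closure (Set.range B.baseSupp)) : β = 0 := by
  classical
  rw [mem_closure_iff] at h h'
  obtain ⟨n, hn⟩ := h
  obtain ⟨m, hm⟩ := h'
  have := sum_injective B (a := fun i => ((n i + m i : ℕ) : ℂ)) (b := 0) (by
    simp only [Nat.cast_add, add_smul, Finset.sum_add_distrib, ← hn, ← hm]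
    simp)
  rw [hn]
  refine Finset.sum_eq_zero fun i _ => ?_
  have h1 := congrFun this i
  simp only [Pi.zero_apply, Nat.cast_eq_zero] at h1
  have : n i = 0 := by omega
  simp [this]

/-- A simple reflection permutes the positive roots other than the simple root itself. -/
lemma simpleRefl_root_pos {i : ι} {x : H.root} (hx : x ≠ B.baseSupp' i)
    (h : (rootSystem H).root x ∈ AddSubmonoid.closure (Set.range B.baseSupp)) :
    simpleRefl B i ((rootSystem H).root x) ∈ AddSubmonoid.closure (Set.range B.baseSupp) := by
  classical
  by_contra hcon
  have h1 := root_pos_or_neg B ((rootSystem H).reflectionPerm (B.baseSupp' i) x)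
  rw [root_reflectionPerm] at h1
  have h2 := h1.resolve_left hcon
  rw [simpleRefl_apply, neg_sub] at h2
  rw [mem_closure_iff] at h h2
  obtain ⟨n, hn⟩ := h
  obtain ⟨m, hm⟩ := h2
  -- all coefficients of the root other than the one at `i` vanish
  have h3 := sum_injective B (a := fun j => ((m j + n j : ℕ) : ℂ))
    (b := Pi.single i ((rootSystem H).root x (B.h' i))) (by
    simp only [Nat.cast_add, add_smul, Finset.sum_add_distrib, ← hn, ← hm]
    rw [sub_add_cancel, Finset.sum_eq_single i]
    · simp
    · intro j _ hj; simp [hj]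
    · simp)
  have h4 : (rootSystem H).root x = (n i : ℂ) • (rootSystem H).root (B.baseSupp' i) := by
    rw [hn, Finset.sum_eq_single i]
    · rfl
    · intro j _ hj
      have := congrFun h3 j
      rw [Pi.single_eq_of_ne hj, Nat.cast_eq_zero] at this
      have : n j = 0 := by omega
      simp [this]
    · simp
  have h5 : ¬ LinearIndependent ℂ ![(rootSystem H).root x, (rootSystem H).root (B.baseSupp' i)] := by
    intro hli
    rw [LinearIndependent.pair_iff] at hli
    have := (hli 1 (-(n i : ℂ)) (by rw [h4]; simp)).1
    exact one_ne_zero this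
  rcases RootPairing.IsReduced.eq_or_eq_neg x (B.baseSupp' i) h5 with h6 | h6
  · exact hx (by rw [(rootSystem H).root.injective h6])
  · refine (rootSystem H).ne_zero x (eq_zero_of_mem_closure B ((mem_closure_iff B _).2 ⟨n, hn⟩) ?_)
    rw [h6, neg_neg, root_baseSupp']
    exact AddSubmonoid.subset_closure ⟨i, rfl⟩

/-- The longest element of the Weyl group, which takes all simple roots to negative roots. It
minimizes the number of positive roots that stay positive. -/
lemma exists_longest : ∃ g ∈ weyl B, ∀ i,
    -(g (B.baseSupp i)) ∈ AddSubmonoid.closure (Set.range B.baseSupp) := by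
  classical
  let C := AddSubmonoid.closure (Set.range B.baseSupp)
  let S : (Dual ℂ H ≃ₗ[ℂ] Dual ℂ H) → Set H.root := fun g =>
    {x | (rootSystem H).root x ∈ C ∧ g ((rootSystem H).root x) ∈ C}
  obtain ⟨g, hg, hmin⟩ := WellFounded.has_min (measure fun g => (S g).ncard).wf
    {g | g ∈ weyl B} ⟨1, (weyl B).one_mem⟩
  refine ⟨g, hg, fun i => ?_⟩
  obtain ⟨y, hy⟩ := exists_root_of_mem_weyl B hg (B.baseSupp' i)
  rw [root_baseSupp'] at hy
  refine (hy ▸ root_pos_or_neg B y).resolve_left fun hpos => ?_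
  refine hmin (g * simpleRefl B i) ((weyl B).mul_mem hg (simpleRefl_mem B i)) ?_
  change (S (g * simpleRefl B i)).ncard < (S g).ncard
  have hmem : B.baseSupp' i ∈ S g := ⟨AddSubmonoid.subset_closure ⟨i, rfl⟩, hpos⟩
  refine lt_of_le_of_lt ?_ (Set.ncard_sdiff_singleton_lt_of_mem hmem (Set.toFinite _))
  have hsi : simpleRefl B i (B.baseSupp i) = -B.baseSupp i := by
    have : IsAddTorsionFree L := .of_isTorsionFree ℂ L
    rw [simpleRefl_apply, B.baseSupp_apply_h', B.A_diag_eq_two]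
    module
  refine Set.ncard_le_ncard_of_injOn ((rootSystem H).reflectionPerm (B.baseSupp' i)) ?_
    ((Equiv.injective _).injOn) (Set.toFinite _)
  rintro x ⟨hx1, hx2⟩
  have hxi : x ≠ B.baseSupp' i := by
    rintro rfl
    rw [root_baseSupp'] at hx2
    change g (simpleRefl B i (B.baseSupp i)) ∈ C at hx2
    rw [hsi, map_neg] at hx2
    have := eq_zero_of_mem_closure B hpos hx2
    rw [hy] at this
    exact (rootSystem H).ne_zero y this
  refine ⟨⟨?_, ?_⟩, ?_⟩
  · rw [root_reflectionPerm]
    exact simpleRefl_root_pos B hxi hx1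
  · rw [root_reflectionPerm]
    exact hx2
  · intro h
    have h1 := root_reflectionPerm B i x
    rw [show (rootSystem H).reflectionPerm (B.baseSupp' i) x = B.baseSupp' i from h,
      root_baseSupp', simpleRefl_apply] at h1
    have h2 : simpleRefl B i (B.baseSupp i) = (rootSystem H).root x := by
      rw [show B.baseSupp i = simpleRefl B i ((rootSystem H).root x) from h1]
      exact LinearEquiv.congr_fun (refl_mul_self _ _) _
    rw [hsi] at h2
    refine (rootSystem H).ne_zero x (eq_zero_of_mem_closure B hx1 ?_)
    rw [← h2, neg_neg]
    exact AddSubmonoid.subset_closure ⟨i, rfl⟩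

variable [DecidableEq ι] {lam : Dual ℂ H} {l : ι → ℤ}

/-- The order generated by the positive reflections is the componentwise order of coordinates. -/
lemma reflLE_posPairs_iff (hA : IsDynkin B.A) (hlam : IsMinuscule B lam)
    (hl : ∀ i, lam (B.h' i) = l i) (μ μ' : orbit (weyl B) lam) :
    reflLE (posPairs B) _ μ μ' ↔ (orbitEquiv B hl μ).1 ≤ (orbitEquiv B hl μ').1 := by
  have hO := isMinusculeOrbit B hA hlam hl
  constructor
  · intro h
    induction h with
    | refl => exact le_rfl
    | @tail ν ν' _ h ih =>
      obtain ⟨r, ⟨hr, -⟩, hpos, h⟩ := h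
      obtain ⟨n, hn⟩ := (mem_closure_iff B _).1 hr
      refine ih.trans (le_of_wt_eq B (lam := lam) hpos (n := n) ?_)
      rw [wt_orbitEquiv, wt_orbitEquiv, h, hn]
  · intro h
    have h1 := hO.exists_path hA (orbitEquiv B hl μ).2 (orbitEquiv B hl μ').2 h
    obtain ⟨d, hd⟩ : ∃ d, d = (orbitEquiv B hl μ').1 := ⟨_, rfl⟩
    rw [← hd] at h1
    induction h1 generalizing μ' with
    | refl =>
      have : μ = μ' := (orbitEquiv B hl).injective (Subtype.ext hd)
      rw [this]
      exact .refl
    | @tail b d hb hbd ih =>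
      obtain ⟨hbO, hdO, i, rfl⟩ := hbd
      let ν := (orbitEquiv B hl).symm ⟨b, hbO⟩
      have hν : orbitEquiv B hl ν = ⟨b, hbO⟩ := (orbitEquiv B hl).apply_symm_apply _
      have hv := hO.val_eq_one_of_add_mem hA hbO hdO
      have hw : ν.1 = wt B lam b := by rw [← wt_orbitEquiv B hl, hν]
      refine (ih ν ?_ (by rw [hν])).tail ⟨_, simplePairs_subset_posPairs B ⟨i, rfl⟩, ?_, ?_⟩
      · rw [hν]; exact IsMinusculeSet.le_of_path hb
      · rw [hw, wt_apply B hl, hv]; simp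
      · have := simpleRefl_wt B hl b i
        rw [hv, hd, wt_orbitEquiv, ← hw] at this
        exact this.symm

/-- The longest element reverses the order of the orbit. -/
lemma exists_antitone (hl : ∀ i, lam (B.h' i) = l i) :
    ∃ ψ : reach B.A l ≃ reach B.A l, ∀ c d, c.1 ≤ d.1 ↔ (ψ d).1 ≤ (ψ c).1 := by
  obtain ⟨g, hg, hneg⟩ := exists_longest B
  let C := AddSubmonoid.closure (Set.range B.baseSupp)
  have hC : ∀ β ∈ C, -(g β) ∈ C := by
    intro β hβ
    induction hβ using AddSubmonoid.closure_induction with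
    | mem x hx => obtain ⟨i, rfl⟩ := hx; exact hneg i
    | zero => simp
    | add x y _ _ hx hy => rw [map_add, neg_add]; exact add_mem hx hy
  have hCs : ∀ β ∈ C, -(g.symm β) ∈ C := by
    intro β hβ
    induction hβ using AddSubmonoid.closure_induction with
    | mem x hx =>
      obtain ⟨i, rfl⟩ := hx
      obtain ⟨y, hy⟩ := exists_root_of_mem_weyl B ((weyl B).inv_mem hg) (B.baseSupp' i)
      change g.symm (B.baseSupp i) = _ at hy
      rw [hy]
      refine (root_pos_or_neg B y).resolve_left fun h => ?_
      have h1 := hC _ h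
      rw [← hy, g.apply_symm_apply] at h1
      have := eq_zero_of_mem_closure B (AddSubmonoid.subset_closure ⟨i, rfl⟩) h1
      exact B.linearIndependent_baseSupp.ne_zero i this
    | zero => simp
    | add x y _ _ hx hy => rw [map_add, neg_add]; exact add_mem hx hy
  have hle : ∀ c d : ι → ℤ, c ≤ d ↔ wt B lam c - wt B lam d ∈ C := by
    intro c d
    rw [wt_sub_wt, mem_closure_iff]
    constructor
    · intro h
      refine ⟨fun i => (d i - c i).toNat, ?_⟩
      refine Finset.sum_congr rfl fun i _ => ?_
      have : ((d i - c i).toNat : ℤ) = d i - c i := Int.toNat_of_nonneg (sub_nonneg.2 (h i))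
      have h1 : (((d i - c i).toNat : ℕ) : ℂ) = ((d i - c i : ℤ) : ℂ) := by
        exact_mod_cast congrArg (Int.cast : ℤ → ℂ) this
      rw [h1]
    · rintro ⟨n, hn⟩ i
      have := congrFun (sum_injective B hn) i
      have : d i - c i = n i := by exact_mod_cast this
      exact sub_nonneg.1 (this ▸ Int.natCast_nonneg _)
  let e : orbit (weyl B) lam ≃ orbit (weyl B) lam :=
    { toFun := fun μ => ⟨g μ.1, map_mem_orbit hg μ.2⟩
      invFun := fun μ => ⟨g.symm μ.1, map_mem_orbit ((weyl B).inv_mem hg) μ.2⟩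
      left_inv := fun μ => Subtype.ext (g.symm_apply_apply _)
      right_inv := fun μ => Subtype.ext (g.apply_symm_apply _) }
  refine ⟨((orbitEquiv B hl).symm.trans e).trans (orbitEquiv B hl), fun c d => ?_⟩
  have hw : ∀ c : reach B.A l, wt B lam
      ((((orbitEquiv B hl).symm.trans e).trans (orbitEquiv B hl)) c).1 = g (wt B lam c) := by
    intro c
    simp only [Equiv.trans_apply, wt_orbitEquiv]
    rfl
  rw [hle, hle, hw, hw, ← map_sub]
  constructor
  · intro h
    have := hC _ h
    rwa [← map_neg, neg_sub] at this
  · intro h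
    have := hCs _ h
    rwa [g.symm_apply_apply, neg_sub] at this

end Roots

/-! ### The colored poset of a minuscule weight and the isomorphism `f` -/

section LabelEquiv

variable {ι : Type*} {P : Type*} [PartialOrder P] {O : Set (ι → ℤ)} {κ : P → ι}

/-- The isomorphism between the labelling set and the lattice of filters. -/
def IsLabelled.equiv (hL : IsLabelled O κ) : O ≃ Filt P :=
  (Equiv.ofBijective (fun F : Filt P => (⟨cnt κ F.1, hL.mem _ F.2⟩ : O))
    ⟨fun F G h => Subtype.ext <|
      have h' : cnt κ F.1 = cnt κ G.1 := congrArg Subtype.val h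
      Set.Subset.antisymm (hL.sub _ _ F.2 G.2 h'.le) (hL.sub _ _ G.2 F.2 h'.ge), fun c =>
      let ⟨F, hF, h⟩ := hL.surj c.1 c.2
      ⟨⟨F, hF⟩, Subtype.ext h⟩⟩).symm

lemma IsLabelled.cnt_equiv (hL : IsLabelled O κ) (c : O) : cnt κ (hL.equiv c).1 = c.1 :=
  congrArg Subtype.val (hL.equiv.symm_apply_apply c)

lemma IsLabelled.le_iff (hL : IsLabelled O κ) {F G : Filt P} : F ≤ G ↔ cnt κ F.1 ≤ cnt κ G.1 :=
  have := hL.finite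
  ⟨fun h => cnt_mono κ h, fun h => hL.sub _ _ F.2 G.2 h⟩

end LabelEquiv

section Colored

open LieAlgebra LieAlgebra.IsKilling

variable {L : Type*} [LieRing L] [LieAlgebra ℂ L] {H : LieSubalgebra ℂ L}
variable {ι : Type*} [Fintype ι] (B : LieAlgebra.Basis ι H)

lemma cartanBasis_apply (i : ι) : cartanBasis B i = B.h' i := by
  simp only [cartanBasis, Basis.map_apply]
  refine Subtype.ext ?_
  simp [LieAlgebra.Basis.h', Basis.span_apply]
  rfl

variable [DecidableEq ι] {lam : Dual ℂ H} {l : ι → ℤ}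

lemma eq_fundWeight_iff (hl : ∀ i, lam (B.h' i) = l i) (i : ι) :
    lam = fundWeight B i ↔ l = Pi.single i 1 := by
  have h1 : ∀ j, fundWeight B i (B.h' j) = ((Pi.single i 1 : ι → ℤ) j : ℂ) := fun j => by
    rw [← cartanBasis_apply, fundWeight, Basis.coord_apply, Basis.repr_self]
    by_cases h : j = i
    · subst h; simp
    · rw [Finsupp.single_eq_of_ne (Ne.symm h), Pi.single_eq_of_ne h]; simp
  constructor
  · rintro rfl
    ext j
    have := h1 j
    rw [hl j] at this
    exact_mod_cast this
  · rintro rfl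
    refine (cartanBasis B).ext fun j => ?_
    rw [cartanBasis_apply, hl, h1]

lemma exists_eq_single (hA : IsDynkin B.A) (hlam : IsMinuscule B lam)
    (hl : ∀ i, lam (B.h' i) = l i) (h0 : lam ≠ 0) : ∃ i, l = Pi.single i 1 := by
  have hO := isMinusculeOrbit B hA hlam hl
  by_contra! hcon
  refine h0 ((cartanBasis B).ext fun j => ?_)
  rw [cartanBasis_apply, hl, LinearMap.zero_apply, Int.cast_eq_zero]
  by_contra hj
  exact hcon j (hO.eq_single hA hj)

variable [FiniteDimensional ℂ L] [IsKilling ℂ L] [H.IsCartanSubalgebra]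

lemma IsColoredMinusculePoset.isLabelled (hA : IsDynkin B.A) (hlam : IsMinuscule B lam)
    (hl : ∀ i, lam (B.h' i) = l i) {P : Type*} [PartialOrder P] {κ : P → ι}
    (h : IsColoredMinusculePoset B lam P κ) : IsLabelled (reach B.A l) κ := by
  have hO := isMinusculeOrbit B hA hlam hl
  obtain ⟨φ, hφ⟩ := h.orbitIso
  obtain ⟨κ', hL, -⟩ := hO.exists_isLabelled hA (finite_reach B hO) ((orbitEquiv B hl).symm.trans φ)
    (fun a b => by
      simp only [Equiv.trans_apply]
      rw [← hφ, reflLE_posPairs_iff B hA hlam hl, Equiv.apply_symm_apply, Equiv.apply_symm_apply])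
  obtain ⟨m, hm, hmi⟩ := h.top
  exact hL.of_coloring hA ((eq_fundWeight_iff B hl _).1 hmi) hO h.topTree_bij h.topTree_adj h.ends
    hm rfl

lemma exists_isColoredMinusculePoset (hA : IsDynkin B.A) (hlam : IsMinuscule B lam)
    (hl : ∀ i, lam (B.h' i) = l i) (h0 : lam ≠ 0) :
    ∃ (P : Type) (_ : PartialOrder P) (κ : P → ι), IsColoredMinusculePoset B lam P κ := by
  have hO := isMinusculeOrbit B hA hlam hl
  have hfin := finite_reach B hO
  obtain ⟨i, hi⟩ := exists_eq_single B hA hlam hl h0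
  obtain ⟨P, _, φ, hφ⟩ := hO.exists_poset hA hfin
  obtain ⟨κ, hL, -⟩ := hO.exists_isLabelled hA hfin φ hφ
  have hH := hL.isHeap hA hO
  obtain ⟨m, hm, hmi⟩ := hL.exists_top hA hO hi
  have hfinP := hL.finite
  refine ⟨P, inferInstance, κ, ?_⟩
  exact
    { dComplete := hH.isDComplete hA
      connected := hasse_connected hm
      selfDual := by
        obtain ⟨ψ, hψ⟩ := exists_antitone B hl
        refine selfDual_of_antitone ((φ.symm.trans ψ).trans φ) fun F G => ?_
        simp only [Equiv.trans_apply]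
        rw [← hφ, ← hψ, hφ, φ.apply_symm_apply, φ.apply_symm_apply]
      orbitIso := ⟨(orbitEquiv B hl).trans φ, fun μ μ' => by
        rw [reflLE_posPairs_iff B hA hlam hl, hφ]; rfl⟩
      topTree_bij := hH.topTree_bijOn hA (hL.surjective hA hO hi)
      topTree_adj := fun x y => by
        rw [hH.topTree_adj hA]
        constructor
        · intro h
          exact ⟨IsHeap.ne_of_adj hA h, by rw [h]; decide⟩
        · rintro ⟨h1, h2⟩
          exact (hA.off _ _ h1).resolve_left h2
      ends := fun k x y h => hH.ends hA h
      top := ⟨m, hm, (eq_fundWeight_iff B hl _).2 (hmi ▸ hi)⟩ }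

/-- The isomorphism `f` between the orbit and the lattice of filters. -/
def coloredIso (hl : ∀ i, lam (B.h' i) = l i) {P : Type*} [PartialOrder P] {κ : P → ι}
    (hL : IsLabelled (reach B.A l) κ) : orbit (weyl B) lam ≃ Filt P :=
  (orbitEquiv B hl).trans hL.equiv

lemma cnt_coloredIso (hl : ∀ i, lam (B.h' i) = l i) {P : Type*} [PartialOrder P] {κ : P → ι}
    (hL : IsLabelled (reach B.A l) κ) (μ : orbit (weyl B) lam) :
    cnt κ (coloredIso B hl hL μ).1 = (orbitEquiv B hl μ).1 := hL.cnt_equiv _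

lemma isColoredIso_coloredIso (hA : IsDynkin B.A) (hlam : IsMinuscule B lam)
    (hl : ∀ i, lam (B.h' i) = l i) {P : Type*} [PartialOrder P] {κ : P → ι}
    (hL : IsLabelled (reach B.A l) κ) : IsColoredIso B lam κ (coloredIso B hl hL) := by
  have hO := isMinusculeOrbit B hA hlam hl
  refine ⟨fun μ μ' => ?_, fun i μ μ' h => ?_⟩
  · rw [reflLE_posPairs_iff B hA hlam hl, hL.le_iff, cnt_coloredIso, cnt_coloredIso]
  · refine (hL.filtS_eq hA hO.1 ?_).symm
    rw [cnt_coloredIso, cnt_coloredIso]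
    refine orbitEquiv_eq B hl ?_
    rw [← simpleRefl_wt B hl, wt_orbitEquiv, h]
    rfl

lemma isColoredIso_unique (hA : IsDynkin B.A) (hlam : IsMinuscule B lam)
    (hl : ∀ i, lam (B.h' i) = l i) {P : Type*} [PartialOrder P] {κ : P → ι}
    {f g : orbit (weyl B) lam ≃ Filt P} (hf : IsColoredIso B lam κ f)
    (hg : IsColoredIso B lam κ g) : f = g := by
  have hO := isMinusculeOrbit B hA hlam hl
  have hbot : ∀ f : orbit (weyl B) lam ≃ Filt P, IsColoredIso B lam κ f →
      f ⟨lam, mem_orbit_self _ _⟩ = ⟨∅, isUpperSet_empty⟩ := by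
    intro f hf
    refine le_antisymm ?_ (Set.empty_subset _)
    rw [← f.apply_symm_apply (⟨∅, isUpperSet_empty⟩ : Filt P), ← hf.1,
      reflLE_posPairs_iff B hA hlam hl, orbitEquiv_eq B hl (c := 0) (wt_zero B)]
    exact hO.nonneg _ (orbitEquiv B hl _).2
  have key : ∀ c ∈ reach B.A l, ∀ μ : orbit (weyl B) lam, wt B lam c = μ.1 → f μ = g μ := by
    intro c hc
    induction hc with
    | refl =>
      intro μ hμ
      have : μ = ⟨lam, mem_orbit_self _ _⟩ := Subtype.ext (by rw [← hμ, wt_zero])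
      rw [this, hbot f hf, hbot g hg]
    | @tail b c hb hbc ih =>
      rintro μ hμ
      obtain ⟨i, rfl⟩ := hbc
      let ν : orbit (weyl B) lam := ⟨wt B lam b, (wt_mem_orbit_iff B hl _).2 ⟨b, hb, rfl⟩⟩
      have h1 : μ.1 = ν.1 - ν.1 (B.h' i) • B.baseSupp i := by
        rw [← hμ, ← simpleRefl_wt B hl]; rfl
      rw [hf.2 i ν μ h1, hg.2 i ν μ h1, ih ν rfl]
  ext1 μ
  exact key _ (orbitEquiv B hl μ).2 μ (wt_orbitEquiv B hl μ)

end Colored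

/-! ### Folding of integer vectors -/

section FoldSum

variable {ι : Type*} [Fintype ι] (σ : Equiv.Perm ι) (p : FoldIndex σ)

open Classical in
/-- The sum over the orbit `p` of `σ`. -/
def foldSum {M : Type*} [AddCommMonoid M] (f : ι → M) : M := ∑ i with toFold σ i = p, f i

variable {σ p}

lemma toFold_eq_iff {i j : ι} : toFold σ i = toFold σ j ↔ σ.SameCycle i j := Quotient.eq

lemma toFold_apply (i : ι) : toFold σ (σ i) = toFold σ i :=
  toFold_eq_iff.2 (Equiv.Perm.sameCycle_apply_left.2 (Equiv.Perm.SameCycle.refl σ i))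

variable {M : Type*} [AddCommMonoid M]

lemma foldSum_congr {f g : ι → M} (h : ∀ i, toFold σ i = p → f i = g i) :
    foldSum σ p f = foldSum σ p g := by
  classical
  exact Finset.sum_congr rfl fun i hi => h i (Finset.mem_filter.1 hi).2

lemma foldSum_eq_single {f : ι → M} {i : ι} (hi : toFold σ i = p)
    (h : ∀ j, toFold σ j = p → j ≠ i → f j = 0) : foldSum σ p f = f i := by
  classical
  exact Finset.sum_eq_single i (fun j hj hji => h j (Finset.mem_filter.1 hj).2 hji)
    fun h' => absurd (Finset.mem_filter.2 ⟨Finset.mem_univ i, hi⟩) h'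

lemma foldSum_eq_pair {f : ι → M} {i j : ι} (hij : i ≠ j)
    (h : ∀ k, toFold σ k = p ↔ k = i ∨ k = j) : foldSum σ p f = f i + f j := by
  classical
  rw [foldSum, ← Finset.sum_pair hij]
  refine Finset.sum_congr ?_ fun _ _ => rfl
  ext k
  simp [h]

lemma map_foldSum {N F : Type*} [AddCommMonoid N] [FunLike F M N] [AddMonoidHomClass F M N]
    (g : F) (f : ι → M) : g (foldSum σ p f) = foldSum σ p fun i => g (f i) := map_sum g _ _

lemma foldSum_nonneg {f : ι → ℤ} (h : ∀ i, toFold σ i = p → 0 ≤ f i) : 0 ≤ foldSum σ p f := by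
  classical
  exact Finset.sum_nonneg fun i hi => h i (Finset.mem_filter.1 hi).2

lemma eq_zero_of_foldSum {f : ι → ℤ} (h : ∀ i, toFold σ i = p → 0 ≤ f i)
    (h0 : foldSum σ p f ≤ 0) {i : ι} (hi : toFold σ i = p) : f i = 0 := by
  classical
  exact (Finset.sum_eq_zero_iff_of_nonneg fun i hi => h i (Finset.mem_filter.1 hi).2).1
    (le_antisymm h0 (foldSum_nonneg h)) i (Finset.mem_filter.2 ⟨Finset.mem_univ i, hi⟩)

lemma foldSum_neg (f : ι → ℤ) : foldSum σ p (fun i => -f i) = -foldSum σ p f := by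
  classical
  exact Finset.sum_neg_distrib ..

open Classical in
lemma foldSum_eq_sum (f : ι → M) : foldSum σ p f = ∑ i, if toFold σ i = p then f i else 0 :=
  Finset.sum_filter _ _

end FoldSum

section FoldStep

variable {ι : Type*} (A : Matrix ι ι ℤ) (σ : Equiv.Perm ι)

/-- The vertices of the orbit `p` are pairwise not adjacent. -/
def Orth (p : FoldIndex σ) : Prop :=
  ∀ i j, toFold σ i = p → toFold σ j = p → i ≠ j → A i j = 0

/-- The orbit `p` consists of two adjacent vertices. -/
def IsPair (p : FoldIndex σ) (i j : ι) : Prop :=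
  A i j = -1 ∧ ∀ k, toFold σ k = p ↔ k = i ∨ k = j

variable {A σ} {p : FoldIndex σ} {i j : ι} [Fintype ι]

lemma IsPair.ne (hA : IsDynkin A) (h : IsPair A σ p i j) : i ≠ j := IsHeap.ne_of_adj hA h.1

lemma IsPair.not_orth (hA : IsDynkin A) (h : IsPair A σ p i j) : ¬ Orth A σ p := fun ho => by
  have := ho i j ((h.2 i).2 (.inl rfl)) ((h.2 j).2 (.inr rfl)) (h.ne hA)
  rw [h.1] at this
  omega

/-- Both kinds of orbits of a diagram automorphism. -/
lemma orth_or_pair (hA : IsDynkin A) (hA' : IsTypeADE6 A) (hσ : ∀ i j, A (σ i) (σ j) = A i j)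
    (p : FoldIndex σ) : Orth A σ p ∨ ∃ i j, IsPair A σ p i j := by
  by_cases h : Orth A σ p
  · exact .inl h
  right
  unfold Orth at h
  push Not at h
  obtain ⟨i, j, hi, hj, hij, h⟩ := h
  have hadj := (hA.off i j hij).resolve_left h
  have hc : σ.SameCycle i j := toFold_eq_iff.1 (hi.trans hj.symm)
  refine ⟨i, j, hadj, fun k => ⟨fun hk => ?_, ?_⟩⟩
  · exact hA'.orbit_eq_pair σ hσ hadj hc k (toFold_eq_iff.1 (hi.trans hk.symm))
  · rintro (rfl | rfl)
    exacts [hi, hj]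

variable (A σ)

open Classical in
/-- The multiple of `α_i`, `i ∈ p`, that the folded reflection `w_p` subtracts from a weight with
values `v` on the simple coroots. -/
def foldMult {M : Type*} [AddCommMonoid M] (p : FoldIndex σ) (v : ι → M) (i : ι) : M :=
  if Orth A σ p then v i else foldSum σ p v

lemma foldMult_orth {M : Type*} [AddCommMonoid M] (h : Orth A σ p) (v : ι → M) (i : ι) :
    foldMult A σ p v i = v i := if_pos h

lemma foldMult_pair {M : Type*} [AddCommMonoid M] (hA : IsDynkin A) (h : IsPair A σ p i j)
    (v : ι → M) (k : ι) : foldMult A σ p v k = v i + v j := by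
  rw [foldMult, if_neg (h.not_orth hA), foldSum_eq_pair (h.ne hA) h.2]

variable (l : ι → ℤ)

open Classical in
/-- The reflection `w_p`, on coordinate vectors. -/
def foldStep (p : FoldIndex σ) (c : ι → ℤ) (i : ι) : ℤ :=
  c i + if toFold σ i = p then foldMult A σ p (val A l c) i else 0

/-- The sum over `p` of the values of a weight on the simple coroots. -/
def tot (p : FoldIndex σ) (c : ι → ℤ) : ℤ := foldSum σ p (val A l c)

variable {A σ l}

lemma foldStep_of_mem {c : ι → ℤ} (hi : toFold σ i = p) :
    foldStep A σ l p c i = c i + foldMult A σ p (val A l c) i := by simp [foldStep, hi]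

lemma foldStep_of_not_mem {c : ι → ℤ} (hi : toFold σ i ≠ p) :
    foldStep A σ l p c i = c i := by simp [foldStep, hi]

lemma val_foldStep (c : ι → ℤ) (k : ι) : val A l (foldStep A σ l p c) k =
    val A l c k - foldSum σ p fun i => foldMult A σ p (val A l c) i * A i k := by
  have := val_sub_val (A := A) (l := l) c (foldStep A σ l p c) k
  have h2 : ∑ j, (foldStep A σ l p c j - c j) * A j k =
      foldSum σ p fun i => foldMult A σ p (val A l c) i * A i k := by
    rw [foldSum_eq_sum]
    refine Finset.sum_congr rfl fun i _ => ?_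
    by_cases hi : toFold σ i = p
    · simp [foldStep, hi]
    · simp [foldStep, hi]
  rw [h2] at this
  omega

lemma val_foldStep_orth (hA : IsDynkin A) (h : Orth A σ p) (c : ι → ℤ) (hi : toFold σ i = p) :
    val A l (foldStep A σ l p c) i = -val A l c i := by
  rw [val_foldStep, foldSum_eq_single hi, foldMult_orth A σ h, hA.diag]
  · ring
  · intro j hj hji
    rw [h j i hj hi hji, mul_zero]

lemma val_foldStep_pair (hA : IsDynkin A) (h : IsPair A σ p i j) (c : ι → ℤ) :
    val A l (foldStep A σ l p c) i = -val A l c j ∧ val A l (foldStep A σ l p c) j = -val A l c i := by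
  constructor
  · rw [val_foldStep, foldSum_eq_pair (h.ne hA) h.2, foldMult_pair A σ hA h, foldMult_pair A σ hA h,
      hA.diag, hA.symm j i, h.1]
    ring
  · rw [val_foldStep, foldSum_eq_pair (h.ne hA) h.2, foldMult_pair A σ hA h, foldMult_pair A σ hA h,
      hA.diag, h.1]
    ring

variable (hA : IsDynkin A) (hp : Orth A σ p ∨ ∃ i j, IsPair A σ p i j)
include hA hp

lemma tot_foldStep (c : ι → ℤ) : tot A σ l p (foldStep A σ l p c) = -tot A σ l p c := by
  unfold tot
  rcases hp with h | ⟨i, j, h⟩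
  · rw [← foldSum_neg]
    exact foldSum_congr fun i hi => val_foldStep_orth hA h c hi
  · rw [foldSum_eq_pair (h.ne hA) h.2, foldSum_eq_pair (h.ne hA) h.2, (val_foldStep_pair hA h c).1,
      (val_foldStep_pair hA h c).2]
    ring

lemma foldStep_foldStep (c : ι → ℤ) : foldStep A σ l p (foldStep A σ l p c) = c := by
  ext k
  by_cases hk : toFold σ k = p
  · rw [foldStep_of_mem hk, foldStep_of_mem hk]
    rcases hp with h | ⟨i, j, h⟩
    · rw [foldMult_orth A σ h, foldMult_orth A σ h, val_foldStep_orth hA h c hk]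
      ring
    · rw [foldMult_pair A σ hA h, foldMult_pair A σ hA h, (val_foldStep_pair hA h c).1,
        (val_foldStep_pair hA h c).2]
      ring
  · rw [foldStep_of_not_mem hk, foldStep_of_not_mem hk]

end FoldStep

section FoldSet

variable {ι : Type*} [Fintype ι] [DecidableEq ι]

/-- The coordinate vectors of the weights `w λ` with `w` commuting with `σ`: a subset of the
minuscule orbit that is closed under the folded reflections and whose elements have values of
constant sign on each orbit of `σ`. -/
structure IsFoldSet (A : Matrix ι ι ℤ) (l : ι → ℤ) (O : Set (ι → ℤ)) (σ : Equiv.Perm ι)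
    (C : Set (ι → ℤ)) : Prop where
  orbit : IsMinusculeOrbit A l O
  orth_or_pair : ∀ p, Orth A σ p ∨ ∃ i j, IsPair A σ p i j
  sub : C ⊆ O
  zero_mem : 0 ∈ C
  step : ∀ c ∈ C, ∀ p, foldStep A σ l p c ∈ C
  sign : ∀ c ∈ C, ∀ p, (∀ i, toFold σ i = p → 0 ≤ val A l c i) ∨
    ∀ i, toFold σ i = p → val A l c i ≤ 0

namespace IsFoldSet

variable {A : Matrix ι ι ℤ} {l : ι → ℤ} {O : Set (ι → ℤ)} {σ : Equiv.Perm ι} {C : Set (ι → ℤ)}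
  {c d : ι → ℤ} {p : FoldIndex σ} {i : ι}

lemma val_nonneg (hC : IsFoldSet A l O σ C) (hc : c ∈ C) (h : 0 ≤ tot A σ l p c)
    (hi : toFold σ i = p) : 0 ≤ val A l c i := by
  rcases hC.sign c hc p with h1 | h1
  · exact h1 i hi
  · have := eq_zero_of_foldSum (σ := σ) (p := p) (f := fun i => -val A l c i)
      (fun i hi => neg_nonneg.2 (h1 i hi)) (by rw [foldSum_neg]; exact neg_nonpos.2 h) hi
    omega

lemma val_nonpos (hC : IsFoldSet A l O σ C) (hc : c ∈ C) (h : tot A σ l p c ≤ 0)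
    (hi : toFold σ i = p) : val A l c i ≤ 0 := by
  rcases hC.sign c hc p with h1 | h1
  · exact (eq_zero_of_foldSum h1 h hi).le
  · exact h1 i hi

/-- On an orbit of two adjacent vertices the two values cannot both be nonzero of the same sign. -/
lemma pair_bound (hC : IsFoldSet A l O σ C) (hc : c ∈ C) {j : ι} (h : IsPair A σ p i j) :
    -1 ≤ val A l c i + val A l c j ∧ val A l c i + val A l c j ≤ 1 := by
  have hO := hC.orbit.1
  have hcO := hC.sub hc
  have hi := hO.val_mem c hcO i
  have hj := hO.val_mem c hcO j
  constructor
  · by_contra hcon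
    have h1 : val A l c i = -1 := by omega
    have h2 : val A l c j = -1 := by omega
    have h3 := hO.val_mem _ (hO.step c hcO i) j
    rw [val_add_single, h1, h2, h.1] at h3
    omega
  · by_contra hcon
    have h1 : val A l c i = 1 := by omega
    have h2 : val A l c j = 1 := by omega
    have h3 := hO.val_mem _ (hO.step c hcO i) j
    rw [val_add_single, h1, h2, h.1] at h3
    omega

lemma foldMult_nonneg (hA : IsDynkin A) (hC : IsFoldSet A l O σ C) (hc : c ∈ C)
    (h : 0 ≤ tot A σ l p c) (hi : toFold σ i = p) : 0 ≤ foldMult A σ p (val A l c) i := by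
  rcases hC.orth_or_pair p with h1 | ⟨a, b, h1⟩
  · rw [foldMult_orth A σ h1]
    exact hC.val_nonneg hc h hi
  · rw [foldMult_pair A σ hA h1]
    exact add_nonneg (hC.val_nonneg hc h ((h1.2 a).2 (.inl rfl)))
      (hC.val_nonneg hc h ((h1.2 b).2 (.inr rfl)))

lemma foldMult_nonpos (hA : IsDynkin A) (hC : IsFoldSet A l O σ C) (hc : c ∈ C)
    (h : tot A σ l p c ≤ 0) (hi : toFold σ i = p) : foldMult A σ p (val A l c) i ≤ 0 := by
  rcases hC.orth_or_pair p with h1 | ⟨a, b, h1⟩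
  · rw [foldMult_orth A σ h1]
    exact hC.val_nonpos hc h hi
  · rw [foldMult_pair A σ hA h1]
    exact add_nonpos (hC.val_nonpos hc h ((h1.2 a).2 (.inl rfl)))
      (hC.val_nonpos hc h ((h1.2 b).2 (.inr rfl)))

lemma le_foldStep (hA : IsDynkin A) (hC : IsFoldSet A l O σ C) (hc : c ∈ C)
    (h : 0 ≤ tot A σ l p c) : c ≤ foldStep A σ l p c := fun i => by
  by_cases hi : toFold σ i = p
  · rw [foldStep_of_mem hi]
    exact le_add_of_nonneg_right (hC.foldMult_nonneg hA hc h hi)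
  · rw [foldStep_of_not_mem hi]

lemma foldStep_le (hA : IsDynkin A) (hC : IsFoldSet A l O σ C) (hc : c ∈ C)
    (h : tot A σ l p c ≤ 0) : foldStep A σ l p c ≤ c := fun i => by
  by_cases hi : toFold σ i = p
  · rw [foldStep_of_mem hi]
    exact add_le_of_nonpos_right (hC.foldMult_nonpos hA hc h hi)
  · rw [foldStep_of_not_mem hi]

lemma foldStep_ne (hA : IsDynkin A) (hC : IsFoldSet A l O σ C) (h : tot A σ l p c ≠ 0) :
    foldStep A σ l p c ≠ c := fun h' => by
  have := tot_foldStep hA (hC.orth_or_pair p) (l := l) c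
  rw [h'] at this
  omega

lemma sum_foldStep_lt (hA : IsDynkin A) (hC : IsFoldSet A l O σ C) (hc : c ∈ C)
    (h : tot A σ l p c < 0) : ∑ i, foldStep A σ l p c i < ∑ i, c i := by
  have h1 := hC.foldStep_le hA hc h.le
  obtain ⟨i, hi⟩ := (Pi.lt_def.1 (lt_of_le_of_ne h1 (hC.foldStep_ne hA h.ne))).2
  exact Finset.sum_lt_sum (fun i _ => h1 i) ⟨i, Finset.mem_univ i, hi⟩

lemma exists_tot_neg (hA : IsDynkin A) (hC : IsFoldSet A l O σ C) (hc : c ∈ C) (h0 : c ≠ 0) :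
    ∃ i, tot A σ l (toFold σ i) c < 0 := by
  obtain ⟨i, hi⟩ := hC.orbit.exists_val_neg hA (hC.sub hc) h0
  refine ⟨i, ?_⟩
  by_contra! h
  have := hC.val_nonneg hc h rfl
  omega

/-- The difference of two comparable elements bounds the difference of their values. -/
lemma val_sub_le (hA : IsDynkin A) (hcd : c ≤ d) (i : ι) :
    val A l c i - val A l d i ≤ 2 * (d i - c i) := by
  rw [val_sub_val]
  exact hA.sum_le (n := d - c) (sub_nonneg.2 hcd) i

lemma val_sub_le_of_adj (hA : IsDynkin A) (hcd : c ≤ d) {i j : ι} (hij : A j i = -1) :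
    val A l c i - val A l d i ≤ 2 * (d i - c i) - (d j - c j) := by
  have hne : j ≠ i := IsHeap.ne_of_adj hA hij
  rw [val_sub_val, ← Finset.add_sum_erase _ _ (Finset.mem_univ i),
    ← Finset.add_sum_erase _ _ (Finset.mem_erase.2 ⟨hne, Finset.mem_univ j⟩), hA.diag, hij]
  have : ∑ k ∈ (Finset.univ.erase i).erase j, (d k - c k) * A k i ≤ 0 :=
    Finset.sum_nonpos fun k hk => mul_nonpos_of_nonneg_of_nonpos (sub_nonneg.2 (hcd k))
      (hA.apply_nonpos (Finset.ne_of_mem_erase (Finset.mem_of_mem_erase hk)))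
  linarith

/-- A folded reflection is monotone on pairs of vectors on which it moves in the same direction. -/
lemma foldStep_mono (hA : IsDynkin A) (hC : IsFoldSet A l O σ C) (hc : c ∈ C) (hd : d ∈ C)
    (hcd : c ≤ d) (h : (0 ≤ tot A σ l p c ∧ 0 ≤ tot A σ l p d) ∨
      (tot A σ l p c ≤ 0 ∧ tot A σ l p d ≤ 0)) : foldStep A σ l p c ≤ foldStep A σ l p d := by
  rw [Pi.le_def]
  intro k
  by_cases hk : toFold σ k = p
  · rw [foldStep_of_mem hk, foldStep_of_mem hk]
    rcases hC.orth_or_pair p with h1 | ⟨i, j, h1⟩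
    · rw [foldMult_orth A σ h1, foldMult_orth A σ h1]
      have h2 : (0 ≤ val A l c k ∧ 0 ≤ val A l d k) ∨ (val A l c k ≤ 0 ∧ val A l d k ≤ 0) := h.imp
        (fun h => ⟨hC.val_nonneg hc h.1 hk, hC.val_nonneg hd h.2 hk⟩)
        (fun h => ⟨hC.val_nonpos hc h.1 hk, hC.val_nonpos hd h.2 hk⟩)
      have h3 := val_sub_le hA hcd (l := l) k
      have h4 := hC.orbit.val_mem c (hC.sub hc) k
      have h5 := hC.orbit.val_mem d (hC.sub hd) k
      have h6 := hcd k
      omega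
    · rw [foldMult_pair A σ hA h1, foldMult_pair A σ hA h1]
      have hi := (h1.2 i).2 (.inl rfl)
      have hj := (h1.2 j).2 (.inr rfl)
      have h2 : (0 ≤ val A l c i ∧ 0 ≤ val A l c j ∧ 0 ≤ val A l d i ∧ 0 ≤ val A l d j) ∨
          (val A l c i ≤ 0 ∧ val A l c j ≤ 0 ∧ val A l d i ≤ 0 ∧ val A l d j ≤ 0) := h.imp
        (fun h => ⟨hC.val_nonneg hc h.1 hi, hC.val_nonneg hc h.1 hj, hC.val_nonneg hd h.2 hi,
          hC.val_nonneg hd h.2 hj⟩)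
        (fun h => ⟨hC.val_nonpos hc h.1 hi, hC.val_nonpos hc h.1 hj, hC.val_nonpos hd h.2 hi,
          hC.val_nonpos hd h.2 hj⟩)
      have h4 := val_sub_le_of_adj hA hcd (l := l) h1.1
      have h5 := val_sub_le_of_adj hA hcd (l := l) (hA.symm i j ▸ h1.1)
      have h6 := hC.pair_bound hc h1
      have h7 := hC.pair_bound hd h1
      have h8 := hcd i
      have h9 := hcd j
      rcases (h1.2 k).1 hk with rfl | rfl
      · omega
      · omega
  · rw [foldStep_of_not_mem hk, foldStep_of_not_mem hk]
    exact hcd k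

lemma le_foldStep_of_opposite (hA : IsDynkin A) (hC : IsFoldSet A l O σ C) (hc : c ∈ C)
    (hd : d ∈ C) (hcd : c ≤ d) (h : 0 ≤ tot A σ l p c) (h' : tot A σ l p d ≤ 0) :
    c ≤ foldStep A σ l p d := by
  rw [Pi.le_def]
  intro k
  by_cases hk : toFold σ k = p
  · rw [foldStep_of_mem hk]
    rcases hC.orth_or_pair p with h1 | ⟨i, j, h1⟩
    · rw [foldMult_orth A σ h1]
      have h3 := val_sub_le hA hcd (l := l) k
      have h4 := hC.val_nonneg hc h hk
      have h5 := hC.orbit.val_mem d (hC.sub hd) k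
      have h6 := hcd k
      omega
    · rw [foldMult_pair A σ hA h1]
      have hi := (h1.2 i).2 (.inl rfl)
      have hj := (h1.2 j).2 (.inr rfl)
      have h2 := hC.val_nonneg hc h hi
      have h2' := hC.val_nonneg hc h hj
      have h3 := hC.val_nonpos hd h' hi
      have h3' := hC.val_nonpos hd h' hj
      have h4 := val_sub_le_of_adj hA hcd (l := l) h1.1
      have h5 := val_sub_le_of_adj hA hcd (l := l) (hA.symm i j ▸ h1.1)
      have h7 := hC.pair_bound hd h1
      have h8 := hcd i
      have h9 := hcd j
      rcases (h1.2 k).1 hk with rfl | rfl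
      · omega
      · omega
  · rw [foldStep_of_not_mem hk]
    exact hcd k

/-- The involution `S_p` on filters is the folded reflection `w_p`. -/
lemma filtS_eq (hA : IsDynkin A) (hC : IsFoldSet A l O σ C) {P : Type*} [PartialOrder P]
    {κ : P → ι} (hL : IsLabelled O κ) {F G : Filt P} (hF : cnt κ F.1 ∈ C)
    (h : cnt κ G.1 = foldStep A σ l p (cnt κ F.1)) :
    filtS (fun x => toFold σ (κ x)) p F = G := by
  have hG : cnt κ G.1 ∈ C := h ▸ hC.step _ hF p
  have ht : tot A σ l p (cnt κ G.1) = -tot A σ l p (cnt κ F.1) := by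
    rw [h, tot_foldStep hA (hC.orth_or_pair p)]
  have hs : ∀ i, toFold σ i ≠ p → cnt κ F.1 i = cnt κ G.1 i := fun i hi => by
    rw [h, foldStep_of_not_mem hi]
  rcases le_total 0 (tot A σ l p (cnt κ F.1)) with h0 | h0
  · refine hL.filtS_eq_of_le (toFold σ) p hA hC.orbit.1 ?_ hs (fun i hi => ?_) fun i hi => ?_
    · rw [h]; exact hC.le_foldStep hA hF h0
    · have := hC.val_nonneg hF h0 hi
      omega
    · have := hC.val_nonpos hG (by omega) hi
      omega
  · refine hL.filtS_eq_of_ge (toFold σ) p hA hC.orbit.1 ?_ hs (fun i hi => ?_) fun i hi => ?_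
    · rw [h]; exact hC.foldStep_le hA hF h0
    · have := hC.val_nonpos hF h0 hi
      omega
    · have := hC.val_nonneg hG (by omega) hi
      omega

end IsFoldSet

end FoldSet

/-! ### The folded reflections and restriction to `h(0)` -/

section FoldLie

open LieAlgebra

lemma foldSum_comp {ι : Type*} [Fintype ι] {σ : Equiv.Perm ι} {p : FoldIndex σ} {M : Type*}
    [AddCommMonoid M] (f : ι → M) : foldSum σ p (fun i => f (σ i)) = foldSum σ p f := by
  classical
  rw [foldSum_eq_sum, foldSum_eq_sum, ← Equiv.sum_comp σ fun i => if toFold σ i = p then f i else 0]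
  simp only [toFold_apply]

lemma foldMult_map {ι : Type*} [Fintype ι] {A : Matrix ι ι ℤ} {σ : Equiv.Perm ι} {p : FoldIndex σ}
    {M N F : Type*} [AddCommMonoid M] [AddCommMonoid N] [FunLike F M N] [AddMonoidHomClass F M N]
    (g : F) (v : ι → M) (i : ι) :
    foldMult A σ p (fun j => g (v j)) i = g (foldMult A σ p v i) := by
  unfold foldMult
  split_ifs
  · rfl
  · rw [map_foldSum]

variable {L : Type*} [LieRing L] [LieAlgebra ℂ L] {H : LieSubalgebra ℂ L}
variable {ι : Type*} [Fintype ι] (B : LieAlgebra.Basis ι H) (σ : Equiv.Perm ι)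

variable {B} in
lemma dual_ext {μ ν : Dual ℂ H} (h : ∀ i, μ (B.h' i) = ν (B.h' i)) : μ = ν :=
  (cartanBasis B).ext fun i => by rw [cartanBasis_apply, h]

lemma sigmaH_h' (i : ι) : sigmaH B σ (B.h' i) = B.h' (σ i) := by
  rw [← cartanBasis_apply, ← cartanBasis_apply, sigmaH, Basis.equiv_apply]

lemma sigmaDual_apply (μ : Dual ℂ H) (h : H) : sigmaDual B σ μ (sigmaH B σ h) = μ h := by
  change μ ((sigmaH B σ).symm (sigmaH B σ h)) = _
  rw [LinearEquiv.symm_apply_apply]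

lemma sigmaDual_h' (μ : Dual ℂ H) (i : ι) : sigmaDual B σ μ (B.h' (σ i)) = μ (B.h' i) := by
  rw [← sigmaH_h', sigmaDual_apply]

lemma foldH_eq_orth {p : FoldIndex σ} (h : Orth B.A σ p) : foldH B σ p = foldSum σ p B.h' :=
  if_pos h

lemma foldH_eq_not_orth {p : FoldIndex σ} (h : ¬ Orth B.A σ p) :
    foldH B σ p = (2 : ℂ) • foldSum σ p B.h' := if_neg h

/-- The factor `1` or `2` in the definition of `H_p`. -/
def foldFactor (p : FoldIndex σ) : ℤ := open Classical in if Orth B.A σ p then 1 else 2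

lemma foldFactor_pos (p : FoldIndex σ) : 0 < foldFactor B σ p := by
  unfold foldFactor; split_ifs <;> norm_num

lemma apply_foldH (μ : Dual ℂ H) (p : FoldIndex σ) :
    μ (foldH B σ p) = foldFactor B σ p * foldSum σ p fun i => μ (B.h' i) := by
  by_cases h : Orth B.A σ p
  · rw [foldH_eq_orth B σ h, map_foldSum, foldFactor, if_pos h]; simp
  · rw [foldH_eq_not_orth B σ h, map_smul, map_foldSum, foldFactor, if_neg h]; simp

lemma sigmaH_foldH (p : FoldIndex σ) : sigmaH B σ (foldH B σ p) = foldH B σ p := by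
  have h : sigmaH B σ (foldSum σ p B.h') = foldSum σ p B.h' := by
    rw [map_foldSum, ← foldSum_comp B.h']
    simp only [sigmaH_h']
  by_cases ho : Orth B.A σ p
  · rw [foldH_eq_orth B σ ho, h]
  · rw [foldH_eq_not_orth B σ ho, map_smul, h]

lemma res_apply (μ : Dual ℂ H) (t : cartan0 B σ) : res B σ μ t = μ t := rfl

lemma res_foldH0 (μ : Dual ℂ H) (p : FoldIndex σ) :
    res B σ μ (foldH0 B σ p) = foldFactor B σ p * foldSum σ p fun i => μ (B.h' i) :=
  apply_foldH B σ μ p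

lemma sigmaH_cartan0 (t : cartan0 B σ) : sigmaH B σ t = t := by
  obtain ⟨x, hx⟩ := t
  change sigmaH B σ x = x
  induction hx using Submodule.span_induction with
  | mem x hx => obtain ⟨p, rfl⟩ := hx; exact sigmaH_foldH B σ p
  | zero => exact map_zero _
  | add x y _ _ h1 h2 => rw [map_add, h1, h2]
  | smul a x _ h1 => rw [map_smul, h1]

lemma res_sigmaDual (μ : Dual ℂ H) : res B σ (sigmaDual B σ μ) = res B σ μ := by
  ext t
  rw [res_apply, res_apply]
  conv_lhs => rw [← sigmaH_cartan0 B σ t]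
  rw [sigmaDual_apply]

variable (hσA : ∀ i j, B.A (σ i) (σ j) = B.A i j)
include hσA

lemma sigmaDual_baseSupp (i : ι) : sigmaDual B σ (B.baseSupp i) = B.baseSupp (σ i) := by
  refine dual_ext (B := B) fun j => ?_
  obtain ⟨k, rfl⟩ := σ.surjective j
  rw [sigmaDual_h', B.baseSupp_apply_h', B.baseSupp_apply_h', hσA]

lemma res_baseSupp_eq {i j : ι} (h : toFold σ i = toFold σ j) :
    res B σ (B.baseSupp i) = res B σ (B.baseSupp j) := by
  obtain ⟨n, hn⟩ := (toFold_eq_iff.1 h).exists_nat_pow_eq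
  have : ∀ n : ℕ, res B σ (B.baseSupp ((σ ^ n) i)) = res B σ (B.baseSupp i) := by
    intro n
    induction n with
    | zero => simp
    | succ n ih =>
      rw [pow_succ', Equiv.Perm.mul_apply, ← sigmaDual_baseSupp B σ hσA, res_sigmaDual, ih]
  rw [← hn, this]

variable (hA : IsDynkin B.A) (hp : ∀ p, Orth B.A σ p ∨ ∃ i j, IsPair B.A σ p i j)
include hA hp

lemma foldSimplePairs_two (i : ι) :
    res B σ (B.baseSupp i) (foldH0 B σ (toFold σ i)) = 2 := by
  rw [res_foldH0]
  simp only [B.baseSupp_apply_h']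
  rcases hp (toFold σ i) with h | ⟨a, b, h⟩
  · rw [foldFactor, if_pos h, foldSum_eq_single (i := i) rfl, hA.diag]
    · simp
    · intro j hj hji
      rw [h i j rfl hj hji.symm]; simp
  · rw [foldFactor, if_neg (h.not_orth hA), foldSum_eq_pair (h.ne hA) h.2]
    rcases (h.2 i).1 rfl with rfl | rfl
    · rw [hA.diag, h.1]; norm_num
    · rw [hA.diag, hA.symm, h.1]; norm_num

lemma foldSimplePairs_two' : ∀ r ∈ foldSimplePairs B σ, r.1 r.2 = 2 := by
  rintro _ ⟨i, rfl⟩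
  exact foldSimplePairs_two B σ hσA hA hp i

omit hσA in
/-- The folded reflection `w_p` as an element of the Weyl group of `g`. -/
lemma exists_foldRefl (p : FoldIndex σ) : ∃ g ∈ weyl B, ∀ ν, g ν = ν -
    foldSum σ p fun i => foldMult B.A σ p (fun j => ν (B.h' j)) i • B.baseSupp i := by
  classical
  rcases hp p with h | ⟨i, j, h⟩
  · -- the simple reflections in pairwise orthogonal simple roots multiply to this
    have key : ∀ s : Finset ι, (∀ i ∈ s, toFold σ i = p) → ∃ g ∈ weyl B, ∀ ν : Dual ℂ H, g ν = ν -
        ∑ i ∈ s, ν (B.h' i) • B.baseSupp i := by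
      intro s
      induction s using Finset.induction_on with
      | empty => exact fun _ => ⟨1, (weyl B).one_mem, fun ν => by simp⟩
      | insert i s his ih =>
        intro hs
        obtain ⟨g, hg, h1⟩ := ih fun i hi => hs i (Finset.mem_insert_of_mem hi)
        refine ⟨simpleRefl B i * g, (weyl B).mul_mem (simpleRefl_mem B i) hg, fun ν => ?_⟩
        change simpleRefl B i (g ν) = _
        rw [simpleRefl_apply, h1, Finset.sum_insert his]
        have h2 : (∑ k ∈ s, ν (B.h' k) • B.baseSupp k) (B.h' i) = 0 := by
          rw [LinearMap.sum_apply]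
          refine Finset.sum_eq_zero fun k hk => ?_
          rw [LinearMap.smul_apply, B.baseSupp_apply_h',
            h k i (hs k (Finset.mem_insert_of_mem hk)) (hs i (Finset.mem_insert_self i s))
              (fun h => his (h ▸ hk))]
          simp
        rw [LinearMap.sub_apply, h2]
        module
    obtain ⟨g, hg, h1⟩ := key (Finset.univ.filter fun i => toFold σ i = p)
      fun i hi => (Finset.mem_filter.1 hi).2
    refine ⟨g, hg, fun ν => ?_⟩
    rw [h1]
    congr 1
    rw [foldSum]
    refine Finset.sum_congr (by ext; simp) fun i _ => ?_
    rw [foldMult_orth _ _ h]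
  · refine ⟨simpleRefl B i * (simpleRefl B j * simpleRefl B i), (weyl B).mul_mem (simpleRefl_mem B i)
      ((weyl B).mul_mem (simpleRefl_mem B j) (simpleRefl_mem B i)), fun ν => ?_⟩
    rw [foldSum_eq_pair (h.ne hA) h.2, foldMult_pair _ _ hA h, foldMult_pair _ _ hA h]
    change simpleRefl B i (simpleRefl B j (simpleRefl B i ν)) = _
    simp only [simpleRefl_apply, LinearMap.sub_apply, LinearMap.smul_apply, B.baseSupp_apply_h',
      hA.diag, h.1, hA.symm j i, smul_eq_mul]
    push_cast
    module

/-- The folded reflection `w_p`. -/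
def foldRefl (p : FoldIndex σ) : Dual ℂ H ≃ₗ[ℂ] Dual ℂ H := (exists_foldRefl B σ hA hp p).choose

omit hσA in
lemma foldRefl_mem (p : FoldIndex σ) : foldRefl B σ hA hp p ∈ weyl B :=
  (exists_foldRefl B σ hA hp p).choose_spec.1

omit hσA in
lemma foldRefl_apply (p : FoldIndex σ) (ν : Dual ℂ H) : foldRefl B σ hA hp p ν = ν -
    foldSum σ p fun i => foldMult B.A σ p (fun j => ν (B.h' j)) i • B.baseSupp i :=
  (exists_foldRefl B σ hA hp p).choose_spec.2 ν

lemma foldRefl_comm (p : FoldIndex σ) (ν : Dual ℂ H) :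
    sigmaDual B σ (foldRefl B σ hA hp p ν) = foldRefl B σ hA hp p (sigmaDual B σ ν) := by
  rw [foldRefl_apply, foldRefl_apply, map_sub, map_foldSum]
  congr 1
  rw [← foldSum_comp fun i => foldMult B.A σ p (fun j => sigmaDual B σ ν (B.h' j)) i • B.baseSupp i]
  refine foldSum_congr fun i _ => ?_
  rw [map_smul, sigmaDual_baseSupp B σ hσA]
  congr 1
  unfold foldMult
  split_ifs
  · exact (sigmaDual_h' B σ ν i).symm
  · rw [← foldSum_comp fun j => sigmaDual B σ ν (B.h' j)]
    simp only [sigmaDual_h']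

/-- The simple reflection of the folded Weyl group. -/
def foldSimpleRefl (i : ι) : Dual ℂ (cartan0 B σ) ≃ₗ[ℂ] Dual ℂ (cartan0 B σ) :=
  refl (res B σ (B.baseSupp i), foldH0 B σ (toFold σ i)) (foldSimplePairs_two B σ hσA hA hp i)

lemma foldSimpleRefl_apply (i : ι) (ν : Dual ℂ (cartan0 B σ)) :
    foldSimpleRefl B σ hσA hA hp i ν =
      ν - ν (foldH0 B σ (toFold σ i)) • res B σ (B.baseSupp i) := rfl

lemma foldSimpleRefl_mem (i : ι) : foldSimpleRefl B σ hσA hA hp i ∈ foldWeyl B σ :=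
  refl_mem (Set.mem_range_self i) _

lemma foldSimpleRefl_foldSimpleRefl (i : ι) (ν : Dual ℂ (cartan0 B σ)) :
    foldSimpleRefl B σ hσA hA hp i (foldSimpleRefl B σ hσA hA hp i ν) = ν :=
  LinearEquiv.congr_fun (refl_mul_self _ (foldSimplePairs_two B σ hσA hA hp i)) ν

lemma foldWeyl_induction {P : (Dual ℂ (cartan0 B σ) ≃ₗ[ℂ] Dual ℂ (cartan0 B σ)) → Prop} (one : P 1)
    (mul : ∀ i, ∀ g ∈ foldWeyl B σ, P g → P (foldSimpleRefl B σ hσA hA hp i * g)) :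
    ∀ g ∈ foldWeyl B σ, P g := by
  refine reflGroup_induction (foldSimplePairs_two' B σ hσA hA hp) one ?_
  rintro _ ⟨i, rfl⟩ g hg h
  exact mul i g hg h

lemma res_foldRefl (i : ι) (ν : Dual ℂ H) : res B σ (foldRefl B σ hA hp (toFold σ i) ν) =
    foldSimpleRefl B σ hσA hA hp i (res B σ ν) := by
  rw [foldRefl_apply, foldSimpleRefl_apply, map_sub, map_foldSum, res_foldH0]
  congr 1
  have h1 : (foldSum σ (toFold σ i) fun j => res B σ
      (foldMult B.A σ (toFold σ i) (fun k => ν (B.h' k)) j • B.baseSupp j)) =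
      (foldSum σ (toFold σ i) fun j => foldMult B.A σ (toFold σ i) (fun k => ν (B.h' k)) j) •
        res B σ (B.baseSupp i) := by
    have : (foldSum σ (toFold σ i) fun j => foldMult B.A σ (toFold σ i) (fun k => ν (B.h' k)) j) •
        res B σ (B.baseSupp i) = foldSum σ (toFold σ i) fun j =>
          foldMult B.A σ (toFold σ i) (fun k => ν (B.h' k)) j • res B σ (B.baseSupp i) := by
      classical
      exact Finset.sum_smul
    rw [this]
    refine foldSum_congr fun j hj => ?_
    rw [map_smul, res_baseSupp_eq B σ hσA hj]
  rw [h1]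
  congr 1
  rcases hp (toFold σ i) with h | ⟨a, b, h⟩
  · rw [foldFactor, if_pos h]
    simp only [foldMult_orth _ _ h]
    simp
  · rw [foldFactor, if_neg (h.not_orth hA), foldSum_eq_pair (h.ne hA) h.2,
      foldSum_eq_pair (h.ne hA) h.2, foldMult_pair _ _ hA h, foldMult_pair _ _ hA h]
    push_cast
    ring

end FoldLie

section HatOrbit

open LieAlgebra

variable {L : Type*} [LieRing L] [LieAlgebra ℂ L] {H : LieSubalgebra ℂ L}
variable {ι : Type*} [Fintype ι] [DecidableEq ι] (B : LieAlgebra.Basis ι H) (σ : Equiv.Perm ι)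
variable {lam : Dual ℂ H} {l : ι → ℤ}

/-- The orbit of `λ` under the `σ`-invariant part of the Weyl group, in coordinates. -/
def hatSet (lam : Dual ℂ H) : Set (ι → ℤ) := {c | wt B lam c ∈ hatOrbit B σ lam}

lemma hatOrbit_subset : hatOrbit B σ lam ⊆ orbit (weyl B) lam := by
  rintro μ ⟨g, hg, -, h⟩
  exact ⟨g, hg, h⟩

lemma lam_mem_hatOrbit : lam ∈ hatOrbit B σ lam := ⟨1, (weyl B).one_mem, by simp, rfl⟩

lemma sigma_comm_iff (g : Dual ℂ H ≃ₗ[ℂ] Dual ℂ H) :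
    sigmaDual B σ * g * (sigmaDual B σ)⁻¹ = g ↔
      ∀ ν, sigmaDual B σ (g ν) = g (sigmaDual B σ ν) := by
  rw [mul_inv_eq_iff_eq_mul]
  exact ⟨fun h ν => LinearEquiv.congr_fun h ν, fun h => LinearEquiv.ext h⟩

lemma exists_hatSet_of_mem (hl : ∀ i, lam (B.h' i) = l i) {μ : Dual ℂ H}
    (hμ : μ ∈ hatOrbit B σ lam) : ∃ c ∈ hatSet B σ lam, wt B lam c = μ := by
  obtain ⟨c, hc, rfl⟩ := (wt_mem_orbit_iff B hl μ).1 (hatOrbit_subset B σ hμ)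
  exact ⟨c, hμ, rfl⟩

variable (hA : IsDynkin B.A) (hp : ∀ p, Orth B.A σ p ∨ ∃ i j, IsPair B.A σ p i j)

lemma foldRefl_wt (hl : ∀ i, lam (B.h' i) = l i) (p : FoldIndex σ) (c : ι → ℤ) :
    foldRefl B σ hA hp p (wt B lam c) = wt B lam (foldStep B.A σ l p c) := by
  rw [foldRefl_apply, ← sub_eq_zero, sub_right_comm, wt_sub_wt, sub_eq_zero, foldSum_eq_sum]
  refine Finset.sum_congr rfl fun i _ => ?_
  by_cases hi : toFold σ i = p
  · rw [foldStep_of_mem hi, if_pos hi, add_sub_cancel_left]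
    congr 1
    simp only [wt_apply B hl]
    exact (foldMult_map (Int.castAddHom ℂ) (val B.A l c) i).symm
  · rw [foldStep_of_not_mem hi, if_neg hi, sub_self, Int.cast_zero, zero_smul]

lemma res_wt_foldH0 (hl : ∀ i, lam (B.h' i) = l i) (c : ι → ℤ) (p : FoldIndex σ) :
    res B σ (wt B lam c) (foldH0 B σ p) = ((foldFactor B σ p * tot B.A σ l p c : ℤ) : ℂ) := by
  rw [res_foldH0, tot]
  simp only [wt_apply B hl]
  rw [Int.cast_mul]
  congr 1
  exact (map_foldSum (Int.castAddHom ℂ) (val B.A l c)).symm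

variable (hσA : ∀ i j, B.A (σ i) (σ j) = B.A i j)

include hσA in
lemma foldRefl_mem_hatOrbit (p : FoldIndex σ) {μ : Dual ℂ H} (hμ : μ ∈ hatOrbit B σ lam) :
    foldRefl B σ hA hp p μ ∈ hatOrbit B σ lam := by
  obtain ⟨g, hg, hgσ, rfl⟩ := hμ
  refine ⟨foldRefl B σ hA hp p * g, (weyl B).mul_mem (foldRefl_mem B σ hA hp p) hg, ?_, rfl⟩
  rw [sigma_comm_iff] at hgσ ⊢
  intro ν
  change sigmaDual B σ (foldRefl B σ hA hp p (g ν)) = foldRefl B σ hA hp p (g (sigmaDual B σ ν))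
  rw [foldRefl_comm B σ hσA, hgσ]

variable [FiniteDimensional ℂ L] [IsKilling ℂ L] [H.IsCartanSubalgebra]

include hA hp hσA in
/-- If `w` commutes with `σ`, then `w⁻¹` takes the coroots `h_i`, `i ∈ p`, to coroots that are
permuted by `σ` and thus all positive or all negative. -/
lemma isFoldSet_hatSet (hlam : IsMinuscule B lam) (hl : ∀ i, lam (B.h' i) = l i) :
    IsFoldSet B.A l (reach B.A l) σ (hatSet B σ lam) where
  orbit := isMinusculeOrbit B hA hlam hl
  orth_or_pair := hp
  sub c hc := by
    obtain ⟨d, hd, h⟩ := (wt_mem_orbit_iff B hl _).1 (hatOrbit_subset B σ hc)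
    exact wt_injective B h ▸ hd
  zero_mem := by
    change wt B lam 0 ∈ hatOrbit B σ lam
    rw [wt_zero]
    exact lam_mem_hatOrbit B σ
  step c hc p := by
    change wt B lam (foldStep B.A σ l p c) ∈ hatOrbit B σ lam
    rw [← foldRefl_wt B σ hA hp hl]
    exact foldRefl_mem_hatOrbit B σ hA hp hσA p hc
  sign c hc p := by
    obtain ⟨i, rfl⟩ := Quotient.exists_rep p
    obtain ⟨g, hg, hgσ, h⟩ := hc
    rw [sigma_comm_iff] at hgσ
    obtain ⟨k, hk⟩ := exists_coeff_of_mem_weyl B hg i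
    have hO := isMinusculeOrbit B hA hlam hl
    have hsum : ∀ n : ℕ, 0 ≤ ∑ j, (k j : ℤ) * l ((σ ^ n) j) := fun n =>
      Finset.sum_nonneg fun j _ => mul_nonneg (Int.natCast_nonneg _) (hO.l_nonneg _)
    have hpow : ∀ (n : ℕ) (ν : Dual ℂ H) (j : ι),
        (((sigmaDual B σ) ^ n : Dual ℂ H ≃ₗ[ℂ] Dual ℂ H) ν) (B.h' ((σ ^ n) j)) = ν (B.h' j) := by
      intro n
      induction n with
      | zero => intro ν j; simp
      | succ n ih =>
        intro ν j
        rw [pow_succ', pow_succ']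
        change sigmaDual B σ (((sigmaDual B σ) ^ n : Dual ℂ H ≃ₗ[ℂ] Dual ℂ H) ν)
          (B.h' (σ ((σ ^ n) j))) = _
        rw [sigmaDual_h', ih]
    have hcomm : ∀ (n : ℕ) (ν : Dual ℂ H),
        ((sigmaDual B σ) ^ n : Dual ℂ H ≃ₗ[ℂ] Dual ℂ H) (g ν) =
          g (((sigmaDual B σ) ^ n : Dual ℂ H ≃ₗ[ℂ] Dual ℂ H) ν) := by
      intro n
      induction n with
      | zero => intro ν; simp
      | succ n ih =>
        intro ν
        rw [pow_succ']
        change sigmaDual B σ (((sigmaDual B σ) ^ n : Dual ℂ H ≃ₗ[ℂ] Dual ℂ H) (g ν)) =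
          g (sigmaDual B σ (((sigmaDual B σ) ^ n : Dual ℂ H ≃ₗ[ℂ] Dual ℂ H) ν))
        rw [ih, hgσ]
    -- the values at the coroots of the orbit of `i` are `± ∑ k_j λ(h_{σ^n(j)})`
    have hval : ∀ (n : ℕ), ∃ ν : Dual ℂ H, ((val B.A l c ((σ ^ n) i) : ℤ) : ℂ) = (g ν) (B.h' i) ∧
        ∀ j, ν (B.h' j) = l ((σ ^ n) j) := by
      intro n
      refine ⟨(((sigmaDual B σ) ^ n : Dual ℂ H ≃ₗ[ℂ] Dual ℂ H)).symm lam, ?_, fun j => ?_⟩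
      · rw [← wt_apply B hl, ← h, ← hpow n (g _) i, hcomm, LinearEquiv.apply_symm_apply]
      · rw [← hl, ← hpow n _ j, LinearEquiv.apply_symm_apply]
    refine hk.imp (fun hk => ?_) (fun hk => ?_)
    · intro m hm
      obtain ⟨n, rfl⟩ := (toFold_eq_iff.1 hm.symm).exists_nat_pow_eq
      obtain ⟨ν, h1, h2⟩ := hval n
      rw [hk] at h1
      simp only [h2] at h1
      have h3 : val B.A l c ((σ ^ n) i) = ∑ j, (k j : ℤ) * l ((σ ^ n) j) := by
        exact_mod_cast h1
      rw [h3]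
      exact hsum n
    · intro m hm
      obtain ⟨n, rfl⟩ := (toFold_eq_iff.1 hm.symm).exists_nat_pow_eq
      obtain ⟨ν, h1, h2⟩ := hval n
      rw [hk] at h1
      simp only [h2] at h1
      have h3 : val B.A l c ((σ ^ n) i) = -∑ j, (k j : ℤ) * l ((σ ^ n) j) := by
        exact_mod_cast h1
      rw [h3]
      exact neg_nonpos.2 (hsum n)

end HatOrbit

/-! ### The bijection of orbits and the folded map -/

section FoldOrbit

open LieAlgebra

variable {L : Type*} [LieRing L] [LieAlgebra ℂ L] {H : LieSubalgebra ℂ L}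
variable {ι : Type*} [Fintype ι] (B : LieAlgebra.Basis ι H) (σ : Equiv.Perm ι)

/-- The hypotheses on the diagram, its automorphism `σ` and the minuscule weight `lam`, whose
values at the simple coroots are the integers `l i`. -/
structure IsFolding (lam : Dual ℂ H) (l : ι → ℤ) : Prop where
  dynkin : IsDynkin B.A
  orth_or_pair : ∀ p, Orth B.A σ p ∨ ∃ i j, IsPair B.A σ p i j
  map_cartan : ∀ i j, B.A (σ i) (σ j) = B.A i j
  minuscule : IsMinuscule B lam
  apply_h' : ∀ i, lam (B.h' i) = l i

variable {B σ} {lam : Dual ℂ H} {l : ι → ℤ} [DecidableEq ι]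

namespace IsFolding

/-- The simple reflection `s̃_p`, `i ∈ p`, of the folded Weyl group. -/
def simpleRefl (hF : IsFolding B σ lam l) (i : ι) :
    Dual ℂ (cartan0 B σ) ≃ₗ[ℂ] Dual ℂ (cartan0 B σ) :=
  foldSimpleRefl B σ hF.map_cartan hF.dynkin hF.orth_or_pair i

lemma simpleRefl_res_wt (hF : IsFolding B σ lam l) (i : ι) (c : ι → ℤ) :
    hF.simpleRefl i (res B σ (wt B lam c)) =
      res B σ (wt B lam (foldStep B.A σ l (toFold σ i) c)) := by
  rw [← foldRefl_wt B σ hF.dynkin hF.orth_or_pair hF.apply_h',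
    res_foldRefl B σ hF.map_cartan]
  rfl

lemma simpleRefl_simpleRefl (hF : IsFolding B σ lam l) (i : ι) (ν : Dual ℂ (cartan0 B σ)) :
    hF.simpleRefl i (hF.simpleRefl i ν) = ν :=
  foldSimpleRefl_foldSimpleRefl B σ hF.map_cartan hF.dynkin hF.orth_or_pair i ν

lemma tot_eq (hF : IsFolding B σ lam l) {c d : ι → ℤ}
    (h : res B σ (wt B lam c) = res B σ (wt B lam d)) (p : FoldIndex σ) :
    tot B.A σ l p c = tot B.A σ l p d := by
  have h1 := congrArg (fun ν => ν (foldH0 B σ p)) h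
  simp only [res_wt_foldH0 B σ hF.apply_h'] at h1
  exact mul_left_cancel₀ (foldFactor_pos B σ p).ne' (Int.cast_injective h1)

variable [FiniteDimensional ℂ L] [IsKilling ℂ L] [H.IsCartanSubalgebra]

lemma isFoldSet (hF : IsFolding B σ lam l) :
    IsFoldSet B.A l (reach B.A l) σ (hatSet B σ lam) :=
  isFoldSet_hatSet B σ hF.dynkin hF.orth_or_pair hF.map_cartan hF.minuscule hF.apply_h'

lemma nonneg (hF : IsFolding B σ lam l) {c : ι → ℤ} (hc : c ∈ hatSet B σ lam) : 0 ≤ c :=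
  hF.isFoldSet.orbit.nonneg c (hF.isFoldSet.sub hc)

/-- Induction over the coordinate vectors of the orbit, applying folded reflections that lower the
sum of the coordinates. -/
lemma hatSet_induction (hF : IsFolding B σ lam l) {Q : (ι → ℤ) → Prop} (zero : Q 0)
    (step : ∀ c ∈ hatSet B σ lam, ∀ i, tot B.A σ l (toFold σ i) c < 0 →
      Q (foldStep B.A σ l (toFold σ i) c) → Q c) : ∀ c ∈ hatSet B σ lam, Q c := by
  have hC := hF.isFoldSet
  have key : ∀ n : ℕ, ∀ c ∈ hatSet B σ lam, ∑ i, c i < n → Q c := by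
    intro n
    induction n with
    | zero =>
      intro c hc h
      exact absurd (Finset.sum_nonneg fun i _ => hF.nonneg hc i) (by simpa using h)
    | succ n ih =>
      intro c hc h
      by_cases h0 : c = 0
      · exact h0 ▸ zero
      obtain ⟨i, hi⟩ := hC.exists_tot_neg hF.dynkin hc h0
      refine step c hc i hi (ih _ (hC.step c hc _) ?_)
      have := hC.sum_foldStep_lt hF.dynkin hc hi
      push_cast at h
      omega
  intro c hc
  refine key ((∑ i, c i).toNat + 1) c hc ?_
  have := Int.self_le_toNat (∑ i, c i)
  push_cast
  omega

lemma res_wt_mem_orbit (hF : IsFolding B σ lam l) :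
    ∀ c ∈ hatSet B σ lam, res B σ (wt B lam c) ∈ orbit (foldWeyl B σ) (res B σ lam) := by
  refine hF.hatSet_induction (by rw [wt_zero]; exact mem_orbit_self _ _) fun c hc i _ h => ?_
  have h1 := map_mem_orbit (foldSimpleRefl_mem B σ hF.map_cartan hF.dynkin hF.orth_or_pair i) h
  change hF.simpleRefl i _ ∈ _ at h1
  rwa [← hF.simpleRefl_res_wt, hF.simpleRefl_simpleRefl] at h1

lemma exists_of_mem_orbit (hF : IsFolding B σ lam l) {ν : Dual ℂ (cartan0 B σ)}
    (hν : ν ∈ orbit (foldWeyl B σ) (res B σ lam)) :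
    ∃ c ∈ hatSet B σ lam, res B σ (wt B lam c) = ν := by
  obtain ⟨g, hg, rfl⟩ := hν
  refine foldWeyl_induction B σ hF.map_cartan hF.dynkin hF.orth_or_pair
    (P := fun g => ∃ c ∈ hatSet B σ lam, res B σ (wt B lam c) = g (res B σ lam)) ?_ ?_ g hg
  · exact ⟨0, hF.isFoldSet.zero_mem, by rw [wt_zero]; rfl⟩
  · rintro i g - ⟨c, hc, h⟩
    refine ⟨_, hF.isFoldSet.step c hc (toFold σ i), ?_⟩
    rw [← hF.simpleRefl_res_wt, h]
    rfl

lemma res_wt_injOn (hF : IsFolding B σ lam l) :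
    ∀ c ∈ hatSet B σ lam, ∀ d ∈ hatSet B σ lam, res B σ (wt B lam c) = res B σ (wt B lam d) →
      c = d := by
  have hC := hF.isFoldSet
  refine hF.hatSet_induction ?_ fun c hc i hi ih d hd h => ?_
  · intro d hd h
    by_contra h0
    obtain ⟨i, hi⟩ := hC.exists_tot_neg hF.dynkin hd (Ne.symm h0)
    rw [← hF.tot_eq h] at hi
    have h1 := hC.foldStep_le hF.dynkin hC.zero_mem hi.le
    have h2 := hF.nonneg (hC.step 0 hC.zero_mem (toFold σ i))
    exact hC.foldStep_ne hF.dynkin hi.ne (le_antisymm h1 h2)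
  · have h1 := ih _ (hC.step d hd (toFold σ i))
      (by rw [← hF.simpleRefl_res_wt, ← hF.simpleRefl_res_wt, h])
    rw [← foldStep_foldStep hF.dynkin (hF.orth_or_pair (toFold σ i)) c, h1,
      foldStep_foldStep hF.dynkin (hF.orth_or_pair (toFold σ i))]

lemma bijOn_res (hF : IsFolding B σ lam l) :
    Set.BijOn (res B σ) (hatOrbit B σ lam) (orbit (foldWeyl B σ) (res B σ lam)) := by
  refine ⟨fun μ hμ => ?_, fun μ hμ μ' hμ' h => ?_, fun ν hν => ?_⟩
  · obtain ⟨c, hc, rfl⟩ := exists_hatSet_of_mem B σ hF.apply_h' hμ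
    exact hF.res_wt_mem_orbit c hc
  · obtain ⟨c, hc, rfl⟩ := exists_hatSet_of_mem B σ hF.apply_h' hμ
    obtain ⟨d, hd, rfl⟩ := exists_hatSet_of_mem B σ hF.apply_h' hμ'
    rw [hF.res_wt_injOn c hc d hd h]
  · obtain ⟨c, hc, rfl⟩ := hF.exists_of_mem_orbit hν
    exact ⟨_, hc, rfl⟩

/-- The coordinates `c` of the weight `λ - ∑ c_i α_i` of the `σ`-invariant orbit that restricts
to `ν`. -/
def coord (hF : IsFolding B σ lam l) (ν : orbit (foldWeyl B σ) (res B σ lam)) : ι → ℤ :=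
  (hF.exists_of_mem_orbit ν.2).choose

lemma coord_mem (hF : IsFolding B σ lam l) (ν : orbit (foldWeyl B σ) (res B σ lam)) :
    hF.coord ν ∈ hatSet B σ lam := (hF.exists_of_mem_orbit ν.2).choose_spec.1

lemma res_wt_coord (hF : IsFolding B σ lam l) (ν : orbit (foldWeyl B σ) (res B σ lam)) :
    res B σ (wt B lam (hF.coord ν)) = ν.1 := (hF.exists_of_mem_orbit ν.2).choose_spec.2

lemma coord_eq (hF : IsFolding B σ lam l) {ν : orbit (foldWeyl B σ) (res B σ lam)} {c : ι → ℤ}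
    (hc : c ∈ hatSet B σ lam) (h : res B σ (wt B lam c) = ν.1) : hF.coord ν = c :=
  hF.res_wt_injOn _ (hF.coord_mem ν) _ hc ((hF.res_wt_coord ν).trans h.symm)

lemma coord_injective (hF : IsFolding B σ lam l) : Function.Injective hF.coord := fun ν ν' h =>
  Subtype.ext (by rw [← hF.res_wt_coord, h, hF.res_wt_coord])

lemma apply_foldH0 (hF : IsFolding B σ lam l) (ν : orbit (foldWeyl B σ) (res B σ lam))
    (p : FoldIndex σ) :
    ν.1 (foldH0 B σ p) = ((foldFactor B σ p * tot B.A σ l p (hF.coord ν) : ℤ) : ℂ) := by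
  rw [← res_wt_foldH0 B σ hF.apply_h', hF.res_wt_coord]

lemma apply_foldH0_pos_iff (hF : IsFolding B σ lam l) (ν : orbit (foldWeyl B σ) (res B σ lam))
    (p : FoldIndex σ) : 0 < ν.1 (foldH0 B σ p) ↔ 0 < tot B.A σ l p (hF.coord ν) := by
  rw [hF.apply_foldH0, Int.cast_pos, mul_pos_iff_of_pos_left (foldFactor_pos B σ p)]

/-- The simple reflection `s̃_p`, `i ∈ p`, as a map of the orbit. -/
def orbitRefl (hF : IsFolding B σ lam l) (i : ι) (ν : orbit (foldWeyl B σ) (res B σ lam)) :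
    orbit (foldWeyl B σ) (res B σ lam) :=
  ⟨hF.simpleRefl i ν.1,
    map_mem_orbit (foldSimpleRefl_mem B σ hF.map_cartan hF.dynkin hF.orth_or_pair i) ν.2⟩

lemma coord_orbitRefl (hF : IsFolding B σ lam l) (i : ι)
    (ν : orbit (foldWeyl B σ) (res B σ lam)) :
    hF.coord (hF.orbitRefl i ν) = foldStep B.A σ l (toFold σ i) (hF.coord ν) :=
  hF.coord_eq (hF.isFoldSet.step _ (hF.coord_mem ν) _) (by
    rw [← hF.simpleRefl_res_wt, hF.res_wt_coord]; rfl)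

lemma orbitRefl_orbitRefl (hF : IsFolding B σ lam l) (i : ι)
    (ν : orbit (foldWeyl B σ) (res B σ lam)) : hF.orbitRefl i (hF.orbitRefl i ν) = ν :=
  Subtype.ext (hF.simpleRefl_simpleRefl i ν.1)

/-- The element of the orbit of `λ` that corresponds to `ν`. -/
def lift (hF : IsFolding B σ lam l) (ν : orbit (foldWeyl B σ) (res B σ lam)) :
    orbit (weyl B) lam :=
  ⟨wt B lam (hF.coord ν), hatOrbit_subset B σ (hF.coord_mem ν)⟩

variable {P : Type*} [PartialOrder P] {κ : P → ι}

/-- The folded map from the orbit of `res λ` to the filters of `P`. -/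
def foldMap (hF : IsFolding B σ lam l) (hL : IsLabelled (reach B.A l) κ)
    (ν : orbit (foldWeyl B σ) (res B σ lam)) : Filt P :=
  coloredIso B hF.apply_h' hL (hF.lift ν)

lemma cnt_foldMap (hF : IsFolding B σ lam l) (hL : IsLabelled (reach B.A l) κ)
    (ν : orbit (foldWeyl B σ) (res B σ lam)) : cnt κ (hF.foldMap hL ν).1 = hF.coord ν := by
  rw [foldMap, cnt_coloredIso]
  exact orbitEquiv_eq B hF.apply_h' rfl

lemma isFoldOf_foldMap (hF : IsFolding B σ lam l) (hL : IsLabelled (reach B.A l) κ) :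
    IsFoldOf B σ lam (coloredIso B hF.apply_h' hL) (hF.foldMap hL) := by
  intro μ ν hμ h
  obtain ⟨c, hc, h1⟩ := exists_hatSet_of_mem B σ hF.apply_h' hμ
  rw [foldMap]
  congr 1
  refine Subtype.ext ?_
  rw [← h1, ← hF.coord_eq hc (by rw [h1, h])]
  rfl

lemma eq_foldMap (hF : IsFolding B σ lam l) (hL : IsLabelled (reach B.A l) κ)
    {gt : orbit (foldWeyl B σ) (res B σ lam) → Filt P}
    (h : IsFoldOf B σ lam (coloredIso B hF.apply_h' hL) gt) : gt = hF.foldMap hL :=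
  funext fun ν => h (hF.lift ν) ν (hF.coord_mem ν) (hF.res_wt_coord ν).symm

lemma foldMap_le_iff (hF : IsFolding B σ lam l) (hL : IsLabelled (reach B.A l) κ)
    (ν ν' : orbit (foldWeyl B σ) (res B σ lam)) :
    hF.foldMap hL ν ≤ hF.foldMap hL ν' ↔ hF.coord ν ≤ hF.coord ν' := by
  rw [hL.le_iff, cnt_foldMap, cnt_foldMap]

lemma foldMap_injective (hF : IsFolding B σ lam l) (hL : IsLabelled (reach B.A l) κ) :
    Function.Injective (hF.foldMap hL) := fun ν ν' h =>
  hF.coord_injective (by rw [← hF.cnt_foldMap hL, h, cnt_foldMap])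

lemma filtS_foldMap (hF : IsFolding B σ lam l) (hL : IsLabelled (reach B.A l) κ) (i : ι)
    (ν : orbit (foldWeyl B σ) (res B σ lam)) :
    filtS (fun x => toFold σ (κ x)) (toFold σ i) (hF.foldMap hL ν) =
      hF.foldMap hL (hF.orbitRefl i ν) :=
  hF.isFoldSet.filtS_eq hF.dynkin hL (by rw [cnt_foldMap]; exact hF.coord_mem ν)
    (by rw [cnt_foldMap, cnt_foldMap, coord_orbitRefl])

lemma foldMap_lt_foldMap_iff (hF : IsFolding B σ lam l) (hL : IsLabelled (reach B.A l) κ) (i : ι)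
    (ν : orbit (foldWeyl B σ) (res B σ lam)) :
    hF.foldMap hL ν < hF.foldMap hL (hF.orbitRefl i ν) ↔
      0 < ν.1 (foldH0 B σ (toFold σ i)) := by
  have hC := hF.isFoldSet
  rw [apply_foldH0_pos_iff hF, lt_iff_le_not_ge, foldMap_le_iff, foldMap_le_iff, coord_orbitRefl]
  constructor
  · rintro ⟨-, h⟩
    by_contra! h1
    exact h (hC.foldStep_le hF.dynkin (hF.coord_mem ν) h1)
  · intro h
    have h1 := hC.le_foldStep hF.dynkin (hF.coord_mem ν) h.le
    exact ⟨h1, fun h2 => hC.foldStep_ne hF.dynkin h.ne' (le_antisymm h2 h1)⟩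

/-- The folded map is an isomorphism for the weak order. -/
lemma isIsoOntoImage_simple (hF : IsFolding B σ lam l) (hL : IsLabelled (reach B.A l) κ) :
    IsIsoOntoImage (reflLE (foldSimplePairs B σ) _) (filtLE fun x => toFold σ (κ x))
      (hF.foldMap hL) := by
  refine ⟨hF.foldMap_injective hL, fun ν ν' => ⟨fun h => ?_, fun h => ?_⟩⟩
  · unfold reflLE at h
    refine h.lift (hF.foldMap hL) ?_
    rintro ν ν' ⟨_, ⟨i, rfl⟩, hpos, h⟩
    have h1 : ν' = hF.orbitRefl i ν := Subtype.ext h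
    refine ⟨toFold σ i, ?_⟩
    rw [h1]
    exact ⟨hF.filtS_foldMap hL i ν, (hF.foldMap_lt_foldMap_iff hL i ν).2 hpos⟩
  · have key : ∀ G, filtLE (fun x => toFold σ (κ x)) (hF.foldMap hL ν) G →
        ∃ ν', hF.foldMap hL ν' = G ∧ reflLE (foldSimplePairs B σ) _ ν ν' := by
      intro G hG
      induction hG with
      | refl => exact ⟨ν, rfl, .refl⟩
      | tail _ h ih =>
        obtain ⟨ν', rfl, h2⟩ := ih
        obtain ⟨p, rfl, h⟩ := h
        obtain ⟨i, rfl⟩ := Quotient.exists_rep p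
        change _ < filtS _ (toFold σ i) _ at h
        refine ⟨hF.orbitRefl i ν', (hF.filtS_foldMap hL i ν').symm, h2.tail ?_⟩
        rw [hF.filtS_foldMap hL i ν', hF.foldMap_lt_foldMap_iff] at h
        exact ⟨_, ⟨i, rfl⟩, h, rfl⟩
    obtain ⟨ν'', h1, h2⟩ := key _ h
    rwa [← hF.foldMap_injective hL h1]

end IsFolding

end FoldOrbit

/-! ### Invariant vectors and the height on `h(0)` -/

section Height

open LieAlgebra

lemma eq_of_toFold_eq {ι X : Type*} {σ : Equiv.Perm ι} [Fintype ι] {u : ι → X}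
    (hu : ∀ i, u (σ i) = u i) {i j : ι} (h : toFold σ i = toFold σ j) : u i = u j := by
  obtain ⟨n, rfl⟩ := (toFold_eq_iff.1 h).exists_nat_pow_eq
  clear h
  induction n with
  | zero => rfl
  | succ n ih => rw [pow_succ', Equiv.Perm.mul_apply, hu, ih]

lemma sum_smul_eq_sum_foldSum {ι M : Type*} {σ : Equiv.Perm ι} [Fintype ι] [AddCommGroup M]
    [Fintype (FoldIndex σ)] {u : ι → ℤ} (hu : ∀ i, u (σ i) = u i) (x : ι → M) :
    ∑ i, u i • x i = ∑ p : FoldIndex σ, u p.out • foldSum σ p x := by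
  classical
  rw [← Finset.sum_fiberwise Finset.univ (toFold σ)]
  refine Finset.sum_congr rfl fun p _ => ?_
  rw [foldSum, Finset.smul_sum]
  refine Finset.sum_congr (by ext; simp) fun i hi => ?_
  rw [eq_of_toFold_eq hu (i := i) (j := p.out)]
  rw [(Finset.mem_filter.1 hi).2]
  exact p.out_eq.symm

/-- Multiples of invariant vectors are images of invariant vectors under a Cartan matrix. -/
lemma exists_invariant {ι : Type*} [Fintype ι] [DecidableEq ι] {A : Matrix ι ι ℤ}
    (hA : A.det ≠ 0) {σ : Equiv.Perm ι} (hσ : ∀ i j, A (σ i) (σ j) = A i j) {r : ι → ℤ}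
    (hr : ∀ i, r (σ i) = r i) :
    ∃ u : ι → ℤ, (∀ i, u (σ i) = u i) ∧ ∀ j, ∑ i, A j i * u i = A.det ^ 2 * r j := by
  let u : ι → ℤ := A.det • A.adjugate.mulVec r
  have hu : ∀ j, ∑ i, A j i * u i = A.det ^ 2 * r j := by
    intro j
    have h : A.mulVec u = A.det ^ 2 • r := by
      rw [Matrix.mulVec_smul, Matrix.mulVec_mulVec, Matrix.mul_adjugate, Matrix.smul_mulVec,
        Matrix.one_mulVec, smul_smul, sq]
    exact congrFun h j
  refine ⟨u, fun i => ?_, hu⟩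
  have h : A.mulVec (fun i => u (σ i) - u i) = 0 := by
    ext j
    change ∑ i, A j i * (u (σ i) - u i) = 0
    simp only [mul_sub, Finset.sum_sub_distrib]
    have : ∑ i, A j i * u (σ i) = ∑ i, A (σ j) i * u i := by
      rw [← Equiv.sum_comp σ fun i => A (σ j) i * u i]
      simp only [hσ]
    rw [this, hu, hu, hr, sub_self]
  exact sub_eq_zero.1 (congrFun (Matrix.eq_zero_of_mulVec_eq_zero hA h) i)

variable {L : Type*} [LieRing L] [LieAlgebra ℂ L] {H : LieSubalgebra ℂ L}
variable {ι : Type*} [Fintype ι] [DecidableEq ι] (B : LieAlgebra.Basis ι H) (σ : Equiv.Perm ι)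

lemma foldSum_mem_cartan0 (p : FoldIndex σ) : foldSum σ p B.h' ∈ cartan0 B σ := by
  have h : foldH B σ p ∈ cartan0 B σ := Submodule.subset_span (Set.mem_range_self p)
  by_cases ho : Orth B.A σ p
  · rwa [foldH_eq_orth B σ ho] at h
  · rw [foldH_eq_not_orth B σ ho] at h
    exact (Submodule.smul_mem_iff _ two_ne_zero).1 h

/-- Up to a positive factor, the simple roots take any prescribed `σ`-invariant integral values on
some element of `h(0)`. -/
lemma exists_cartan0 (hσA : ∀ i j, B.A (σ i) (σ j) = B.A i j) {r : ι → ℤ}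
    (hr : ∀ i, r (σ i) = r i) :
    ∃ D : ℤ, 0 < D ∧ ∃ t : cartan0 B σ, ∀ i, B.baseSupp i t = ((D * r i : ℤ) : ℂ) := by
  classical
  have hdet := B.nondegen.det_ne_zero
  obtain ⟨u, hu, hAu⟩ := exists_invariant hdet hσA hr
  refine ⟨B.A.det ^ 2, by positivity, ⟨∑ i, u i • B.h' i, ?_⟩, fun i => ?_⟩
  · rw [sum_smul_eq_sum_foldSum hu]
    exact sum_mem fun p _ => zsmul_mem (foldSum_mem_cartan0 B σ p) _
  · rw [map_sum, ← hAu, Int.cast_sum]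
    refine Finset.sum_congr rfl fun j _ => ?_
    rw [map_zsmul, B.baseSupp_apply_h', zsmul_eq_mul, mul_comm, Int.cast_mul]

/-- There is an element of `h(0)` on which all simple roots take the same positive value. -/
lemma exists_height (hσA : ∀ i j, B.A (σ i) (σ j) = B.A i j) :
    ∃ D : ℤ, 0 < D ∧ ∃ t : cartan0 B σ, ∀ i, B.baseSupp i t = (D : ℂ) := by
  obtain ⟨D, hD, t, ht⟩ := exists_cartan0 B σ hσA (r := 1) fun _ => rfl
  exact ⟨D, hD, t, fun i => by rw [ht, Pi.one_apply, mul_one]⟩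

/-- A nonzero nonnegative combination of simple roots is positive on some `H_q`. -/
lemma exists_foldSum_pos (hA : IsDynkin B.A) (hσA : ∀ i j, B.A (σ i) (σ j) = B.A i j)
    {n : ι → ℤ} (hn : 0 ≤ n) (h0 : n ≠ 0) :
    ∃ i, 0 < foldSum σ (toFold σ i) fun i => ∑ j, n j * B.A j i := by
  classical
  obtain ⟨u, hu, hAu⟩ := exists_invariant B.nondegen.det_ne_zero hσA (r := 1) fun _ => rfl
  have hdet := B.nondegen.det_ne_zero
  have hD : (0 : ℤ) < B.A.det ^ 2 := by positivity
  -- a negative entry of `u` contradicts finite type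
  have hu0 : 0 ≤ u := by
    by_contra hneg
    let m : ι → ℤ := fun i => max (-u i) 0
    have hm0 : m ≠ 0 := fun h => hneg fun i => by
      have : max (-u i) 0 = 0 := congrFun h i
      have := max_eq_right_iff.1 this
      simp only [Pi.zero_apply]; omega
    obtain ⟨i, hi, h⟩ := hA.exists_pos (n := m) (fun i => le_max_right _ _) hm0
    have hmi : m i = -u i := max_eq_left (by
      by_contra! hc
      simp only [m, max_eq_right hc.le, lt_irrefl] at hi)
    have h1 : ∑ j, m j * B.A j i ≤ ∑ j, (-u j) * B.A j i := by
      refine Finset.sum_le_sum fun j _ => ?_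
      by_cases hj : j = i
      · rw [hj, hmi]
      · exact mul_le_mul_of_nonpos_right (le_max_left _ _) (hA.apply_nonpos hj)
    have h2 : ∑ j, (-u j) * B.A j i = -(B.A.det ^ 2 * 1) := by
      have := hAu i
      rw [Pi.one_apply] at this
      rw [← this, ← Finset.sum_neg_distrib]
      exact Finset.sum_congr rfl fun j _ => by rw [hA.symm j i]; ring
    linarith
  by_contra! hcon
  have h1 : 0 < ∑ i, u i * ∑ j, n j * B.A j i := by
    have : ∑ i, u i * ∑ j, n j * B.A j i = ∑ j, n j * B.A.det ^ 2 := by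
      simp only [Finset.mul_sum]
      rw [Finset.sum_comm]
      refine Finset.sum_congr rfl fun j _ => ?_
      have := hAu j
      rw [Pi.one_apply, mul_one] at this
      rw [← this, Finset.mul_sum]
      exact Finset.sum_congr rfl fun i _ => by ring
    rw [this, ← Finset.sum_mul]
    refine mul_pos ?_ hD
    obtain ⟨i, hi⟩ := Function.ne_iff.1 h0
    exact Finset.sum_pos' (fun i _ => hn i) ⟨i, Finset.mem_univ i, lt_of_le_of_ne (hn i) hi.symm⟩
  have h2 := sum_smul_eq_sum_foldSum hu fun i => ∑ j, n j * B.A j i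
  simp only [smul_eq_mul] at h2
  rw [h2] at h1
  refine h1.not_ge (Finset.sum_nonpos fun p _ => mul_nonpos_of_nonneg_of_nonpos (hu0 _) ?_)
  have := hcon p.out
  rwa [show toFold σ p.out = p from p.out_eq] at this

lemma exists_of_mem_res_closure {β : Dual ℂ (cartan0 B σ)}
    (h : β ∈ AddSubmonoid.closure (Set.range fun i => res B σ (B.baseSupp i))) :
    ∃ n : ι → ℕ, β = res B σ (∑ i, (n i : ℂ) • B.baseSupp i) := by
  have h1 : (Set.range fun i => res B σ (B.baseSupp i)) =
      (res B σ).toAddMonoidHom '' Set.range B.baseSupp := by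
    rw [← Set.range_comp]; rfl
  rw [h1, ← AddMonoidHom.map_mclosure] at h
  obtain ⟨γ, hγ, rfl⟩ := h
  obtain ⟨n, rfl⟩ := (mem_closure_iff B γ).1 hγ
  exact ⟨n, rfl⟩

lemma res_mem_closure {γ : Dual ℂ H} (h : γ ∈ AddSubmonoid.closure (Set.range B.baseSupp)) :
    res B σ γ ∈ AddSubmonoid.closure (Set.range fun i => res B σ (B.baseSupp i)) := by
  have h1 : (Set.range fun i => res B σ (B.baseSupp i)) =
      (res B σ).toAddMonoidHom '' Set.range B.baseSupp := by
    rw [← Set.range_comp]; rfl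
  rw [h1, ← AddMonoidHom.map_mclosure]
  exact ⟨γ, h, rfl⟩

end Height

/-! ### The strong order on the folded orbit -/

section StrongOrder

open LieAlgebra

variable {L : Type*} [LieRing L] [LieAlgebra ℂ L] {H : LieSubalgebra ℂ L}
variable {ι : Type*} [Fintype ι] [DecidableEq ι] (B : LieAlgebra.Basis ι H) (σ : Equiv.Perm ι)
variable (hσA : ∀ i j, B.A (σ i) (σ j) = B.A i j)

/-- The properties of the set of positive roots (with coroots) of `g(0)` that determine the strong
order: it contains the simple pairs, its roots are nonnegative combinations of simple roots, and a
simple reflection preserves it except for multiples of the simple root. -/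
structure IsPositiveSystem (Ψ : Set (Dual ℂ (cartan0 B σ) × cartan0 B σ)) : Prop where
  simple : foldSimplePairs B σ ⊆ Ψ
  closure : ∀ r ∈ Ψ, r.1 ∈ AddSubmonoid.closure (Set.range fun i => res B σ (B.baseSupp i))
  refl : ∀ r ∈ Ψ, ∀ i, (∃ n : ℕ, r.1 = n • res B σ (B.baseSupp i)) ∨
    (r.1 - r.1 (foldH0 B σ (toFold σ i)) • res B σ (B.baseSupp i),
      r.2 - res B σ (B.baseSupp i) r.2 • foldH0 B σ (toFold σ i)) ∈ Ψ

namespace IsFolding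

variable {B σ} {lam : Dual ℂ H} {l : ι → ℤ}
variable [FiniteDimensional ℂ L] [IsKilling ℂ L] [H.IsCartanSubalgebra]

lemma baseSupp_foldH0 (hF : IsFolding B σ lam l) (i : ι) :
    res B σ (B.baseSupp i) (foldH0 B σ (toFold σ i)) = 2 :=
  foldSimplePairs_two B σ hF.map_cartan hF.dynkin hF.orth_or_pair i

/-- On the vector of `exists_height` the weight with coordinates `c` takes the value
`λ - D ∑ c_i`. -/
lemma apply_height (hF : IsFolding B σ lam l) {D : ℤ} {t : cartan0 B σ}
    (ht : ∀ i, B.baseSupp i t = (D : ℂ)) (ν : orbit (foldWeyl B σ) (res B σ lam)) :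
    ν.1 t = lam t - D * ((∑ i, hF.coord ν i : ℤ) : ℂ) := by
  rw [← hF.res_wt_coord, res_apply, wt, LinearMap.sub_apply, LinearMap.sum_apply]
  simp only [LinearMap.smul_apply, ht, smul_eq_mul]
  rw [← Finset.sum_mul, mul_comm]
  push_cast
  rfl

/-- The orbit contains no weight in the interior of a `β_p`-string: a reflection group element
that moves it to `λ` would make `λ` a proper convex combination of two weights, at least one of
them different from `λ`. -/
lemma not_between (hF : IsFolding B σ lam l) {x y : orbit (foldWeyl B σ) (res B σ lam)} (i : ι)
    {k v : ℤ} (hv : x.1 (foldH0 B σ (toFold σ i)) = v) (hk : 0 < k) (hkv : k < v)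
    (h : y.1 = x.1 - (k : ℂ) • res B σ (B.baseSupp i)) : False := by
  obtain ⟨D, hD, t, ht⟩ := exists_height B σ hF.map_cartan
  obtain ⟨g, hg, hgy⟩ := y.2
  have hg' := (foldWeyl B σ).inv_mem hg
  let z₁ : orbit (foldWeyl B σ) (res B σ lam) := ⟨g⁻¹ x.1, map_mem_orbit hg' x.2⟩
  let z₂ : orbit (foldWeyl B σ) (res B σ lam) :=
    ⟨g⁻¹ (hF.orbitRefl i x).1, map_mem_orbit hg' (hF.orbitRefl i x).2⟩
  have hr : (hF.orbitRefl i x).1 = x.1 - (v : ℂ) • res B σ (B.baseSupp i) := by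
    rw [← hv]; rfl
  have hgy' : g⁻¹ y.1 = res B σ lam := by
    rw [← hgy]; exact g.symm_apply_apply _
  have h1 : ((v : ℂ) - k) • z₁.1 + (k : ℂ) • z₂.1 = (v : ℂ) • res B σ lam := by
    change ((v : ℂ) - k) • g⁻¹ x.1 + (k : ℂ) • g⁻¹ (hF.orbitRefl i x).1 = _
    rw [show (v : ℂ) • res B σ lam = (v : ℂ) • g⁻¹ y.1 by rw [hgy'], h, hr]
    simp only [map_sub, map_smul]
    module
  have h2 := congrArg (fun ν : Dual ℂ (cartan0 B σ) => ν t) h1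
  simp only [LinearMap.add_apply, LinearMap.smul_apply, smul_eq_mul, hF.apply_height ht,
    res_apply] at h2
  have h3 : (((v - k) * ∑ i, hF.coord z₁ i + k * ∑ i, hF.coord z₂ i : ℤ) : ℂ) = 0 := by
    have hD' : (D : ℂ) ≠ 0 := by exact_mod_cast hD.ne'
    refine (mul_eq_zero.1 (?_ : (D : ℂ) * _ = 0)).resolve_left hD'
    push_cast at h2 ⊢
    linear_combination -h2
  have h4 : (v - k) * ∑ i, hF.coord z₁ i + k * ∑ i, hF.coord z₂ i = 0 := by exact_mod_cast h3
  have hn₁ := hF.nonneg (hF.coord_mem z₁)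
  have hn₂ := hF.nonneg (hF.coord_mem z₂)
  have hs₁ : 0 ≤ ∑ i, hF.coord z₁ i := Finset.sum_nonneg fun i _ => hn₁ i
  have hs₂ : 0 ≤ ∑ i, hF.coord z₂ i := Finset.sum_nonneg fun i _ => hn₂ i
  have h5 : ∑ i, hF.coord z₁ i = 0 := by nlinarith
  have h6 : ∑ i, hF.coord z₂ i = 0 := by nlinarith
  have h7 : hF.coord z₁ = hF.coord z₂ := by
    ext i
    rw [(Finset.sum_eq_zero_iff_of_nonneg fun i _ => hn₁ i).1 h5 i (Finset.mem_univ i),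
      (Finset.sum_eq_zero_iff_of_nonneg fun i _ => hn₂ i).1 h6 i (Finset.mem_univ i)]
  have h8 : g⁻¹ x.1 = g⁻¹ (hF.orbitRefl i x).1 := congrArg Subtype.val (hF.coord_injective h7)
  have h9 := (g⁻¹).injective h8
  rw [hr, eq_comm, sub_eq_self] at h9
  have h10 := congrArg (fun ν : Dual ℂ (cartan0 B σ) => ν (foldH0 B σ (toFold σ i))) h9
  simp only [LinearMap.smul_apply, hF.baseSupp_foldH0, LinearMap.zero_apply, smul_eq_mul] at h10
  have : (v : ℂ) ≠ 0 := by exact_mod_cast (hk.trans hkv).ne'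
  simp_all

/-- Two weights that differ by a multiple of a simple root are exchanged by its reflection. -/
lemma eq_orbitRefl (hF : IsFolding B σ lam l) {x y : orbit (foldWeyl B σ) (res B σ lam)} (i : ι)
    {k : ℂ} (hk : 0 < k) (h : y.1 = x.1 - k • res B σ (B.baseSupp i)) :
    y = hF.orbitRefl i x ∧ 0 < x.1 (foldH0 B σ (toFold σ i)) := by
  obtain ⟨D, hD, t, ht⟩ := exists_height B σ hF.map_cartan
  have hD' : (D : ℂ) ≠ 0 := by exact_mod_cast hD.ne'
  -- `k` is an integer
  obtain ⟨m, rfl⟩ : ∃ m : ℤ, k = m := by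
    refine ⟨∑ i, hF.coord y i - ∑ i, hF.coord x i, mul_left_cancel₀ hD' ?_⟩
    have h1 := congrArg (fun ν : Dual ℂ (cartan0 B σ) => ν t) h
    simp only [LinearMap.sub_apply, LinearMap.smul_apply, smul_eq_mul, hF.apply_height ht,
      res_apply, ht] at h1
    push_cast at h1 ⊢
    linear_combination h1
  have hm : 0 < m := by exact_mod_cast hk
  obtain ⟨v, hv⟩ : ∃ v : ℤ, x.1 (foldH0 B σ (toFold σ i)) = v := ⟨_, hF.apply_foldH0 x _⟩
  have hyv : y.1 (foldH0 B σ (toFold σ i)) = ((v - 2 * m : ℤ) : ℂ) := by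
    rw [h, LinearMap.sub_apply, LinearMap.smul_apply, hF.baseSupp_foldH0, hv, smul_eq_mul]
    push_cast
    ring
  have hmv : m = v := by
    rcases lt_trichotomy m v with h1 | h1 | h1
    · exact (hF.not_between i hv hm h1 h).elim
    · exact h1
    · refine (hF.not_between (x := hF.orbitRefl i y) (y := x) i (k := m - v) (v := 2 * m - v)
        ?_ (by omega) (by omega) ?_).elim
      · change (y.1 - y.1 (foldH0 B σ (toFold σ i)) • res B σ (B.baseSupp i)) _ = _
        rw [LinearMap.sub_apply, LinearMap.smul_apply, hF.baseSupp_foldH0, hyv, smul_eq_mul]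
        push_cast
        ring
      · change x.1 = y.1 - y.1 (foldH0 B σ (toFold σ i)) • res B σ (B.baseSupp i) - _
        rw [hyv, h]
        push_cast
        module
  subst hmv
  refine ⟨Subtype.ext ?_, by rw [hv]; exact hk⟩
  rw [h, ← hv]
  rfl

variable {Ψ : Set (Dual ℂ (cartan0 B σ) × cartan0 B σ)}

/-- A reflection step conjugated by a simple reflection. -/
lemma conj_step (hF : IsFolding B σ lam l) {r : Dual ℂ (cartan0 B σ) × cartan0 B σ}
    {x y : orbit (foldWeyl B σ) (res B σ lam)} (i : ι) (h : y.1 = x.1 - x.1 r.2 • r.1) :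
    (hF.orbitRefl i x).1 (r.2 - res B σ (B.baseSupp i) r.2 • foldH0 B σ (toFold σ i)) = x.1 r.2 ∧
    (hF.orbitRefl i y).1 = (hF.orbitRefl i x).1 -
      x.1 r.2 • (r.1 - r.1 (foldH0 B σ (toFold σ i)) • res B σ (B.baseSupp i)) := by
  have h2 := hF.baseSupp_foldH0 i
  constructor
  · change (x.1 - x.1 (foldH0 B σ (toFold σ i)) • res B σ (B.baseSupp i)) _ = _
    simp only [map_sub, map_smul, LinearMap.sub_apply, LinearMap.smul_apply, h2, smul_eq_mul]
    ring
  · change y.1 - y.1 (foldH0 B σ (toFold σ i)) • res B σ (B.baseSupp i) =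
      x.1 - x.1 (foldH0 B σ (toFold σ i)) • res B σ (B.baseSupp i) - _
    rw [h]
    simp only [LinearMap.sub_apply, LinearMap.smul_apply, smul_eq_mul]
    module

lemma le_of_orbitRefl (hF : IsFolding B σ lam l) {x y : orbit (foldWeyl B σ) (res B σ lam)}
    (i : ι) (h : hF.coord (hF.orbitRefl i x) ≤ hF.coord (hF.orbitRefl i y))
    (hxy : tot B.A σ l (toFold σ i) (hF.coord (hF.orbitRefl i x)) ≤
      tot B.A σ l (toFold σ i) (hF.coord (hF.orbitRefl i y))) :
    hF.coord x ≤ hF.coord y := by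
  have hC := hF.isFoldSet
  have hx := hF.coord_mem (hF.orbitRefl i x)
  have hy := hF.coord_mem (hF.orbitRefl i y)
  have hstep : ∀ z, hF.coord z = foldStep B.A σ l (toFold σ i) (hF.coord (hF.orbitRefl i z)) :=
    fun z => by rw [← hF.coord_orbitRefl, hF.orbitRefl_orbitRefl]
  rw [hstep x, hstep y]
  rcases le_total 0 (tot B.A σ l (toFold σ i) (hF.coord (hF.orbitRefl i x))) with h1 | h1
  · exact hC.foldStep_mono hF.dynkin hx hy h (.inl ⟨h1, h1.trans hxy⟩)
  · rcases le_total 0 (tot B.A σ l (toFold σ i) (hF.coord (hF.orbitRefl i y))) with h2 | h2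
    · exact (hC.foldStep_le hF.dynkin hx h1).trans (h.trans (hC.le_foldStep hF.dynkin hy h2))
    · exact hC.foldStep_mono hF.dynkin hx hy h (.inr ⟨h1, h2⟩)

/-- A step of the strong order increases the coordinates, by induction on the height of the root:
a simple reflection lowers the height. -/
lemma coord_le_of_step (hF : IsFolding B σ lam l) (hΨ : IsPositiveSystem B σ Ψ)
    {r : Dual ℂ (cartan0 B σ) × cartan0 B σ} (hr : r ∈ Ψ)
    {x y : orbit (foldWeyl B σ) (res B σ lam)} (hpos : 0 < x.1 r.2)
    (h : y.1 = x.1 - x.1 r.2 • r.1) : hF.coord x ≤ hF.coord y := by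
  obtain ⟨D, hD, t, ht⟩ := exists_height B σ hF.map_cartan
  have hD' : (D : ℂ) ≠ 0 := by exact_mod_cast hD.ne'
  have hheight : ∀ n : ι → ℕ, res B σ (∑ i, (n i : ℂ) • B.baseSupp i) t = D * (∑ i, n i : ℕ) := by
    intro n
    rw [res_apply, LinearMap.sum_apply]
    simp only [LinearMap.smul_apply, ht, smul_eq_mul]
    rw [← Finset.sum_mul, mul_comm]
    push_cast
    rfl
  have key : ∀ N : ℕ, ∀ n : ι → ℕ, ∑ i, n i < N → ∀ r ∈ Ψ,
      r.1 = res B σ (∑ i, (n i : ℂ) • B.baseSupp i) →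
      ∀ x y : orbit (foldWeyl B σ) (res B σ lam), 0 < x.1 r.2 → y.1 = x.1 - x.1 r.2 • r.1 →
      hF.coord x ≤ hF.coord y := by
    intro N
    induction N with
    | zero => intro n hn; simp at hn
    | succ N ih =>
      intro n hn r hr hrn x y hpos h
      by_cases h0 : n = 0
      · have : r.1 = 0 := by rw [hrn, h0]; simp
        rw [this, smul_zero, sub_zero] at h
        rw [Subtype.ext h]
      obtain ⟨i, hi⟩ := exists_foldSum_pos B σ hF.dynkin hF.map_cartan
        (n := fun i => (n i : ℤ)) (fun i => Int.natCast_nonneg _)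
        (fun h' => h0 (funext fun i => Int.natCast_eq_zero.1 (congrFun h' i)))
      have hri : r.1 (foldH0 B σ (toFold σ i)) = ((foldFactor B σ (toFold σ i) *
          foldSum σ (toFold σ i) fun i => ∑ j, (n j : ℤ) * B.A j i : ℤ) : ℂ) := by
        rw [hrn, res_foldH0, Int.cast_mul]
        congr 1
        refine Eq.trans ?_ (map_foldSum (Int.castAddHom ℂ) _).symm
        refine foldSum_congr fun k _ => ?_
        rw [LinearMap.sum_apply]
        simp
      set b : ℤ := foldFactor B σ (toFold σ i) *
        foldSum σ (toFold σ i) fun i => ∑ j, (n j : ℤ) * B.A j i with hb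
      have hb0 : 0 < b := mul_pos (foldFactor_pos B σ _) hi
      rcases hΨ.refl r hr i with ⟨m, hm⟩ | hr'
      · have hm0 : m ≠ 0 := fun h' => by
          rw [hm, h', zero_smul, LinearMap.zero_apply] at hri
          exact hb0.ne (by exact_mod_cast hri)
        have hmp : (0 : ℂ) < m := by exact_mod_cast Nat.pos_of_ne_zero hm0
        obtain ⟨rfl, h2⟩ := hF.eq_orbitRefl (x := x) (y := y) i (mul_pos hpos hmp) (by
          rw [h, hm, ← Nat.cast_smul_eq_nsmul ℂ, smul_smul])
        rw [hF.coord_orbitRefl]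
        exact hF.isFoldSet.le_foldStep hF.dynkin (hF.coord_mem x)
          ((hF.apply_foldH0_pos_iff x _).1 h2).le
      · obtain ⟨h1, h2⟩ := hF.conj_step i h
        obtain ⟨n', hn'⟩ := exists_of_mem_res_closure B σ (hΨ.closure _ hr')
        have hlt : ∑ i, n' i < N := by
          have h3 := congrArg (fun ν : Dual ℂ (cartan0 B σ) => ν t) hn'
          simp only [LinearMap.sub_apply, LinearMap.smul_apply, smul_eq_mul] at h3
          rw [hheight, hrn, hheight, ← hrn, hri, res_apply, ht] at h3
          have h4 : ((∑ i, n i : ℕ) : ℂ) - b = (∑ i, n' i : ℕ) :=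
            mul_left_cancel₀ hD' (by linear_combination h3)
          have h5 : ((∑ i, n i : ℕ) : ℤ) - b = (∑ i, n' i : ℕ) := by exact_mod_cast h4
          omega
        refine hF.le_of_orbitRefl i (ih n' hlt _ hr' hn' _ _ (h1 ▸ hpos) (h1.symm ▸ h2)) ?_
        -- the value of `y` at `H_i` is smaller than that of `x`
        have hval : ∀ z, tot B.A σ l (toFold σ i) (hF.coord (hF.orbitRefl i z)) =
            -tot B.A σ l (toFold σ i) (hF.coord z) := fun z => by
          rw [hF.coord_orbitRefl, tot_foldStep hF.dynkin (hF.orth_or_pair _)]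
        rw [hval, hval, neg_le_neg_iff]
        have h6 : y.1 (foldH0 B σ (toFold σ i)) ≤ x.1 (foldH0 B σ (toFold σ i)) := by
          rw [h, LinearMap.sub_apply, LinearMap.smul_apply, hri, smul_eq_mul]
          refine sub_le_self _ (mul_nonneg hpos.le ?_)
          exact_mod_cast hb0.le
        rw [hF.apply_foldH0, hF.apply_foldH0] at h6
        exact le_of_mul_le_mul_left (by exact_mod_cast h6) (foldFactor_pos B σ (toFold σ i))
  obtain ⟨n, hn⟩ := exists_of_mem_res_closure B σ (hΨ.closure _ hr)
  exact key _ n (Nat.lt_succ_self _) r hr hn x y hpos h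

lemma reflLE_orbitRefl (hF : IsFolding B σ lam l) (hΨ : IsPositiveSystem B σ Ψ) (i : ι)
    {y : orbit (foldWeyl B σ) (res B σ lam)}
    (hy : 0 ≤ tot B.A σ l (toFold σ i) (hF.coord y)) : reflLE Ψ _ y (hF.orbitRefl i y) := by
  rcases hy.eq_or_lt with h | h
  · have h1 : y.1 (foldH0 B σ (toFold σ i)) = 0 := by rw [hF.apply_foldH0, ← h]; simp
    have h2 : hF.orbitRefl i y = y := Subtype.ext (by
      change y.1 - y.1 (foldH0 B σ (toFold σ i)) • _ = _
      rw [h1, zero_smul, sub_zero])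
    rw [h2]
    exact .refl
  · exact .single ⟨_, hΨ.simple ⟨i, rfl⟩, (hF.apply_foldH0_pos_iff y _).2 h, rfl⟩

/-- The lifting property of the strong order. -/
lemma reflLE_lift (hF : IsFolding B σ lam l) (hΨ : IsPositiveSystem B σ Ψ) (i : ι)
    {x y : orbit (foldWeyl B σ) (res B σ lam)} (h : reflLE Ψ _ x y)
    (hy : 0 ≤ tot B.A σ l (toFold σ i) (hF.coord y)) :
    reflLE Ψ _ (hF.orbitRefl i x) (hF.orbitRefl i y) := by
  induction h using ReflTransGen.head_induction_on with
  | refl => exact .refl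
  | head h h' ih =>
    rename_i x z
    obtain ⟨r, hr, hpos, h⟩ := h
    rcases hΨ.refl r hr i with ⟨m, hm⟩ | hr'
    · by_cases hm0 : m = 0
      · rw [hm, hm0, zero_smul, smul_zero, sub_zero] at h
        rwa [← Subtype.ext h]
      have hmp : (0 : ℂ) < m := by exact_mod_cast Nat.pos_of_ne_zero hm0
      obtain ⟨rfl, -⟩ := hF.eq_orbitRefl (x := x) (y := z) i (mul_pos hpos hmp) (by
        rw [h, hm, ← Nat.cast_smul_eq_nsmul ℂ, smul_smul])
      exact h'.trans (hF.reflLE_orbitRefl hΨ i hy)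
    · obtain ⟨h1, h2⟩ := hF.conj_step i h
      exact ih.head ⟨_, hr', h1 ▸ hpos, h1.symm ▸ h2⟩

/-- The strong order on the folded orbit is the componentwise order of the coordinates. -/
lemma reflLE_iff (hF : IsFolding B σ lam l) (hΨ : IsPositiveSystem B σ Ψ)
    (ν ν' : orbit (foldWeyl B σ) (res B σ lam)) :
    reflLE Ψ _ ν ν' ↔ hF.coord ν ≤ hF.coord ν' := by
  have hC := hF.isFoldSet
  constructor
  · intro h
    induction h with
    | refl => exact le_rfl
    | tail _ h ih =>
      obtain ⟨r, hr, hpos, h⟩ := h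
      exact ih.trans (hF.coord_le_of_step hΨ hr hpos h)
  · have key : ∀ c ∈ hatSet B σ lam, ∀ ν ν' : orbit (foldWeyl B σ) (res B σ lam),
        hF.coord ν' = c → hF.coord ν ≤ c → reflLE Ψ _ ν ν' := by
      refine hF.hatSet_induction (fun ν ν' h1 h2 => ?_) fun c hc i hi ih ν ν' h1 h2 => ?_
      · rw [hF.coord_injective (h1.trans (le_antisymm (hF.nonneg (hF.coord_mem ν)) h2))]
        exact .refl
      · subst h1
        have ht : 0 ≤ tot B.A σ l (toFold σ i) (hF.coord (hF.orbitRefl i ν')) := by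
          rw [hF.coord_orbitRefl, tot_foldStep hF.dynkin (hF.orth_or_pair _)]
          exact neg_nonneg.2 hi.le
        have hup := hF.reflLE_orbitRefl hΨ i ht
        rw [hF.orbitRefl_orbitRefl] at hup
        rcases le_total 0 (tot B.A σ l (toFold σ i) (hF.coord ν)) with h3 | h3
        · exact (ih ν (hF.orbitRefl i ν') (hF.coord_orbitRefl i ν')
            (hC.le_foldStep_of_opposite hF.dynkin (hF.coord_mem ν) hc h2 h3 hi.le)).trans hup
        · have h4 := hF.reflLE_lift hΨ i (ih (hF.orbitRefl i ν) (hF.orbitRefl i ν')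
            (hF.coord_orbitRefl i ν') (by
              rw [hF.coord_orbitRefl]
              exact hC.foldStep_mono hF.dynkin (hF.coord_mem ν) hc h2 (.inr ⟨h3, hi.le⟩))) ht
          rwa [hF.orbitRefl_orbitRefl, hF.orbitRefl_orbitRefl] at h4
    exact key _ (hF.coord_mem ν') ν ν' rfl

end IsFolding

end StrongOrder

/-! ### The automorphism of an `sl₂`-triple -/

section SlTwo

open LieAlgebra

variable {L : Type*} [LieRing L] [LieAlgebra ℂ L] [FiniteDimensional ℂ L]

/-- An eigenvector of `ad h` with nonzero eigenvalue is ad-nilpotent: its powers have infinitely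
many eigenvalues under `ad (ad h)`. -/
lemma isNilpotent_ad {h e : L} {a : ℂ} (ha : a ≠ 0) (he : ⁅h, e⁆ = a • e) :
    IsNilpotent (ad ℂ L e) := by
  by_contra hcon
  -- the commutator with `ad h`
  let D : End ℂ L →ₗ[ℂ] End ℂ L := LinearMap.mulLeft ℂ (ad ℂ L h) - LinearMap.mulRight ℂ (ad ℂ L h)
  have hD : ∀ T, D T = ad ℂ L h * T - T * ad ℂ L h := fun _ => rfl
  have h1 : D (ad ℂ L e) = a • ad ℂ L e := by
    refine LinearMap.ext fun x => ?_
    change ⁅h, ⁅e, x⁆⁆ - ⁅e, ⁅h, x⁆⁆ = a • ⁅e, x⁆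
    rw [← smul_lie, ← he, leibniz_lie, add_sub_cancel_right]
  have hpow : ∀ n : ℕ, D ((ad ℂ L e) ^ n) = ((n : ℂ) * a) • (ad ℂ L e) ^ n := by
    intro n
    induction n with
    | zero => simp [hD]
    | succ n ih =>
      have h2 : D ((ad ℂ L e) ^ (n + 1)) =
          D ((ad ℂ L e) ^ n) * ad ℂ L e + (ad ℂ L e) ^ n * D (ad ℂ L e) := by
        simp only [hD, pow_succ]
        noncomm_ring
      rw [h2, ih, h1, smul_mul_assoc, mul_smul_comm, ← pow_succ, ← add_smul]
      congr 1
      push_cast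
      ring
  have hev : ∀ n : ℕ, End.HasEigenvalue D ((n : ℂ) * a) := fun n =>
    End.hasEigenvalue_of_hasEigenvector (x := (ad ℂ L e) ^ n)
      ⟨End.mem_eigenspace_iff.2 (hpow n), fun h0 => hcon ⟨n, h0⟩⟩
  refine Set.infinite_of_injective_forall_mem (f := fun n : ℕ => (n : ℂ) * a) ?_ hev
    (End.finite_hasEigenvalue _)
  intro m n hmn
  exact_mod_cast mul_right_cancel₀ ha hmn

/-- The exponential of a nilpotent inner derivation. -/
lemma exists_exp {e : L} (he : IsNilpotent (ad ℂ L e)) : ∃ θ : L ≃ₗ⁅ℂ⁆ L,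
    (∀ x, ⁅e, ⁅e, ⁅e, x⁆⁆⁆ = 0 → θ x = x + ⁅e, x⁆ + (2⁻¹ : ℂ) • ⁅e, ⁅e, x⁆⁆) ∧
    ∀ K : LieSubalgebra ℂ L, e ∈ K → ∀ x ∈ K, θ x ∈ K := by
  let : Module ℚ L := Module.compHom L (algebraMap ℚ ℂ)
  have hsmul : ∀ (q : ℚ) (x : L), q • x = (q : ℂ) • x := fun _ _ => rfl
  let : LieAlgebra ℚ L := ⟨fun q x y => by rw [hsmul, hsmul, lie_smul]⟩
  have he' : IsNilpotent (LieDerivation.ad ℂ L e).toLinearMap := by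
    rwa [LieDerivation.coe_ad_apply_eq_ad_apply]
  refine ⟨LieDerivation.exp _ he', fun x hx => ?_, fun K hK x hx => ?_⟩
  · rw [LieDerivation.exp_map_apply, LieDerivation.coe_ad_apply_eq_ad_apply]
    have := IsNilpotent.exp_smul_eq_sum (a := ad ℂ L e) (m := x) (k := 3)
      (by simpa [pow_succ] using hx) he
    refine Eq.trans this ?_
    simp [Finset.sum_range_succ, pow_succ, hsmul, Nat.factorial]
  · rw [LieDerivation.exp_map_apply, LieDerivation.coe_ad_apply_eq_ad_apply]
    obtain ⟨k, hk⟩ := he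
    have := IsNilpotent.exp_smul_eq_sum (a := ad ℂ L e) (m := x) (k := k)
      (by rw [hk, zero_smul]) ⟨k, hk⟩
    have h1 : ∀ n : ℕ, ((ad ℂ L e) ^ n) x ∈ K := by
      intro n
      induction n with
      | zero => exact hx
      | succ n ih =>
        rw [pow_succ']
        exact K.lie_mem hK ih
    refine Eq.subst (motive := fun y => y ∈ K) this.symm (sum_mem fun n _ => ?_)
    rw [hsmul]
    exact K.smul_mem _ (h1 n)

/-- The automorphism `exp(ad e) exp(-ad f) exp(ad e)` reflects elements that act on `e` and `f` by
scalars. -/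
lemma exists_reflection {h e f : L} (hef : ⁅e, f⁆ = h) (he : ⁅h, e⁆ = (2 : ℂ) • e)
    (hf : ⁅h, f⁆ = (-2 : ℂ) • f) : ∃ θ : L ≃ₗ⁅ℂ⁆ L,
    (∀ (t : L) (b : ℂ), ⁅t, e⁆ = b • e → ⁅t, f⁆ = -(b • f) → θ t = t - b • h) ∧
    ∀ K : LieSubalgebra ℂ L, e ∈ K → f ∈ K → ∀ x ∈ K, θ x ∈ K := by
  obtain ⟨θ₁, h1, h1'⟩ := exists_exp (isNilpotent_ad two_ne_zero he)
  obtain ⟨θ₂, h2, h2'⟩ := exists_exp (e := -f) (isNilpotent_ad (h := h) (a := -2) (by norm_num)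
    (by rw [lie_neg, hf, smul_neg]))
  refine ⟨(θ₁.trans θ₂).trans θ₁, fun t b hte htf => ?_, fun K hK hK' x hx =>
    h1' K hK _ (h2' K (K.neg_mem hK') _ (h1' K hK x hx))⟩
  change θ₁ (θ₂ (θ₁ t)) = _
  have het : ⁅e, t⁆ = -(b • e) := by rw [← lie_skew, hte]
  have hft : ⁅f, t⁆ = b • f := by rw [← lie_skew, htf, neg_neg]
  have hfe : ⁅f, e⁆ = -h := by rw [← lie_skew, hef]
  have heh : ⁅e, h⁆ = -((2 : ℂ) • e) := by rw [← lie_skew, he]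
  have hfh : ⁅f, h⁆ = (2 : ℂ) • f := by rw [← lie_skew, hf, neg_smul, neg_neg]
  have e1 : θ₁ t = t - b • e := by
    rw [h1 t (by simp [het]), het]
    simp
    module
  have e2 : θ₂ (t - b • e) = t - b • e - b • h := by
    rw [h2]
    · simp only [lie_sub, lie_smul, neg_lie, lie_neg, lie_self, hft, hfe, hfh]
      module
    · simp only [lie_sub, lie_smul, neg_lie, lie_neg, lie_self, hft, hfe, hfh]
      simp
  have e3 : θ₁ (t - b • e - b • h) = t - b • h := by
    rw [h1]
    · simp only [lie_sub, lie_smul, lie_neg, lie_self, het, heh]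
      simp
      module
    · simp only [lie_sub, lie_smul, lie_neg, lie_self, het, heh]
      simp
  rw [e1, e2, e3]

end SlTwo

/-! ### The positive roots of the fixed point subalgebra -/

section PositiveRoots

open LieAlgebra IsKilling

variable {L : Type*} [LieRing L] [LieAlgebra ℂ L] {H : LieSubalgebra ℂ L}
variable {ι : Type*} [Fintype ι] (B : LieAlgebra.Basis ι H) (σ : Equiv.Perm ι)

/-- The sum of the Chevalley generators `e_i`, `i ∈ p`. -/
def foldE (p : FoldIndex σ) : L := foldSum σ p B.e

/-- The multiple of the sum of the Chevalley generators `f_i`, `i ∈ p`, that completes `foldE` and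
`H_p` to an `sl₂`-triple. -/
def foldF (p : FoldIndex σ) : L := (foldFactor B σ p : ℂ) • foldSum σ p B.f

lemma lie_foldE_foldF (p : FoldIndex σ) :
    ⁅foldE B σ p, foldF B σ p⁆ = ((foldH B σ p : H) : L) := by
  classical
  have h : ⁅foldSum σ p B.e, foldSum σ p B.f⁆ = ((foldSum σ p B.h' : H) : L) := by
    have h1 : ((foldSum σ p B.h' : H) : L) = foldSum σ p B.h :=
      map_foldSum H.subtype B.h'
    rw [h1]
    simp only [foldSum]
    rw [sum_lie]
    refine Finset.sum_congr rfl fun i hi => ?_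
    rw [lie_sum, Finset.sum_eq_single i, (B.sl2 i).lie_e_f]
    · exact fun j _ hj => B.lie_e_f_ne i j hj.symm
    · exact fun h => absurd hi h
  rw [foldE, foldF, lie_smul, h]
  by_cases ho : Orth B.A σ p
  · rw [foldH_eq_orth B σ ho, foldFactor, if_pos ho]; simp
  · rw [foldH_eq_not_orth B σ ho, foldFactor, if_neg ho]; simp

variable (hσA : ∀ i j, B.A (σ i) (σ j) = B.A i j)
include hσA

lemma lie_foldE (i : ι) (t : cartan0 B σ) : ⁅((t : H) : L), foldE B σ (toFold σ i)⁆ =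
    res B σ (B.baseSupp i) t • foldE B σ (toFold σ i) := by
  classical
  rw [foldE, foldSum, lie_sum, Finset.smul_sum]
  refine Finset.sum_congr rfl fun j hj => ?_
  rw [← res_baseSupp_eq B σ hσA (Finset.mem_filter.1 hj).2, res_apply]
  exact (B.baseSupp_apply_smul_e j t).symm

lemma lie_foldF (i : ι) (t : cartan0 B σ) : ⁅((t : H) : L), foldF B σ (toFold σ i)⁆ =
    -(res B σ (B.baseSupp i) t • foldF B σ (toFold σ i)) := by
  classical
  rw [foldF, lie_smul, smul_comm, ← smul_neg]
  congr 1
  rw [foldSum, lie_sum, Finset.smul_sum, ← Finset.sum_neg_distrib]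
  refine Finset.sum_congr rfl fun j hj => ?_
  rw [← res_baseSupp_eq B σ hσA (Finset.mem_filter.1 hj).2, res_apply, eq_neg_iff_add_eq_zero,
    add_comm, ← eq_neg_iff_add_eq_zero]
  exact B.baseSupp_apply_smul_f j t

omit hσA
variable {τ : L ≃ₗ⁅ℂ⁆ L}

lemma foldE_mem (hτe : ∀ i, τ (B.e i) = B.e (σ i)) (p : FoldIndex σ) :
    foldE B σ p ∈ fixedSubalgebra τ := by
  change τ (foldSum σ p B.e) = foldSum σ p B.e
  rw [map_foldSum, ← foldSum_comp B.e]
  simp only [hτe]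

lemma foldF_mem (hτf : ∀ i, τ (B.f i) = B.f (σ i)) (p : FoldIndex σ) :
    foldF B σ p ∈ fixedSubalgebra τ := by
  refine LieSubalgebra.smul_mem _ _ ?_
  change τ (foldSum σ p B.f) = foldSum σ p B.f
  rw [map_foldSum, ← foldSum_comp B.f]
  simp only [hτf]

variable [FiniteDimensional ℂ L] [IsKilling ℂ L] [H.IsCartanSubalgebra]

/-- A nonzero weight of `h(0)` on `g` is the restriction of a root. -/
lemma weight_pos_or_neg {β : Dual ℂ (cartan0 B σ)} (hβ : β ≠ 0) {x : L} (hx : x ≠ 0)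
    (h : ∀ t : cartan0 B σ, ⁅((t : H) : L), x⁆ = β t • x) :
    β ∈ AddSubmonoid.closure (Set.range fun i => res B σ (B.baseSupp i)) ∨
    -β ∈ AddSubmonoid.closure (Set.range fun i => res B σ (B.baseSupp i)) := by
  classical
  have hab := B.isLieAbelian_cartan
  let V : LieSubmodule ℂ H L :=
    { carrier := {x | ∀ t : cartan0 B σ, ⁅((t : H) : L), x⁆ = β t • x}
      add_mem' := fun {x y} hx hy t => by rw [lie_add, hx, hy, smul_add]
      zero_mem' := fun t => by rw [lie_zero, smul_zero]
      smul_mem' := fun c x hx t => by rw [lie_smul, hx, smul_comm]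
      lie_mem := fun {s x} hx t => by
        change ⁅((t : H) : L), ⁅(s : L), x⁆⁆ = β t • ⁅(s : L), x⁆
        have h0 : ⁅((t : H) : L), (s : L)⁆ = 0 :=
          congrArg Subtype.val (LieModule.IsTrivial.trivial (t : H) s)
        rw [leibniz_lie, h0, zero_lie, zero_add, hx, lie_smul] }
  have : Nontrivial V := ⟨⟨⟨x, h⟩, 0, fun h0 => hx (congrArg Subtype.val h0)⟩⟩
  obtain ⟨χ, hχ⟩ := LieModule.exists_nontrivial_weightSpace_of_isSolvable ℂ H V
  obtain ⟨⟨v, hv⟩, hv0⟩ := exists_ne (0 : LieModule.weightSpace V χ)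
  rw [LieModule.mem_weightSpace] at hv
  have hv0' : (v : L) ≠ 0 := fun h0 => hv0 (Subtype.ext (Subtype.ext h0))
  have hvχ : ∀ s : H, ⁅s, (v : L)⁆ = χ s • (v : L) := fun s => congrArg Subtype.val (hv s)
  have hres : res B σ χ = β := by
    ext t
    refine smul_left_injective ℂ hv0' ?_
    change χ t • (v : L) = β t • (v : L)
    rw [← hvχ]
    exact v.2 t
  have hmem : (v : L) ∈ LieModule.genWeightSpace L χ :=
    LieModule.weightSpace_le_genWeightSpace L χ ((LieModule.mem_weightSpace _ _).2 hvχ)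
  let w : LieModule.Weight ℂ H L := ⟨χ, fun h0 => hv0' (by
    rw [h0] at hmem; exact hmem)⟩
  have hw : w ∈ H.root := by
    have h1 : ¬ w.IsZero := fun h0 => by
      refine hβ ?_
      rw [← hres]
      ext t
      exact congrFun h0 t
    simpa [LieModule.Weight.IsNonZero] using h1
  have hroot : (rootSystem H).root ⟨w, hw⟩ = χ := rfl
  rw [← hres, ← hroot, ← map_neg]
  exact (root_pos_or_neg B ⟨w, hw⟩).imp (res_mem_closure B σ) (res_mem_closure B σ)

variable [DecidableEq ι]

/-- The positive roots of `g(0)` with their coroots form a positive system. The simple reflections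
are realized by automorphisms of `g(0)`. -/
lemma isPositiveSystem_foldPosPairs (hA : IsDynkin B.A)
    (hp : ∀ p, Orth B.A σ p ∨ ∃ i j, IsPair B.A σ p i j)
    (hσA : ∀ i j, B.A (σ i) (σ j) = B.A i j)
    (hτe : ∀ i, τ (B.e i) = B.e (σ i)) (hτf : ∀ i, τ (B.f i) = B.f (σ i)) :
    IsPositiveSystem B σ (foldPosPairs B σ τ) := by
  have htwo := foldSimplePairs_two B σ hσA hA hp
  refine ⟨?_, fun r hr => hr.2.2.1, ?_⟩
  · rintro _ ⟨i, rfl⟩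
    have hE : foldE B σ (toFold σ i) ∈ foldRootSpace B σ τ (res B σ (B.baseSupp i)) :=
      ⟨foldE_mem B σ hτe _, lie_foldE B σ hσA i⟩
    have hEF := lie_foldE_foldF B σ (toFold σ i)
    have h0 : res B σ (B.baseSupp i) ≠ 0 := fun h0 => by
      have := htwo i
      rw [h0] at this
      simp at this
    refine ⟨h0, ⟨_, hE, fun hE0 => ?_⟩, AddSubmonoid.subset_closure ⟨i, rfl⟩, htwo i, _, hE,
      foldF B σ (toFold σ i), ⟨foldF_mem B σ hτf _, fun t => ?_⟩, hEF⟩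
    · rw [hE0, zero_lie] at hEF
      have h1 : foldH0 B σ (toFold σ i) = 0 := Subtype.ext (Subtype.ext hEF.symm)
      have := htwo i
      rw [h1] at this
      simp at this
    · rw [lie_foldF B σ hσA, LinearMap.neg_apply, neg_smul]
  · rintro ⟨β, h⟩ ⟨hβ0, -, hβ, hβh, x, hx, y, hy, hxy⟩ i
    change β h = 2 at hβh
    obtain ⟨n, hn⟩ := exists_of_mem_res_closure B σ hβ
    change β = _ at hn
    by_cases hcase : ∀ j, toFold σ j ≠ toFold σ i → n j = 0
    · refine .inl ⟨∑ j, n j, ?_⟩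
      change β = _
      rw [hn, map_sum, Finset.sum_smul]
      refine Finset.sum_congr rfl fun j _ => ?_
      by_cases hj : toFold σ j = toFold σ i
      · rw [map_smul, res_baseSupp_eq B σ hσA hj, Nat.cast_smul_eq_nsmul]
      · rw [hcase j hj]; simp
    right
    change (β - β (foldH0 B σ (toFold σ i)) • res B σ (B.baseSupp i),
      h - res B σ (B.baseSupp i) h • foldH0 B σ (toFold σ i)) ∈ _
    obtain ⟨θ, hθ, hθK⟩ := exists_reflection (lie_foldE_foldF B σ (toFold σ i))
      (by rw [← htwo i]; exact lie_foldE B σ hσA i (foldH0 B σ (toFold σ i)))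
      (by rw [neg_smul, ← htwo i]; exact lie_foldF B σ hσA i (foldH0 B σ (toFold σ i)))
    have hθt : ∀ t : cartan0 B σ, θ ((t : H) : L) =
        (((t - res B σ (B.baseSupp i) t • foldH0 B σ (toFold σ i) : cartan0 B σ) : H) : L) :=
      fun t => hθ _ _ (lie_foldE B σ hσA i t) (lie_foldF B σ hσA i t)
    -- the automorphism maps root spaces to reflected root spaces
    have hspace : ∀ (γ : Dual ℂ (cartan0 B σ)) (z : L), z ∈ foldRootSpace B σ τ γ →
        θ z ∈ foldRootSpace B σ τ
          (γ - γ (foldH0 B σ (toFold σ i)) • res B σ (B.baseSupp i)) := by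
      rintro γ z ⟨hz, hzt⟩
      refine ⟨hθK _ (foldE_mem B σ hτe _) (foldF_mem B σ hτf _) z hz, fun t => ?_⟩
      have h1 : ((t : H) : L) = θ (((t - res B σ (B.baseSupp i) t • foldH0 B σ (toFold σ i) :
          cartan0 B σ) : H) : L) := by
        rw [hθt]
        congr 2
        simp only [map_sub, map_smul, htwo, smul_eq_mul]
        module
      rw [h1, ← LieEquiv.map_lie, hzt, map_smul]
      congr 1
      simp only [map_sub, map_smul, LinearMap.sub_apply, LinearMap.smul_apply, smul_eq_mul]
      ring
    have hθx := hspace β x hx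
    have hθy := hspace (-β) y hy
    have hneg : -β - (-β) (foldH0 B σ (toFold σ i)) • res B σ (B.baseSupp i) =
        -(β - β (foldH0 B σ (toFold σ i)) • res B σ (B.baseSupp i)) := by
      rw [LinearMap.neg_apply]
      module
    rw [hneg] at hθy
    have hθxy : ⁅θ x, θ y⁆ = (((h - res B σ (B.baseSupp i) h • foldH0 B σ (toFold σ i) :
        cartan0 B σ) : H) : L) := by
      rw [← LieEquiv.map_lie, hxy, hθt]
    have h2 : (β - β (foldH0 B σ (toFold σ i)) • res B σ (B.baseSupp i))
        (h - res B σ (B.baseSupp i) h • foldH0 B σ (toFold σ i)) = 2 := by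
      simp only [map_sub, map_smul, LinearMap.sub_apply, LinearMap.smul_apply, smul_eq_mul, htwo,
        hβh]
      ring
    have hβ'0 : β - β (foldH0 B σ (toFold σ i)) • res B σ (B.baseSupp i) ≠ 0 := fun h0 => by
      rw [h0] at h2
      simp at h2
    have hx0 : x ≠ 0 := fun h0 => by
      rw [h0, zero_lie] at hxy
      have h1 : h = 0 := Subtype.ext (Subtype.ext hxy.symm)
      rw [h1] at hβh
      simp at hβh
    have hθx0 : θ x ≠ 0 := fun h0 => hx0 (θ.injective (h0.trans (map_zero θ).symm))
    refine ⟨hβ'0, ⟨θ x, hθx, hθx0⟩, ?_, h2, θ x, hθx, θ y, hθy, hθxy⟩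
    refine (weight_pos_or_neg B σ hβ'0 hθx0 hθx.2).resolve_right fun hcon => ?_
    -- the reflection does not change the coefficients outside the orbit of `i`
    obtain ⟨m, hm⟩ := exists_of_mem_res_closure B σ hcon
    classical
    obtain ⟨D, hD, t, ht⟩ := exists_cartan0 B σ hσA
      (r := fun j => if toFold σ j = toFold σ i then 0 else 1) (fun j => by rw [toFold_apply])
    have hval : ∀ n : ι → ℕ, res B σ (∑ j, (n j : ℂ) • B.baseSupp j) t =
        ((D * ∑ j, (n j : ℤ) * if toFold σ j = toFold σ i then 0 else 1 : ℤ) : ℂ) := by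
      intro n
      rw [res_apply, LinearMap.sum_apply, Finset.mul_sum, Int.cast_sum]
      refine Finset.sum_congr rfl fun j _ => ?_
      rw [LinearMap.smul_apply, ht, smul_eq_mul]
      push_cast
      ring
    have h3 := congrArg (fun ν : Dual ℂ (cartan0 B σ) => ν t) hm
    have hti : res B σ (B.baseSupp i) t = 0 := by
      rw [res_apply, ht, if_pos rfl, mul_zero, Int.cast_zero]
    simp only [LinearMap.neg_apply, LinearMap.sub_apply, LinearMap.smul_apply, hti, smul_zero,
      sub_zero] at h3
    rw [hn, hval, hval] at h3
    have h4 : -(D * ∑ j, (n j : ℤ) * if toFold σ j = toFold σ i then 0 else 1) =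
        D * ∑ j, (m j : ℤ) * if toFold σ j = toFold σ i then 0 else 1 := by exact_mod_cast h3
    push Not at hcase
    obtain ⟨j, hj, hnj⟩ := hcase
    have h5 : 0 < ∑ j, (n j : ℤ) * if toFold σ j = toFold σ i then 0 else 1 := by
      refine Finset.sum_pos' (fun k _ => ?_) ⟨j, Finset.mem_univ j, ?_⟩
      · split_ifs <;> simp
      · rw [if_neg hj, mul_one]
        exact_mod_cast Nat.pos_of_ne_zero hnj
    have h6 : 0 ≤ ∑ j, (m j : ℤ) * if toFold σ j = toFold σ i then 0 else 1 :=
      Finset.sum_nonneg fun k _ => by split_ifs <;> simp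
    have h7 := mul_pos hD h5
    have h8 := mul_nonneg hD.le h6
    omega

end PositiveRoots

end FoldedOrbit

end

theorem theorem8
    {L : Type*} [LieRing L] [LieAlgebra ℂ L] [FiniteDimensional ℂ L]
    [LieAlgebra.IsSimple ℂ L] {H : LieSubalgebra ℂ L} [H.IsCartanSubalgebra]
    {ι : Type*} [Fintype ι] (B : LieAlgebra.Basis ι H)
    (hB : FoldedOrbit.IsTypeADE6 B.A)
    (σ : Equiv.Perm ι) (hσ : σ ≠ 1) (hσA : ∀ i j, B.A (σ i) (σ j) = B.A i j)
    (τ : L ≃ₗ⁅ℂ⁆ L) (hτe : ∀ i, τ (B.e i) = B.e (σ i)) (hτf : ∀ i, τ (B.f i) = B.f (σ i))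
    (lam : Module.Dual ℂ H) (hlam : FoldedOrbit.IsMinuscule B lam) (hlam0 : lam ≠ 0) :
    -- restriction is a bijection between the two orbits
    Set.BijOn (FoldedOrbit.res B σ) (FoldedOrbit.hatOrbit B σ lam)
      (FoldedOrbit.orbit (FoldedOrbit.foldWeyl B σ) (FoldedOrbit.res B σ lam)) ∧
    -- the colored d-complete poset of `lam` exists
    (∃ (P : Type) (_ : PartialOrder P) (κ : P → ι),
      FoldedOrbit.IsColoredMinusculePoset B lam P κ) ∧
    -- and for every such poset, `f` and its folded version exist, are unique, and satisfy (1), (2)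
    ∀ (P : Type*) [PartialOrder P] (κ : P → ι),
      FoldedOrbit.IsColoredMinusculePoset B lam P κ →
      ∃ f : FoldedOrbit.orbit (FoldedOrbit.weyl B) lam ≃ FoldedOrbit.Filt P,
        FoldedOrbit.IsColoredIso B lam κ f ∧
        (∀ g, FoldedOrbit.IsColoredIso B lam κ g → g = f) ∧
        ∃ ft : FoldedOrbit.orbit (FoldedOrbit.foldWeyl B σ) (FoldedOrbit.res B σ lam) →
            FoldedOrbit.Filt P,
          FoldedOrbit.IsFoldOf B σ lam f ft ∧
          (∀ gt, FoldedOrbit.IsFoldOf B σ lam f gt → gt = ft) ∧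
          FoldedOrbit.IsIsoOntoImage
            (FoldedOrbit.reflLE (FoldedOrbit.foldSimplePairs B σ) _)
            (FoldedOrbit.filtLE fun x => FoldedOrbit.toFold σ (κ x)) ft ∧
          FoldedOrbit.IsIsoOntoImage
            (FoldedOrbit.reflLE (FoldedOrbit.foldPosPairs B σ τ) _)
            (fun F F' : FoldedOrbit.Filt P => (F : Set P) ⊆ F') ft := by
  classical
  have hA := hB.isDynkin
  choose n hn using hlam.1
  have hF : FoldedOrbit.IsFolding B σ lam fun i => (n i : ℤ) :=
    ⟨hA, FoldedOrbit.orth_or_pair hA hB hσA, hσA, hlam, fun i => by rw [hn]; simp⟩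
  have hΨ := FoldedOrbit.isPositiveSystem_foldPosPairs B σ hA hF.orth_or_pair hσA hτe hτf
  refine ⟨hF.bijOn_res, FoldedOrbit.exists_isColoredMinusculePoset B hA hlam hF.apply_h' hlam0,
    fun P _ κ h => ?_⟩
  have hL := FoldedOrbit.IsColoredMinusculePoset.isLabelled B hA hlam hF.apply_h' h
  have hf := FoldedOrbit.isColoredIso_coloredIso B hA hlam hF.apply_h' hL
  refine ⟨_, hf, fun g hg => FoldedOrbit.isColoredIso_unique B hA hlam hF.apply_h' hg hf,
    hF.foldMap hL, hF.isFoldOf_foldMap hL, fun gt hgt => hF.eq_foldMap hL hgt,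
    hF.isIsoOntoImage_simple hL, hF.foldMap_injective hL, fun ν ν' => ?_⟩
  rw [hF.reflLE_iff hΨ, ← hF.foldMap_le_iff hL]
  rfl
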